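/- Let $M$ be an $m\times n$ matrix ($m\ge 1$) whose entries are natural numbers (standing for the symbols of an arbitrary domain), let $\gamma\in[c]^m$ assign a color to every row, and let $k,r\ge 1$ be integers. Write $|\gamma|_a$ for the number of rows of color $a$ and $\tilde c = m/\gcd(|\gamma|_1,\dots,|\gamma|_c)$ for the fairlet size. A cluster of a matrix is a maximal set of pairwise identical rows. An $m\times n$ matrix $M'$ is fair if every cluster $S$ of $M'$ contains, for every color $a$, exactly $\frac{|\gamma|_a}{m}|S|$ rows of color $a$. The edit cost of $M'$ is the number of entries in which $M$ and $M'$ differ. In the problem FDMC (Fair Discrete Means Clustering), a solution of the instance $(M,\gamma,k,r)$ is a fair $m\times n$ matrix with at most $r$ distinct rows and edit cost at most $k$. Theorem. FDMC admits a $(5-3/\tilde c)$-approximate fixed-parameter algorithm with respect to $k$. That is, there are a deterministic algorithm, a computable function $f:\mathbb N\to\mathbb N$ and a constant $d$ such that on every instance $I=(M,\gamma,k,r)$ (with all numbers written in binary) the algorithm halts after at most $f(k)\cdot|I|^{d}$ steps, where $|I|$ is the input length, and either rejects, in which case $I$ has no solution, or outputs a fair $m\times n$ matrix $M'$ with at most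 $r$ distinct rows and edit cost at most $(5-3/\tilde c)\,k$, all of whose entries are symbols that occur in $M$. Here algorithms are WHILE programs over binary trees, in which one step is a bounded number of operations on cons cells; this model is equivalent to Turing machines up to polynomial factors in the running time. -/

import Mathlib

/-! ### Machine model

Deterministic one-variable WHILE programs over binary trees with a step count (the standard
WHILE model over LISP-style data). Values are held by reference, so that every unit of cost pays
for a bounded number of operations on cons cells (testing for the empty tree, allocating one cell,
following one pointer, copying one pointer); in particular equality of whole trees and arithmetic
are not primitive. Hence a random access machine with logarithmic cost simulates `T` steps in time
polynomial in `T` and the input length, and a multi-tape Turing machine is simulated with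
constant overhead (a tape is a pair of lists), so that this model has the usual polynomial-time
and fixed-parameter-tractable computations. -/

/-- Finite binary trees: the values on which programs operate. -/
inductive Data where
  | nil : Data
  | node : Data → Data → Data

namespace Data

/-- The left component (`nil` for the empty tree). -/
def hd : Data → Data
  | nil => nil
  | node a _ => a

/-- The right component (`nil` for the empty tree). -/
def tl : Data → Data
  | nil => nil
  | node _ b => b

/-- The number of nodes of a tree, leaves included: the length of an input. -/
def size : Data → ℕ
  | nil => 1
  | node a b => size a + size b + 1

/-- Lists are chains of nodes. -/
def ofList : List Data → Data
  | [] => nil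
  | a :: l => node a (ofList l)

def ofBool : Bool → Data
  | false => nil
  | true => node nil nil

/-- Natural numbers are written in binary (least significant bit first, no leading zeros). -/
def ofNat (a : ℕ) : Data := ofList (a.bits.map ofBool)

/-- A matrix is the list of its rows, and a row is the list of its entries. -/
def ofMatrix {m n : ℕ} (A : Matrix (Fin m) (Fin n) ℕ) : Data :=
  ofList (List.ofFn fun i => ofList (List.ofFn fun j => ofNat (A i j)))

def ofOption {β : Type} (e : β → Data) : Option β → Data
  | none => nil
  | some b => node nil (e b)

end Data

/-- Programs. A program turns one value into one value; truth is being different from `nil`. -/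
inductive Prog where
  | nil : Prog
  | id : Prog
  | hd : Prog
  | tl : Prog
  /-- run both programs on the input and join the two results by a new node -/
  | pair : Prog → Prog → Prog
  /-- `seq p q`: first `p`, then `q` on its result -/
  | seq : Prog → Prog → Prog
  /-- `cond b p q`: if `b` then `p` else `q` -/
  | cond : Prog → Prog → Prog → Prog
  /-- `loop b p`: while `b` holds of the current value `x`, do `x := p x` -/
  | loop : Prog → Prog → Prog

/-- `Runs p x y t`: the program `p` on input `x` halts with output `y` after `t` steps. -/
inductive Prog.Runs : Prog → Data → Data → ℕ → Prop where
  | nil (x : Data) : Runs .nil x .nil 1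
  | id (x : Data) : Runs .id x x 1
  | hd (x : Data) : Runs .hd x x.hd 1
  | tl (x : Data) : Runs .tl x x.tl 1
  | pair {p q : Prog} {x y z : Data} {s t : ℕ} :
      Runs p x y s → Runs q x z t → Runs (.pair p q) x (.node y z) (s + t + 1)
  | seq {p q : Prog} {x y z : Data} {s t : ℕ} :
      Runs p x y s → Runs q y z t → Runs (.seq p q) x z (s + t + 1)
  | cond_true {b p q : Prog} {x y v : Data} {s t : ℕ} :
      Runs b x v s → v ≠ .nil → Runs p x y t → Runs (.cond b p q) x y (s + t + 1)
  | cond_false {b p q : Prog} {x y : Data} {s t : ℕ} :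
      Runs b x .nil s → Runs q x y t → Runs (.cond b p q) x y (s + t + 1)
  | loop_stop {b p : Prog} {x : Data} {s : ℕ} :
      Runs b x .nil s → Runs (.loop b p) x x (s + 1)
  | loop_step {b p : Prog} {x y z v : Data} {s t u : ℕ} :
      Runs b x v s → v ≠ .nil → Runs p x y t → Runs (.loop b p) y z u →
        Runs (.loop b p) x z (s + t + u + 1)

/-- Programs are deterministic: output and step count are determined by the input. -/
theorem Prog.Runs.unique {p : Prog} {x y y' : Data} {t t' : ℕ}
    (h : Prog.Runs p x y t) (h' : Prog.Runs p x y' t') : y = y' ∧ t = t' := by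
  induction h generalizing y' t' with
  | nil | id | hd | tl => cases h'; exact ⟨rfl, rfl⟩
  | pair _ _ ih₁ ih₂ =>
    cases h' with
    | pair a b =>
      obtain ⟨rfl, rfl⟩ := ih₁ a
      obtain ⟨rfl, rfl⟩ := ih₂ b
      exact ⟨rfl, rfl⟩
  | seq _ _ ih₁ ih₂ =>
    cases h' with
    | seq a b =>
      obtain ⟨rfl, rfl⟩ := ih₁ a
      obtain ⟨rfl, rfl⟩ := ih₂ b
      exact ⟨rfl, rfl⟩
  | cond_true _ hv _ ih₁ ih₂ =>
    cases h' with
    | cond_true a _ b =>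
      obtain ⟨rfl, rfl⟩ := ih₁ a
      obtain ⟨rfl, rfl⟩ := ih₂ b
      exact ⟨rfl, rfl⟩
    | cond_false a b => exact absurd (ih₁ a).1 hv
  | cond_false _ _ ih₁ ih₂ =>
    cases h' with
    | cond_true a hv b => exact absurd (ih₁ a).1.symm hv
    | cond_false a b =>
      obtain ⟨_, rfl⟩ := ih₁ a
      obtain ⟨rfl, rfl⟩ := ih₂ b
      exact ⟨rfl, rfl⟩
  | loop_stop _ ih₁ =>
    cases h' with
    | loop_stop a =>
      obtain ⟨_, rfl⟩ := ih₁ a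
      exact ⟨rfl, rfl⟩
    | loop_step a hv _ _ => exact absurd (ih₁ a).1.symm hv
  | loop_step _ hv _ _ ih₁ ih₂ ih₃ =>
    cases h' with
    | loop_stop a => exact absurd (ih₁ a).1 hv
    | loop_step a _ b c =>
      obtain ⟨rfl, rfl⟩ := ih₁ a
      obtain ⟨rfl, rfl⟩ := ih₂ b
      obtain ⟨rfl, rfl⟩ := ih₃ c
      exact ⟨rfl, rfl⟩

/-! ### Fair Discrete Means Clustering -/

namespace FDMC

/-- `|γ|_a`: the number of rows of color `a`. -/
def colorCount {m c : ℕ} (γ : Fin m → Fin c) (a : Fin c) : ℕ :=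
  (Finset.univ.filter fun i => γ i = a).card

/-- The fairlet size `m / gcd (|γ|_1, …, |γ|_c)`; the division is exact, since `m` is the sum
of the color counts. -/
def fairletSize {m c : ℕ} (γ : Fin m → Fin c) : ℕ :=
  m / Finset.univ.gcd (colorCount γ)

/-- The cluster of the type `τ`: all rows that are equal to `τ`. -/
def cluster {m n : ℕ} (A : Matrix (Fin m) (Fin n) ℕ) (τ : Fin n → ℕ) : Finset (Fin m) :=
  {i | A.row i = τ}

/-- A set `S` of rows is fair if it contains exactly `|γ|_a / m * |S|` rows of each color `a`. -/
def FairSet {m c : ℕ} (γ : Fin m → Fin c) (S : Finset (Fin m)) : Prop :=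
  ∀ a : Fin c, ((S.filter fun i => γ i = a).card : ℚ) = (colorCount γ a : ℚ) / m * S.card

/-- A matrix is fair if all its clusters are fair. -/
def FairMatrix {m n c : ℕ} (γ : Fin m → Fin c) (A : Matrix (Fin m) (Fin n) ℕ) : Prop :=
  ∀ i : Fin m, FairSet γ (cluster A (A.row i))

/-- The number of distinct rows. -/
def distinctRows {m n : ℕ} (A : Matrix (Fin m) (Fin n) ℕ) : ℕ :=
  (Finset.univ.image A.row).card

/-- The number of entries in which two matrices differ. -/
def editCost {m n : ℕ} (A B : Matrix (Fin m) (Fin n) ℕ) : ℕ :=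
  (Finset.univ.filter fun e : Fin m × Fin n => A e.1 e.2 ≠ B e.1 e.2).card

/-- Instances `(M, γ, k, r)`; symbols are natural numbers. -/
structure Instance where
  m : ℕ
  n : ℕ
  c : ℕ
  M : Matrix (Fin m) (Fin n) ℕ
  γ : Fin m → Fin c
  k : ℕ
  r : ℕ
  m_pos : 0 < m
  k_pos : 0 < k
  r_pos : 0 < r

namespace Instance

/-- The input given to a program: matrix, list of the colors of the rows, `k` and `r`. -/
def encode (I : Instance) : Data :=
  Data.ofList [Data.ofMatrix I.M, Data.ofList (List.ofFn fun i => Data.ofNat (I.γ i)),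
    Data.ofNat I.k, Data.ofNat I.r]

def IsSolution (I : Instance) (A : Matrix (Fin I.m) (Fin I.n) ℕ) : Prop :=
  FairMatrix I.γ A ∧ editCost I.M A ≤ I.k ∧ distinctRows A ≤ I.r

/-- Correct answers with approximation ratio `α`. The answer `none` (reject) is correct only if the
instance has no solution, over whatever symbols. An answer `some A` is correct if `A` is fair, has
at most `r` distinct rows, is within `α * k` edits, and uses only symbols that occur in `M`, so
that it is a matrix over every domain over which `M` is one. -/
def CorrectAnswer (I : Instance) (α : ℚ) : Option (Matrix (Fin I.m) (Fin I.n) ℕ) → Prop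
  | none => ¬ ∃ A, I.IsSolution A
  | some A => FairMatrix I.γ A ∧ distinctRows A ≤ I.r ∧ (editCost I.M A : ℚ) ≤ α * I.k ∧
      ∀ i j, ∃ i' j', I.M i' j' = A i j

end Instance

/-- There is an `α`-approximate fixed-parameter algorithm with respect to `k`: one program that
answers every instance correctly within `f k * (input length) ^ d` steps, for a computable `f` and
a constant `d`. The ratio `α` may depend on the instance. -/
def AdmitsApproxFPT (α : Instance → ℚ) : Prop :=
  ∃ (p : Prog) (f : ℕ → ℕ) (d : ℕ), Computable f ∧
    ∀ I : Instance, ∃ (ans : Option (Matrix (Fin I.m) (Fin I.n) ℕ)) (t : ℕ),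
      p.Runs I.encode (Data.ofOption Data.ofMatrix ans) t ∧
      t ≤ f I.k * I.encode.size ^ d ∧
      I.CorrectAnswer (α I) ans

end FDMC

/-!
# A `(5 - 3 / c̃)`-approximate fixed-parameter algorithm for Fair Discrete Means Clustering

The algorithm is nondeterministic at heart: an *advice tree* whose height is linear in `k`
controls a polynomial-time computation (`candidate`), and the program tries all trees of this
height, of which there is a number computable from `k`, and outputs the first acceptable
candidate. Acceptance is checked explicitly (`accept`: fair, rows from `M`, at most `r` distinct
rows, cost at most `costFactor * k`, where `costFactor` is `2`, `3`, `4` for `c̃ = 1`, `c̃ = 2`,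
`c̃ ≥ 3`), so an output is correct since `costFactor ≤ 5 - 3 / c̃` (`correctAnswer_of_accept`).
What has to be proved is that some advice leads to an acceptable candidate if there is a solution
`A` (`exists_accepted`).

*Structure of good solutions* (`exists_structured_assignment`). Split the fair clusters of `M`,
the remaining rows of `M`, and the clusters of `A` into fairlets of `c̃` rows. By Birkhoff's
theorem the fairlets in fair clusters of `M` can be matched to the fairlets of `A` such that the
rows not already in the right place have at most the fraction `1 - 1 / c̃` of the cost of `A`
(`exists_matching`). Moving these fairlets as a whole, by exchanging rows of equal color, costs at
most twice that amount in addition (`exists_exchange`), and a further `1` is paid for replacing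
the rows of `A` by rows of `M`. Hence at a cost of at most `(4 - 2 / c̃) * k ≤ costFactor * k` one
may assume that fair clusters move as a whole and that the remaining rows are partitioned into
fair groups of their own.

*Finding such a solution.* At most `2 * k` clusters of `M` are unfair, since each of them loses or
gains an edited row. Starting with every row in the group of its cluster, as long as some group is
unfair, two of its colors are out of balance, so that a row of one of them has to leave the group
or a row of the other one has to enter it; the advice says which, and names the other group
(`exists_repair`). After at most `4 * k` moves all groups are fair. It remains to choose at most
`r` centers among the at most `r + k` distinct rows of `M`, to each of which the groups nearest to
it move. All but `O(k)` centers of a good solution serve only the rows that are equal to them. The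
center that is cheapest to close is either closed, or declared to be one of the exceptional
centers; if it is an unexceptional center of the solution, it can be exchanged for a center that
is not used (`exists_closeCenters`).

The time bounds come from a small calculus of polynomial-time functions on types whose values are
represented by trees: `PolyTime` is closed under composition, case distinction and folds over
lists whose intermediate values have polynomial size, and `fun_prop` derives it for all functions
of the algorithm. The list of all advice trees is computed with the same fold, in time polynomial
in its size.
-/

/-! ### Polynomial-time functions on encoded values -/

def Data.decEq : (x y : Data) → Decidable (x = y)
  | .nil, .nil => isTrue rfl
  | .nil, .node _ _ => isFalse (by simp)
  | .node _ _, .nil => isFalse (by simp)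
  | .node a b, .node c d =>
    match Data.decEq a c, Data.decEq b d with
    | isTrue h, isTrue h' => isTrue (by rw [h, h'])
    | isFalse h, _ => isFalse (by simp [h])
    | _, isFalse h => isFalse (by simp [h])

instance : DecidableEq Data := Data.decEq

/-- Types whose values are represented, without loss, by trees. -/
class Enc (α : Type) where
  enc : α → Data
  enc_injective : Function.Injective enc

open Enc

theorem Data.ofList_injective : Function.Injective Data.ofList := by
  intro l
  induction l with
  | nil => intro l' h; cases l' with
    | nil => rfl
    | cons _ _ => simp [Data.ofList] at h
  | cons a l ih => intro l' h; cases l' with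
    | nil => simp [Data.ofList] at h
    | cons b l' =>
      simp only [Data.ofList, Data.node.injEq] at h
      rw [h.1, ih h.2]

instance : Enc Data := ⟨id, Function.injective_id⟩
instance : Enc Unit := ⟨fun _ => .nil, fun _ _ _ => rfl⟩
instance : Enc Bool := ⟨Data.ofBool, by intro a b h; cases a <;> cases b <;> simp_all [Data.ofBool]⟩
/-- Natural numbers are represented in unary, as a list of empty trees. (The binary
representation of the input is only decoded.) -/
instance : Enc ℕ := ⟨fun n => Data.ofList (List.replicate n .nil), fun a b h => by
  simpa using congrArg List.length (Data.ofList_injective h)⟩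

section PolynomialTime
variable {α β γ σ : Type} [Enc α] [Enc β] [Enc γ] [Enc σ]

instance : Enc (α × β) := ⟨fun p => .node (enc p.1) (enc p.2), fun a b h => by
  simp only [Data.node.injEq] at h
  exact Prod.ext (enc_injective h.1) (enc_injective h.2)⟩
instance : Enc (List α) := ⟨fun l => Data.ofList (l.map enc), fun _ _ h =>
  (List.map_injective_iff.2 enc_injective) (Data.ofList_injective h)⟩
instance : Enc (Option α) := ⟨Data.ofOption enc, fun a b h => by
  cases a <;> cases b <;> simp only [Data.ofOption, Data.node.injEq, reduceCtorEq] at h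
  · rfl
  · rw [enc_injective h.2]⟩

/-- The size of the tree that represents a value. -/
def sz (a : α) : ℕ := (enc a).size

theorem enc_pair (a : α) (b : β) : enc (a, b) = .node (enc a) (enc b) := rfl
theorem enc_nil : enc ([] : List α) = .nil := rfl
theorem enc_cons (a : α) (l : List α) : enc (a :: l) = .node (enc a) (enc l) := rfl
theorem enc_true : enc true = .node .nil .nil := rfl
theorem enc_false : enc false = .nil := rfl
theorem enc_succ (n : ℕ) : enc (n + 1) = .node .nil (enc n) := by
  simp [enc, List.replicate_succ, Data.ofList]
theorem enc_none : enc (none : Option α) = .nil := rfl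
theorem enc_some (a : α) : enc (some a) = .node .nil (enc a) := rfl

theorem Data.size_pos (x : Data) : 0 < x.size := by cases x <;> simp [Data.size]

theorem sz_pos (a : α) : 0 < sz a := Data.size_pos _
theorem sz_pair (a : α) (b : β) : sz (a, b) = sz a + sz b + 1 := rfl
theorem sz_nil : sz ([] : List α) = 1 := rfl
theorem sz_cons (a : α) (l : List α) : sz (a :: l) = sz a + sz l + 1 := rfl
theorem sz_nat (n : ℕ) : sz n = 2 * n + 1 := by
  induction n with
  | zero => rfl
  | succ n ih => simp only [sz, enc_succ, Data.size] at *; omega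

theorem sz_bool_le (b : Bool) : sz b ≤ 3 := by cases b <;> simp [sz, enc, Data.ofBool, Data.size]

theorem sz_append (l l' : List α) : sz (l ++ l') + 1 = sz l + sz l' := by
  induction l with
  | nil => simp [sz_nil]; omega
  | cons a l ih => simp only [List.cons_append, sz_cons]; omega

theorem sz_reverse (l : List α) : sz l.reverse = sz l := by
  induction l with
  | nil => rfl
  | cons a l ih =>
    have h := sz_append l.reverse [a]
    simp only [List.reverse_cons, sz_cons, sz_nil] at *
    omega

theorem length_lt_sz (l : List α) : l.length < sz l := by
  induction l with
  | nil => simp [sz_nil]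
  | cons a l ih => simp only [List.length_cons, sz_cons]; omega

theorem sz_le_of_mem {a : α} {l : List α} (h : a ∈ l) : sz a ≤ sz l := by
  induction l with
  | nil => simp at h
  | cons b l ih =>
    rw [sz_cons]
    rcases List.mem_cons.1 h with rfl | h
    · omega
    · have := ih h; omega

theorem sz_list_le {l : List α} {s : ℕ} (h : ∀ a ∈ l, sz a ≤ s) :
    sz l ≤ l.length * (s + 1) + 1 := by
  induction l with
  | nil => simp [sz_nil]
  | cons a l ih =>
    rw [sz_cons, List.length_cons, Nat.add_mul]
    have := ih fun b hb => h b (List.mem_cons_of_mem _ hb)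
    have := h a List.mem_cons_self
    omega

theorem sz_sublist {l l' : List α} (h : l.Sublist l') : sz l ≤ sz l' := by
  induction h with
  | slnil => exact le_rfl
  | cons a _ ih => rw [sz_cons]; omega
  | cons_cons a _ ih => rw [sz_cons, sz_cons]; omega

/-- `Computes p μ f`: the program `p` computes `f`, and both the number of steps and the size of
the result are bounded by a polynomial in the weight `μ` of the input. -/
def Computes (p : Prog) (μ : α → ℕ) (f : α → β) : Prop :=
  ∃ d : ℕ, ∀ a, (∃ t ≤ (μ a + 2) ^ d, p.Runs (enc a) (enc (f a)) t) ∧ sz (f a) ≤ (μ a + 2) ^ d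

/-- `f` is computable within a number of steps, and with a size of the result, that are polynomial
in the weight `μ` of the input. -/
def PolyTimeIn (μ : α → ℕ) (f : α → β) : Prop := ∃ p : Prog, Computes p μ f

/-- `f` is computable in polynomial time and has values of polynomial size. The bound on the size
does not follow from the one on the time, since programs share subtrees. -/
@[fun_prop]
def PolyTime (f : α → β) : Prop := PolyTimeIn sz f

theorem pow_bound_mono {n d e : ℕ} (h : d ≤ e) : (n + 2) ^ d ≤ (n + 2) ^ e :=
  Nat.pow_le_pow_right (by omega) h

/-- Sums and products of polynomial bounds are below a single power. -/
theorem add_pow_bound (n d e c : ℕ) : (n + 2) ^ d + (n + 2) ^ e + c ≤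
    (n + 2) ^ (d + e + c + 2) := by
  have h1 : (n + 2) ^ d ≤ (n + 2) ^ (d + e) := pow_bound_mono (by omega)
  have h2 : (n + 2) ^ e ≤ (n + 2) ^ (d + e) := pow_bound_mono (by omega)
  have h3 : c + 2 ≤ (n + 2) ^ (c + 2) :=
    (Nat.lt_two_pow_self (n := c + 2)).le.trans (Nat.pow_le_pow_left (by omega) _)
  have h4 : 1 ≤ (n + 2) ^ (d + e) := Nat.one_le_pow _ _ (by omega)
  calc _ ≤ (n + 2) ^ (d + e) * (c + 2) := by nlinarith
    _ ≤ (n + 2) ^ (d + e) * (n + 2) ^ (c + 2) := Nat.mul_le_mul_left _ h3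
    _ = _ := by rw [← pow_add]; congr 1

/-- A convenient form of polynomial boundedness, closed under the arithmetic operations. -/
def PolyBdd {ι : Type} (μ b : ι → ℕ) : Prop := ∃ d, ∀ a, b a ≤ (μ a + 2) ^ d

namespace PolyBdd
variable {ι : Type} {μ b c : ι → ℕ}

theorem mono (hb : PolyBdd μ b) (h : ∀ a, c a ≤ b a) : PolyBdd μ c :=
  let ⟨d, hd⟩ := hb; ⟨d, fun a => (h a).trans (hd a)⟩

theorem self : PolyBdd μ μ := ⟨1, fun a => by rw [pow_one]; omega⟩

theorem const (n : ℕ) : PolyBdd μ fun _ => n := ⟨n, fun a =>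
  (Nat.lt_two_pow_self (n := n)).le.trans (Nat.pow_le_pow_left (by omega) _)⟩

theorem add (hb : PolyBdd μ b) (hc : PolyBdd μ c) : PolyBdd μ fun a => b a + c a := by
  obtain ⟨d, hd⟩ := hb
  obtain ⟨e, he⟩ := hc
  refine ⟨d + e + 0 + 2, fun a => ?_⟩
  have := add_pow_bound (μ a) d e 0
  have := hd a
  show b a + c a ≤ _
  have := he a
  omega

theorem mul (hb : PolyBdd μ b) (hc : PolyBdd μ c) : PolyBdd μ fun a => b a * c a := by
  obtain ⟨d, hd⟩ := hb
  obtain ⟨e, he⟩ := hc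
  exact ⟨d + e, fun a => by rw [pow_add]; exact Nat.mul_le_mul (hd a) (he a)⟩

theorem pow (hb : PolyBdd μ b) (n : ℕ) : PolyBdd μ fun a => b a ^ n := by
  obtain ⟨d, hd⟩ := hb
  exact ⟨d * n, fun a => by rw [pow_mul]; exact Nat.pow_le_pow_left (hd a) n⟩

end PolyBdd

theorem Computes.intro {p : Prog} {μ : α → ℕ} {f : α → β} {b c : α → ℕ}
    (hb : PolyBdd μ b) (hc : PolyBdd μ c)
    (h : ∀ a, ∃ t ≤ b a, p.Runs (enc a) (enc (f a)) t) (h' : ∀ a, sz (f a) ≤ c a) :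
    Computes p μ f := by
  obtain ⟨d, hd⟩ := hb
  obtain ⟨e, he⟩ := hc
  refine ⟨d + e, fun a => ⟨?_, ?_⟩⟩
  · obtain ⟨t, ht, hr⟩ := h a
    exact ⟨t, ht.trans ((hd a).trans (pow_bound_mono (by omega))), hr⟩
  · exact (h' a).trans ((he a).trans (pow_bound_mono (by omega)))

theorem Computes.bounds {p : Prog} {μ : α → ℕ} {f : α → β} (h : Computes p μ f) :
    ∃ b : α → ℕ, PolyBdd μ b ∧ (∀ a, ∃ t ≤ b a, p.Runs (enc a) (enc (f a)) t) ∧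
      ∀ a, sz (f a) ≤ b a := by
  obtain ⟨d, hd⟩ := h
  exact ⟨fun a => (μ a + 2) ^ d, ⟨d, fun a => le_rfl⟩, fun a => (hd a).1, fun a => (hd a).2⟩

theorem PolyTimeIn.size {μ : α → ℕ} {f : α → β} (h : PolyTimeIn μ f) :
    PolyBdd μ fun a => sz (f a) := by
  obtain ⟨p, d, hd⟩ := h
  exact ⟨d, fun a => (hd a).2⟩

theorem PolyTimeIn.comp {μ : α → ℕ} {f : α → β} {g : β → γ} (hg : PolyTime g)
    (hf : PolyTimeIn μ f) : PolyTimeIn μ fun a => g (f a) := by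
  obtain ⟨p, hp⟩ := hf
  obtain ⟨b, hb, hr, hs⟩ := hp.bounds
  obtain ⟨q, e, he⟩ := hg
  have hb' : PolyBdd μ fun a => (b a + 2) ^ e := (hb.add (.const 2)).pow e
  have hle (a : α) : (sz (f a) + 2) ^ e ≤ (b a + 2) ^ e :=
    Nat.pow_le_pow_left (by have := hs a; omega) _
  refine ⟨.seq p q, .intro ((hb.add hb').add (.const 1)) hb' (fun a => ?_)
    fun a => ((he (f a)).2).trans (hle a)⟩
  obtain ⟨t, ht, hrt⟩ := hr a
  obtain ⟨u, hu, hru⟩ := (he (f a)).1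
  have := hle a
  exact ⟨t + u + 1, by omega, hrt.seq hru⟩

theorem PolyTimeIn.pair {μ : α → ℕ} {f : α → β} {g : α → γ} (hf : PolyTimeIn μ f)
    (hg : PolyTimeIn μ g) : PolyTimeIn μ fun a => (f a, g a) := by
  obtain ⟨p, hp⟩ := hf
  obtain ⟨b, hb, hr, hs⟩ := hp.bounds
  obtain ⟨q, hq⟩ := hg
  obtain ⟨c, hc, hr', hs'⟩ := hq.bounds
  have hbc := (hb.add hc).add (.const 1)
  refine ⟨.pair p q, .intro hbc hbc (fun a => ?_) fun a => ?_⟩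
  · obtain ⟨t, ht, hrt⟩ := hr a
    obtain ⟨u, hu, hru⟩ := hr' a
    exact ⟨t + u + 1, by omega, hrt.pair hru⟩
  · have := hs a
    have := hs' a
    rw [sz_pair]
    omega

namespace PolyTime

theorem of_prog {f : α → β} (p : Prog) (T : ℕ) (h : ∀ a, ∃ t ≤ T, p.Runs (enc a) (enc (f a)) t)
    (h' : ∀ a, sz (f a) ≤ sz a + T) : PolyTime f :=
  ⟨p, .intro (.const T) (PolyBdd.self.add (.const T)) h h'⟩

@[fun_prop] theorem id : PolyTime fun x : α => x :=
  of_prog .id 1 (fun a => ⟨1, le_rfl, .id _⟩) fun a => by omega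

@[fun_prop] theorem comp {g : β → γ} {f : α → β} (hg : PolyTime g) (hf : PolyTime f) :
    PolyTime fun x => g (f x) := PolyTimeIn.comp hg hf

@[fun_prop] theorem pair {f : α → β} {g : α → γ} (hf : PolyTime f) (hg : PolyTime g) :
    PolyTime fun x => (f x, g x) := PolyTimeIn.pair hf hg

theorem exists_const (y : Data) : ∃ (p : Prog) (t : ℕ), ∀ x, p.Runs x y t := by
  induction y with
  | nil => exact ⟨.nil, 1, fun x => .nil x⟩
  | node a b iha ihb =>
    obtain ⟨p, t, h⟩ := iha
    obtain ⟨q, u, h'⟩ := ihb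
    exact ⟨.pair p q, t + u + 1, fun x => (h x).pair (h' x)⟩

@[fun_prop] theorem const (b : β) : PolyTime fun _ : α => b := by
  obtain ⟨p, t, h⟩ := exists_const (enc b)
  exact of_prog p (t + sz b) (fun a => ⟨t, by omega, h _⟩) fun a => by omega

@[fun_prop] theorem fst {f : α → β × γ} (hf : PolyTime f) : PolyTime fun x => (f x).1 := by
  have : PolyTime fun x : β × γ => x.1 :=
    of_prog .hd 1 (fun a => ⟨1, le_rfl, .hd _⟩) fun a => by rw [sz_pair a.1 a.2]; omega
  exact this.comp hf

@[fun_prop] theorem snd {f : α → β × γ} (hf : PolyTime f) : PolyTime fun x => (f x).2 := by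
  have : PolyTime fun x : β × γ => x.2 :=
    of_prog .tl 1 (fun a => ⟨1, le_rfl, .tl _⟩) fun a => by rw [sz_pair a.1 a.2]; omega
  exact this.comp hf

theorem cond {f : α → Bool} {g h : α → β} (hf : PolyTime f) (hg : PolyTime g)
    (hh : PolyTime h) : PolyTime fun x => bif f x then g x else h x := by
  obtain ⟨p, hp⟩ := hf
  obtain ⟨b, hb, hr, -⟩ := hp.bounds
  obtain ⟨q, hq⟩ := hg
  obtain ⟨c, hc, hr', hs'⟩ := hq.bounds
  obtain ⟨q', hq'⟩ := hh
  obtain ⟨c', hc', hr'', hs''⟩ := hq'.bounds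
  have hbc := ((hb.add hc).add hc').add (.const 1)
  refine ⟨.cond p q q', .intro hbc (hc.add hc') (fun a => ?_) fun a => ?_⟩
  · obtain ⟨t, ht, hrt⟩ := hr a
    cases hfa : f a with
    | true =>
      obtain ⟨u, hu, hru⟩ := hr' a
      rw [hfa] at hrt
      exact ⟨t + u + 1, by omega, hrt.cond_true (by simp [enc_true]) hru⟩
    | false =>
      obtain ⟨u, hu, hru⟩ := hr'' a
      rw [hfa] at hrt
      exact ⟨t + u + 1, by omega, hrt.cond_false hru⟩
  · have := hs' a
    have := hs'' a
    cases f a <;> simp <;> omega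

@[fun_prop] theorem ite {p : α → Prop} [DecidablePred p] {f g : α → β}
    (hp : PolyTime fun x => decide (p x)) (hf : PolyTime f) (hg : PolyTime g) :
    PolyTime fun x => if p x then f x else g x := by
  simpa only [Bool.cond_decide] using cond hp hf hg

@[fun_prop] theorem decide_eq_true {f : α → Bool} (hf : PolyTime f) :
    PolyTime fun x => decide (f x = true) := by simpa using hf

@[fun_prop] theorem and {f g : α → Bool} (hf : PolyTime f) (hg : PolyTime g) :
    PolyTime fun x => f x && g x := by
  have (x : α) : (f x && g x) = bif f x then g x else false := by cases f x <;> rfl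
  simpa only [this] using cond hf hg (const false)

@[fun_prop] theorem not {f : α → Bool} (hf : PolyTime f) : PolyTime fun x => !f x := by
  have (x : α) : (!f x) = bif f x then false else true := by cases f x <;> rfl
  simpa only [this] using cond hf (const false) (const true)

@[fun_prop] theorem decide_not {p : α → Prop} [DecidablePred p]
    (hp : PolyTime fun x => decide (p x)) : PolyTime fun x => decide (¬ p x) := by
  simpa using not hp

/-- A polynomial-time change of the type that does not change the representation. -/
theorem of_enc_eq {f : α → β} (h : ∀ a, enc (f a) = enc a) : PolyTime f :=
  of_prog .id 1 (fun a => ⟨1, le_rfl, by rw [h]; exact .id _⟩) fun a => by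
    simp only [sz, h]; omega

end PolyTime

/-! ### Iteration over lists -/

/-- The program that folds a list: `pl` and `pi` compute the list and the initial value from the
context, and `ps` computes the next value from context, current value and list element. -/
def foldProg (pl pi ps : Prog) : Prog :=
  .seq (.pair .id (.pair pi pl))
    (.seq (.loop (.seq .tl .tl)
      (.pair .hd (.pair (.seq (.pair .hd (.pair (.seq .tl .hd) (.seq (.seq .tl .tl) .hd))) ps)
        (.seq (.seq .tl .tl) .tl))))
      (.seq .tl .hd))

theorem foldProg_loop_runs {ps : Prog} {g : σ → β → σ} (c : Data) (T : ℕ) (l : List β) (i : σ)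
    (h : ∀ l₁ x l₂, l = l₁ ++ x :: l₂ → ∃ t ≤ T,
      ps.Runs (.node c (.node (enc (l₁.foldl g i)) (enc x))) (enc (g (l₁.foldl g i) x)) t) :
    ∃ t ≤ l.length * (T + 28) + 4,
      (Prog.loop (.seq .tl .tl)
      (.pair .hd (.pair (.seq (.pair .hd (.pair (.seq .tl .hd) (.seq (.seq .tl .tl) .hd))) ps)
        (.seq (.seq .tl .tl) .tl)))).Runs (.node c (.node (enc i) (enc l)))
        (.node c (.node (enc (l.foldl g i)) .nil)) t := by
  induction l generalizing i with
  | nil => exact ⟨_, by omega, Prog.Runs.loop_stop (s := 3) (.seq (.tl _) (.tl _))⟩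
  | cons x l ih =>
    obtain ⟨t, ht, hr⟩ := h [] x l rfl
    obtain ⟨u, hu, hr'⟩ := ih (g i x) fun l₁ y l₂ hl => h (x :: l₁) y l₂ (by simp [hl])
    refine ⟨_, ?_, .loop_step (s := 3) (v := enc (x :: l)) (.seq (.tl _) (.tl _))
        (by simp [enc_cons])
      (.pair (.hd _) (.pair (.seq (.pair (.hd _) (.pair (.seq (.tl _) (.hd _))
        (.seq (.seq (.tl _) (.tl _)) (.hd _)))) hr) (.seq (.seq (.tl _) (.tl _)) (.tl _)))) hr'⟩
    rw [List.length_cons, Nat.succ_mul]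
    omega

theorem PolyTimeIn.foldl {μ : α → ℕ} {f : α → List β} {i : α → σ} {g : α → σ → β → σ}
    (hμ : PolyBdd μ sz)
    (hf : PolyTimeIn μ f) (hi : PolyTimeIn μ i)
    (hg : PolyTime fun p : α × σ × β => g p.1 p.2.1 p.2.2)
    (hb : ∃ b : α → ℕ, PolyBdd μ b ∧ ∀ a l, l <+: f a → sz (l.foldl (g a) (i a)) ≤ b a) :
    PolyTimeIn μ fun a => (f a).foldl (g a) (i a) := by
  obtain ⟨b, hb, hsz⟩ := hb
  have hfs := hf.size
  obtain ⟨pl, hpl⟩ := hf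
  obtain ⟨bl, hbl, hrl, -⟩ := hpl.bounds
  obtain ⟨pi, hpi⟩ := hi
  obtain ⟨bi, hbi, hri, -⟩ := hpi.bounds
  obtain ⟨ps, e, he⟩ := hg
  set T : α → ℕ := fun a => (sz a + (b a + sz (f a) + 1) + 1 + 2) ^ e with hT
  have hTb : PolyBdd μ T :=
    ((((hμ.add ((hb.add hfs).add (.const 1))).add (.const 1)).add (.const 2)).pow e)
  refine ⟨foldProg pl pi ps, .intro (b := fun a => (bl a + bi a) +
    (sz (f a) * (T a + 28) + 20)) ((hbl.add hbi).add
        ((hfs.mul (hTb.add (.const 28))).add (.const 20)))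
    hb (fun a => ?_) fun a => hsz a _ (List.prefix_rfl)⟩
  obtain ⟨t, ht, hr⟩ := hrl a
  obtain ⟨u, hu, hr'⟩ := hri a
  obtain ⟨v, hv, hr''⟩ := foldProg_loop_runs (g := g a) (ps := ps) (enc a) (T a) (f a) (i a)
    fun l₁ x l₂ hl => by
      obtain ⟨⟨t, ht, hr⟩, -⟩ := he (a, l₁.foldl (g a) (i a), x)
      refine ⟨t, ht.trans (Nat.pow_le_pow_left ?_ _), hr⟩
      have h1 := hsz a l₁ ⟨x :: l₂, hl.symm⟩
      have h2 : sz x ≤ sz (f a) := sz_le_of_mem (by simp [hl])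
      rw [sz_pair, sz_pair]
      omega
  refine ⟨_, ?_, .seq (.pair (.id _) (.pair hr' hr)) (.seq hr'' (.seq (.tl _) (.hd _)))⟩
  have h1 := length_lt_sz (f a)
  have h2 : (f a).length * (T a + 28) ≤ sz (f a) * (T a + 28) := Nat.mul_le_mul_right _ h1.le
  omega

theorem PolyBdd.size_of {f : α → β} (h : PolyTime f) : PolyBdd sz fun a => sz (f a) :=
  PolyTimeIn.size h

/-! ### Equality of trees -/

/-- One round of the comparison of trees: the state consists of the value "true" and a stack of
pairs that remain to be compared, or is the empty tree once a difference has been found. -/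
def eqBody : Prog :=
  let top : Prog := .seq .tl .hd
  let rest : Prog := .seq .tl .tl
  let x : Prog := .seq top .hd
  let y : Prog := .seq top .tl
  .cond x (.cond y (.pair .hd (.pair (.pair (.seq x .hd) (.seq y .hd))
    (.pair (.pair (.seq x .tl) (.seq y .tl)) rest))) .nil) (.cond y .nil (.pair .hd rest))

/-- The program that compares the two components of its input. The loop ends when the stack is
empty; then the state is a pair with first component true, or the empty tree. -/
def eqProg : Prog :=
  .seq (.pair (.pair .nil .nil) (.pair .id .nil)) (.seq (.loop .tl eqBody) .hd)

theorem eqBody_loop_runs (n : ℕ) (L : List (Data × Data)) (hL : (L.map fun p => p.1.size).sum ≤ n) :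
    ∃ (z : Data) (t : ℕ), t ≤ n * 60 + 4 ∧
        (Prog.loop .tl eqBody).Runs (.node (enc true) (enc L)) z t ∧
      z.hd = enc (decide (∀ p ∈ L, p.1 = p.2)) := by
  induction n generalizing L with
  | zero =>
    cases L with
    | nil => exact ⟨_, _, by omega, Prog.Runs.loop_stop (.tl _), by simp [Data.hd]⟩
    | cons p L =>
      have := Data.size_pos p.1
      rw [List.map_cons, List.sum_cons] at hL
      omega
  | succ n ih =>
    cases L with
    | nil => exact ⟨_, _, by omega, Prog.Runs.loop_stop (.tl _), by simp [Data.hd]⟩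
    | cons p L =>
      obtain ⟨x, y⟩ := p
      rw [List.map_cons, List.sum_cons] at hL
      have hx : Prog.Runs (.seq (.seq .tl .hd) .hd) (.node (enc true) (enc ((x, y) :: L))) x 5 :=
        .seq (.seq (.tl _) (.hd _)) (.hd _)
      have hy : Prog.Runs (.seq (.seq .tl .hd) .tl) (.node (enc true) (enc ((x, y) :: L))) y 5 :=
        .seq (.seq (.tl _) (.hd _)) (.tl _)
      have hrest : Prog.Runs (.seq .tl .tl) (.node (enc true) (enc ((x, y) :: L))) (enc L) 3 :=
        .seq (.tl _) (.tl _)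
      have htop : enc ((x, y) :: L) ≠ .nil := by simp [enc_cons]
      have hfail : Prog.Runs (.loop .tl eqBody) .nil .nil 2 := Prog.Runs.loop_stop (.tl _)
      cases x with
      | nil =>
        cases y with
        | nil =>
          obtain ⟨z, t, ht, hr, hz⟩ := ih L (by simp only [Data.size] at hL; omega)
          refine ⟨z, _, ?_, .loop_step (.tl _) htop
            (.cond_false hx (.cond_false hy (.pair (.hd _) hrest))) hr, ?_⟩
          · omega
          · rw [hz]; exact congrArg enc (decide_eq_decide.2 (by simp))
        | node c d =>
          refine ⟨_, _, ?_, .loop_step (.tl _) htop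
            (.cond_false hx (.cond_true hy (by simp) (.nil _))) hfail, ?_⟩
          · omega
          · simp [Data.hd, enc_false]
      | node a b =>
        cases y with
        | nil =>
          refine ⟨_, _, ?_, .loop_step (.tl _) htop
            (.cond_true hx (by simp) (.cond_false hy (.nil _))) hfail, ?_⟩
          · omega
          · simp [Data.hd, enc_false]
        | node c d =>
          obtain ⟨z, t, ht, hr, hz⟩ := ih ((a, c) :: (b, d) :: L) (by
            simp only [Data.size, List.map_cons, List.sum_cons] at hL ⊢; omega)
          refine ⟨z, _, ?_, .loop_step (.tl _) htop
            (.cond_true hx (by simp) (.cond_true hy (by simp) (.pair (.hd _) (.pair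
              (.pair (.seq hx (.hd _)) (.seq hy (.hd _)))
              (.pair (.pair (.seq hx (.tl _)) (.seq hy (.tl _))) hrest))))) hr, ?_⟩
          · omega
          · rw [hz]; exact congrArg enc (decide_eq_decide.2 (by simp [and_assoc]))

namespace PolyTime

@[fun_prop] theorem decide_eq [DecidableEq β] {f g : α → β} (hf : PolyTime f) (hg : PolyTime g) :
    PolyTime fun x => decide (f x = g x) := by
  suffices h : PolyTime fun p : β × β => decide (p.1 = p.2) from h.comp (hf.pair hg)
  refine ⟨eqProg, .intro (b := fun a => sz a * 60 + 20) (c := fun _ => 3)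
    ((PolyBdd.self.mul (.const 60)).add (.const 20)) (.const 3) (fun a => ?_)
    fun a => sz_bool_le _⟩
  obtain ⟨z, t, ht, hr, hz⟩ := eqBody_loop_runs (sz a) [(enc a.1, enc a.2)] (by
    simp only [List.map_cons, List.map_nil, List.sum_cons, List.sum_nil]
    have : (enc a).size = (enc a.1).size + (enc a.2).size + 1 := sz_pair a.1 a.2
    rw [sz]
    omega)
  have hdec : decide (a.1 = a.2) = decide (∀ p ∈ [(enc a.1, enc a.2)], p.1 = p.2) := by
    simp [enc_injective.eq_iff]
  rw [hdec, ← hz]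
  refine ⟨_, ?_, .seq (.pair (.pair (.nil _) (.nil _)) (.pair (.id _) (.nil _))) (.seq hr (.hd _))⟩
  omega

/-! ### Lists and options -/

@[fun_prop] theorem cons {f : α → β} {g : α → List β} (hf : PolyTime f) (hg : PolyTime g) :
    PolyTime fun x => f x :: g x := by
  have : PolyTime fun p : β × List β => p.1 :: p.2 := of_enc_eq fun _ => rfl
  exact this.comp (hf.pair hg)

@[fun_prop] theorem some {f : α → β} (hf : PolyTime f) : PolyTime fun x => Option.some (f x) := by
  have : PolyTime fun p : Unit × β => Option.some p.2 := of_enc_eq fun _ => rfl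
  exact this.comp ((const ()).pair hf)

@[fun_prop] theorem tail {f : α → List β} (hf : PolyTime f) : PolyTime fun x => (f x).tail := by
  have : PolyTime fun l : List β => l.tail :=
    of_prog .tl 1 (fun l => ⟨1, le_rfl, by cases l <;> exact .tl _⟩) fun l =>
      (sz_sublist l.tail_sublist).trans (by omega)
  exact this.comp hf

@[fun_prop] theorem head? {f : α → List β} (hf : PolyTime f) : PolyTime fun x => (f x).head? := by
  have : PolyTime fun l : List β => l.head? :=
    of_prog (.cond .id (.pair .nil .hd) .nil) 5 (fun l => by
      cases l with
      | nil => exact ⟨_, by omega, .cond_false (.id _) (.nil _)⟩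
      | cons a l => exact ⟨_, by omega,
          .cond_true (.id _) (by simp [enc_cons]) (.pair (.nil _) (.hd _))⟩)
      fun l => by
        cases l with
        | nil => simp [sz, enc_none, Data.size]
        | cons a l => simp only [List.head?_cons, sz, enc_some, enc_cons, Data.size]; omega
  exact this.comp hf

@[fun_prop] theorem optionElim {f : α → Option β} {g : α → γ} {h : α → β → γ} (hf : PolyTime f)
    (hg : PolyTime g) (hh : PolyTime fun p : α × β => h p.1 p.2) :
    PolyTime fun x => (f x).elim (g x) (h x) := by
  obtain ⟨p, hp⟩ := hf
  obtain ⟨b, hb, hr, hs⟩ := hp.bounds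
  obtain ⟨q, hq⟩ := hg
  obtain ⟨c, hc, hr', hs'⟩ := hq.bounds
  obtain ⟨q', e, he⟩ := hh
  have hc' : PolyBdd sz fun a : α => (sz a + b a + 1 + 2) ^ e :=
    (((PolyBdd.self.add hb).add (.const 1)).add (.const 2)).pow e
  refine ⟨.cond p (.seq (.pair .id (.seq p .tl)) q') q, .intro
    ((((hb.add hb).add hc).add hc').add (.const 9)) (hc.add hc') (fun a => ?_) fun a => ?_⟩
  · obtain ⟨t, ht, hrt⟩ := hr a
    cases hfa : f a with
    | none =>
      obtain ⟨u, hu, hru⟩ := hr' a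
      rw [hfa] at hrt
      exact ⟨t + u + 1, by omega, hrt.cond_false hru⟩
    | some y =>
      obtain ⟨u, hu, hru⟩ := (he (a, y)).1
      have hsa := hs a
      rw [hfa] at hrt hsa
      have hle : (sz (a, y) + 2) ^ e ≤ (sz a + b a + 1 + 2) ^ e := Nat.pow_le_pow_left (by
        rw [sz_pair]
        simp only [sz, enc_some, Data.size] at hsa ⊢
        omega) _
      refine ⟨_, ?_, hrt.cond_true (by simp [enc_some])
          (.seq (.pair (.id _) (.seq hrt (.tl _))) hru)⟩
      omega
  · cases hfa : f a with
    | none =>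
      have := hs' a
      simp only [Option.elim]
      omega
    | some y =>
      have hsa := hs a
      rw [hfa] at hsa
      have hle : (sz (a, y) + 2) ^ e ≤ (sz a + b a + 1 + 2) ^ e := Nat.pow_le_pow_left (by
        rw [sz_pair]
        simp only [sz, enc_some, Data.size] at hsa ⊢
        omega) _
      have := (he (a, y)).2
      simp only [Option.elim]
      dsimp only at this
      omega

@[fun_prop] theorem optionGetD {f : α → Option β} {g : α → β} (hf : PolyTime f)
    (hg : PolyTime g) : PolyTime fun x => (f x).getD (g x) := by
  have (x : α) : (f x).getD (g x) = (f x).elim (g x) fun y => y := by cases f x <;> rfl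
  simp only [this]
  fun_prop

theorem foldl {f : α → List β} {i : α → σ} {g : α → σ → β → σ} (hf : PolyTime f)
    (hi : PolyTime i) (hg : PolyTime fun p : α × σ × β => g p.1 p.2.1 p.2.2)
    (hb : ∃ b : α → ℕ, PolyBdd sz b ∧ ∀ a l, l <+: f a → sz (l.foldl (g a) (i a)) ≤ b a) :
    PolyTime fun a => (f a).foldl (g a) (i a) := PolyTimeIn.foldl .self hf hi hg hb

/-- A fold is in polynomial time if each step adds only a polynomial amount to the value. -/
theorem foldl_of_le {f : α → List β} {i : α → σ} {g : α → σ → β → σ} {c : α × β → ℕ}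
    (hf : PolyTime f) (hi : PolyTime i) (hg : PolyTime fun p : α × σ × β => g p.1 p.2.1 p.2.2)
    (hc : PolyBdd sz c) (hle : ∀ a s x, sz (g a s x) ≤ sz s + c (a, x)) :
    PolyTime fun a => (f a).foldl (g a) (i a) := by
  obtain ⟨d, hd⟩ := hc
  have hsf := PolyBdd.size_of hf
  refine foldl hf hi hg ⟨fun a => sz (i a) + sz (f a) * (sz a + sz (f a) + 1 + 2) ^ d,
    (PolyBdd.size_of hi).add (hsf.mul
      ((((PolyBdd.self.add hsf).add (.const 1)).add (.const 2)).pow d)), fun a l hl => ?_⟩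
  have key : ∀ (l : List β) s, (∀ x ∈ l, x ∈ f a) → sz (l.foldl (g a) s) ≤
      sz s + l.length * (sz a + sz (f a) + 1 + 2) ^ d := by
    intro l
    induction l with
    | nil => intro s _; simp
    | cons x l ih =>
      intro s hl
      have h1 := ih (g a s x) fun y hy => hl y (List.mem_cons_of_mem _ hy)
      have h2 := hle a s x
      have h3 : c (a, x) ≤ (sz a + sz (f a) + 1 + 2) ^ d := (hd _).trans (Nat.pow_le_pow_left (by
        have := sz_le_of_mem (hl x List.mem_cons_self)
        rw [sz_pair]
        omega) _)
      rw [List.foldl_cons, List.length_cons, Nat.succ_mul]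
      omega
  refine (key l (i a) fun x hx => hl.subset hx).trans
      (Nat.add_le_add_left (Nat.mul_le_mul_right _ ?_) _)
  exact hl.length_le.trans (length_lt_sz _).le

@[fun_prop] theorem reverse {f : α → List β} (hf : PolyTime f) :
    PolyTime fun x => (f x).reverse := by
  have (x : α) : (f x).reverse = (f x).foldl (fun l y => y :: l) [] := by
    rw [List.foldl_flip_cons_eq_append']; simp
  simp only [this]
  exact foldl_of_le (c := fun p => sz p) hf (const _) (by fun_prop) .self fun a s x => by
    rw [sz_cons, sz_pair]; omega

@[fun_prop] theorem append {f g : α → List β} (hf : PolyTime f) (hg : PolyTime g) :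
    PolyTime fun x => f x ++ g x := by
  have (x : α) : f x ++ g x = (f x).reverse.foldl (fun l y => y :: l) (g x) := by
    rw [List.foldl_flip_cons_eq_append']; simp
  simp only [this]
  exact foldl_of_le (c := fun p => sz p) hf.reverse hg (by fun_prop) .self fun a s x => by
    rw [sz_cons, sz_pair]; omega

@[fun_prop] theorem flatMap {f : α → List β} {g : α → β → List γ} (hf : PolyTime f)
    (hg : PolyTime fun p : α × β => g p.1 p.2) : PolyTime fun x => (f x).flatMap (g x) := by
  have key : ∀ (x : α) (l : List β) (s : List γ),
      l.foldl (fun s y => s ++ g x y) s = s ++ l.flatMap (g x) := by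
    intro x l
    induction l with
    | nil => simp
    | cons y l ih => intro s; simp [ih]
  have (x : α) : (f x).flatMap (g x) = (f x).foldl (fun s y => s ++ g x y) [] := by simp [key]
  simp only [this]
  refine foldl_of_le (c := fun p => sz (g p.1 p.2)) hf (const _) ?_
      (PolyBdd.size_of hg) fun a s x => by
    have := sz_append s (g a x); dsimp only; omega
  have : PolyTime fun p : α × List γ × β => g p.1 p.2.2 :=
    hg.comp (f := fun p : α × List γ × β => (p.1, p.2.2)) (by fun_prop)
  fun_prop

@[fun_prop] theorem map {f : α → List β} {g : α → β → γ} (hf : PolyTime f)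
    (hg : PolyTime fun p : α × β => g p.1 p.2) : PolyTime fun x => (f x).map (g x) := by
  have (x : α) : (f x).map (g x) = (f x).flatMap fun y => [g x y] := by
    rw [List.map_eq_flatMap]
  simp only [this]
  fun_prop

@[fun_prop] theorem filter {f : α → List β} {g : α → β → Bool} (hf : PolyTime f)
    (hg : PolyTime fun p : α × β => g p.1 p.2) : PolyTime fun x => (f x).filter (g x) := by
  have (x : α) : (f x).filter (g x) = (f x).flatMap fun y => if g x y = true then [y] else [] := by
    induction f x with
    | nil => rfl
    | cons y l ih => rw [List.filter_cons, List.flatMap_cons, ih]; split <;> simp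
  simp only [this]
  fun_prop

@[fun_prop] theorem isEmpty {f : α → List β} (hf : PolyTime f) :
    PolyTime fun x => (f x).isEmpty := by
  have : PolyTime fun l : List β => l.isEmpty :=
    of_prog (.cond .id .nil (.pair .nil .nil)) 5 (fun l => by
      cases l with
      | nil => exact ⟨_, by omega, .cond_false (.id _) (.pair (.nil _) (.nil _))⟩
      | cons a l => exact ⟨_, by omega, .cond_true (.id _) (by simp [enc_cons]) (.nil _)⟩)
      fun l => (sz_bool_le _).trans (by omega)
  exact this.comp hf

@[fun_prop] theorem all {f : α → List β} {g : α → β → Bool} (hf : PolyTime f)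
    (hg : PolyTime fun p : α × β => g p.1 p.2) : PolyTime fun x => (f x).all (g x) := by
  have (x : α) : (f x).all (g x) = ((f x).filter fun y => !g x y).isEmpty := by
    rw [Bool.eq_iff_iff]; simp
  simp only [this]
  fun_prop

@[fun_prop] theorem any {f : α → List β} {g : α → β → Bool} (hf : PolyTime f)
    (hg : PolyTime fun p : α × β => g p.1 p.2) : PolyTime fun x => (f x).any (g x) := by
  have (x : α) : (f x).any (g x) = !((f x).filter (g x)).isEmpty := by
    rw [Bool.eq_iff_iff]; simp
  simp only [this]
  fun_prop

@[fun_prop] theorem decide_mem {f : α → β} {g : α → List β} [∀ x, Decidable (f x ∈ g x)]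
    (hf : PolyTime f) (hg : PolyTime g) : PolyTime fun x => decide (f x ∈ g x) := by
  classical
  have (x : α) : decide (f x ∈ g x) = (g x).any fun y => decide (y = f x) := by
    rw [Bool.eq_iff_iff]; simp
  simp only [this]
  fun_prop

/-! ### Numbers in unary -/

@[fun_prop] theorem units {f : α → ℕ} (hf : PolyTime f) :
    PolyTime fun x => List.replicate (f x) () := by
  have : PolyTime fun n : ℕ => List.replicate n () := of_enc_eq fun n => by
    simp [enc]
  exact this.comp hf

@[fun_prop] theorem length {f : α → List β} (hf : PolyTime f) : PolyTime fun x => (f x).length := by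
  have h : PolyTime fun l : List Unit => l.length := of_enc_eq fun l => by
    simp only [enc, List.map_const']
  have (x : α) : (f x).length = ((f x).map fun _ => ()).length := by simp
  simp only [this]
  exact h.comp (by fun_prop)

@[fun_prop] theorem countP {f : α → List β} {g : α → β → Bool} (hf : PolyTime f)
    (hg : PolyTime fun p : α × β => g p.1 p.2) : PolyTime fun x => (f x).countP (g x) := by
  simp only [List.countP_eq_length_filter]
  fun_prop

@[fun_prop] theorem natAdd {f g : α → ℕ} (hf : PolyTime f) (hg : PolyTime g) :
    PolyTime fun x => f x + g x := by
  have (x : α) : f x + g x = (List.replicate (f x) () ++ List.replicate (g x) ()).length := by simp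
  simp only [this]
  fun_prop

@[fun_prop] theorem natMul {f g : α → ℕ} (hf : PolyTime f) (hg : PolyTime g) :
    PolyTime fun x => f x * g x := by
  have (x : α) : f x * g x =
      ((List.replicate (f x) ()).flatMap fun _ => List.replicate (g x) ()).length := by
    simp
  simp only [this]
  fun_prop

@[fun_prop] theorem drop {f : α → List β} {g : α → ℕ} (hf : PolyTime f) (hg : PolyTime g) :
    PolyTime fun x => (f x).drop (g x) := by
  have key (n : ℕ) (l : List β) : l.drop n = (List.replicate n ()).foldl (fun l _ => l.tail) l := by
    induction n generalizing l with
    | zero => rfl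
    | succ n ih => rw [List.replicate_succ, List.foldl_cons, ← ih, List.drop_tail]
  simp only [key]
  exact foldl_of_le (c := fun _ => 0) (by fun_prop) hf (by fun_prop) (.const 0) fun a s x =>
    sz_sublist s.tail_sublist

@[fun_prop] theorem getElem? {f : α → List β} {g : α → ℕ} (hf : PolyTime f) (hg : PolyTime g) :
    PolyTime fun x => (f x)[g x]? := by
  simp only [← List.head?_drop]
  fun_prop

@[fun_prop] theorem natLe {f g : α → ℕ} (hf : PolyTime f) (hg : PolyTime g) :
    PolyTime fun x => decide (f x ≤ g x) := by
  have (x : α) : decide (f x ≤ g x) = ((List.replicate (f x) ()).drop (g x)).isEmpty := by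
    rw [Bool.eq_iff_iff]; simp; omega
  simp only [this]
  fun_prop

@[fun_prop] theorem natLt {f g : α → ℕ} (hf : PolyTime f) (hg : PolyTime g) :
    PolyTime fun x => decide (f x < g x) := by
  have : PolyTime fun x => decide (f x + 1 ≤ g x) := by fun_prop
  exact this

@[fun_prop] theorem mapSum {f : α → List β} {g : α → β → ℕ} (hf : PolyTime f)
    (hg : PolyTime fun p : α × β => g p.1 p.2) : PolyTime fun x => ((f x).map (g x)).sum := by
  have (x : α) : ((f x).map (g x)).sum =
      ((f x).flatMap fun y => List.replicate (g x y) ()).length := by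
    rw [List.length_flatMap]; simp
  simp only [this]
  fun_prop

@[fun_prop] theorem argmin {f : α → List β} {g : α → β → ℕ} (hf : PolyTime f)
    (hg : PolyTime fun p : α × β => g p.1 p.2) : PolyTime fun x => (f x).argmin (g x) := by
  have (x : α) : (f x).argmin (g x) = (f x).foldl (fun o y => o.elim (Option.some y) fun z =>
      if g x y < g x z then Option.some y else Option.some z) none := by
    unfold List.argmin
    congr 1
    funext o y
    cases o <;> simp [List.argAux]
  have hsize (x : α) (l : List β) (hl : l <+: f x) : sz (l.argmin (g x)) ≤ sz (f x) + 2 := by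
    cases h : l.argmin (g x) with
    | none => simp [sz, enc_none, Data.size]
    | some y =>
      have := sz_le_of_mem (hl.subset (List.argmin_mem h))
      simp only [sz, enc_some, Data.size] at this ⊢
      omega
  simp only [this]
  have hg1 : PolyTime fun p : (α × Option β × β) × β => g p.1.1 p.1.2.2 :=
    hg.comp (f := fun p : (α × Option β × β) × β => (p.1.1, p.1.2.2)) (by fun_prop)
  have hg2 : PolyTime fun p : (α × Option β × β) × β => g p.1.1 p.2 :=
    hg.comp (f := fun p : (α × Option β × β) × β => (p.1.1, p.2)) (by fun_prop)
  refine foldl hf (const _) (by fun_prop) ⟨fun x => sz (f x) + 2,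
    (PolyBdd.size_of hf).add (.const 2), fun x l hl => ?_⟩
  refine le_trans (le_of_eq ?_) (hsize x l hl)
  congr 1
  unfold List.argmin
  congr 1
  funext o y
  cases o <;> simp [List.argAux]

@[fun_prop] theorem zip {f : α → List β} {g : α → List γ} (hf : PolyTime f) (hg : PolyTime g) :
    PolyTime fun x => (f x).zip (g x) := by
  set step : List γ × List (β × γ) → β → List γ × List (β × γ) := fun s y =>
    (s.1.tail, s.1.head?.elim s.2 fun z => (y, z) :: s.2) with hstep
  have key : ∀ (l : List β) (l' : List γ) (s : List (β × γ)),
      (l.foldl step (l', s)).2.reverse = s.reverse ++ l.zip l' := by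
    intro l
    induction l with
    | nil => simp
    | cons y l ih =>
      intro l' s
      cases l' with
      | nil =>
        rw [List.foldl_cons]
        exact (ih [] s).trans (by simp)
      | cons z l' =>
        rw [List.foldl_cons]
        exact (ih l' ((y, z) :: s)).trans (by simp)
  have (x : α) : (f x).zip (g x) = ((f x).foldl step (g x, [])).2.reverse := by simp [key]
  simp only [this]
  have hfold : PolyTime fun x => (f x).foldl step (g x, []) := by
    refine foldl hf (by fun_prop) (by fun_prop)
        ⟨fun x => sz (g x) + sz (f x) * (sz (f x) + sz (g x) + 2) + 2,
      ?_, fun x l hl => ?_⟩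
    · have h1 := PolyBdd.size_of hf
      have h2 := PolyBdd.size_of hg
      exact (h2.add (h1.mul ((h1.add h2).add (.const 2)))).add (.const 2)
    · have h1 : ∀ (l : List β) (l' : List γ) (s : List (β × γ)),
          (l.foldl step (l', s)).1 = l'.drop l.length := by
        intro l
        induction l with
        | nil => simp
        | cons y l ih =>
          intro l' s
          rw [List.foldl_cons, hstep, ih]
          simp
      have h2 := key l (g x) []
      rw [List.reverse_nil, List.nil_append] at h2
      have h3 := h1 l (g x) []
      have h4 : sz (l.foldl step (g x, [])).1 ≤ sz (g x) := by
        rw [h3]; exact sz_sublist (List.drop_sublist _ _)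
      have h5 : sz (l.foldl step (g x, [])).2 ≤ sz (f x) * (sz (f x) + sz (g x) + 2) + 1 := by
        rw [← sz_reverse, h2]
        refine (sz_list_le (s := sz (f x) + sz (g x) + 1) fun p hp => ?_).trans ?_
        · obtain ⟨ha, hb⟩ := List.of_mem_zip (a := p.1) (b := p.2) hp
          have := sz_le_of_mem (hl.subset ha)
          have := sz_le_of_mem hb
          have : sz p = sz p.1 + sz p.2 + 1 := sz_pair p.1 p.2
          omega
        · refine Nat.add_le_add_right (Nat.mul_le_mul_right _ ?_) _
          have := hl.length_le
          have := length_lt_sz (f x)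
          have := List.length_zip (l₁ := l) (l₂ := g x)
          omega
      have : sz (l.foldl step (g x, [])) = _ :=
        sz_pair (l.foldl step (g x, [])).1 (l.foldl step (g x, [])).2
      show _ ≤ sz (g x) + sz (f x) * (sz (f x) + sz (g x) + 2) + 2
      omega
  fun_prop

@[fun_prop] theorem zipIdx {f : α → List β} (hf : PolyTime f) : PolyTime fun x => (f x).zipIdx := by
  have (x : α) : (f x).zipIdx = (f x).zip ((f x).foldl (fun l _ => l ++ [l.length]) []) := by
    have : ∀ l : List β, l.foldl (fun l _ => l ++ [l.length]) [] = List.range l.length := by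
      intro l
      induction l using List.reverseRecOn with
      | nil => rfl
      | append_singleton l y ih => simp [ih, List.range_succ]
    rw [this, List.zipIdx_eq_zip_range']
    simp [List.range_eq_range']
  simp only [this]
  have hfold : PolyTime fun x => (f x).foldl (fun (l : List ℕ) _ => l ++ [l.length]) [] := by
    refine foldl hf (const _) (by fun_prop) ⟨fun x => sz (f x) * (2 * sz (f x) + 1 + 1) + 1, ?_,
      fun x l hl => ?_⟩
    · have h1 := PolyBdd.size_of hf
      exact (h1.mul (((((PolyBdd.const 2).mul h1).add (.const 1))).add (.const 1))).add (.const 1)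
    · have h1 : l.foldl (fun (l : List ℕ) _ => l ++ [l.length]) [] = List.range l.length := by
        clear hl
        induction l using List.reverseRecOn with
        | nil => rfl
        | append_singleton l y ih => simp [ih, List.range_succ]
      have h2 := hl.length_le
      have h3 := length_lt_sz (f x)
      rw [h1]
      refine (sz_list_le (s := 2 * sz (f x) + 1) fun n hn => ?_).trans ?_
      · rw [List.mem_range] at hn
        rw [sz_nat]
        omega
      · rw [List.length_range]
        exact Nat.add_le_add_right (Nat.mul_le_mul_right _ (by omega)) _
  fun_prop

end PolyTime

end PolynomialTime

namespace FDMC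
variable {α : Type} [Enc α]

/-! ### The candidate produced from an advice tree -/

/-- A row of the input matrix: the list of its encoded entries. -/
abbrev Row := List Data

/-- Names of groups of rows. The group `(t, 0)` is the one in which all rows equal to `t` start;
the groups `([], j + 1)` are empty at the start. -/
abbrev Label := Row × ℕ

/-- A record consists of the index, the content, the color and the group of a row. -/
abbrev Rec := ℕ × Row × Data × Label

namespace Rec
def idx (x : Rec) : ℕ := x.1
def row (x : Rec) : Row := x.2.1
def color (x : Rec) : Data := x.2.2.1
def label (x : Rec) : Label := x.2.2.2
def setLabel (x : Rec) (ℓ : Label) : Rec := (x.1, x.2.1, x.2.2.1, ℓ)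

@[fun_prop] theorem polyTime_idx {f : α → Rec} (hf : PolyTime f) : PolyTime fun a => (f a).idx := by
  unfold idx; fun_prop
@[fun_prop] theorem polyTime_row {f : α → Rec} (hf : PolyTime f) : PolyTime fun a => (f a).row := by
  unfold row; fun_prop
@[fun_prop] theorem polyTime_color {f : α → Rec} (hf : PolyTime f) :
    PolyTime fun a => (f a).color := by unfold color; fun_prop
@[fun_prop] theorem polyTime_label {f : α → Rec} (hf : PolyTime f) :
    PolyTime fun a => (f a).label := by unfold label; fun_prop
@[fun_prop] theorem polyTime_setLabel {f : α → Rec} {g : α → Label} (hf : PolyTime f)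
    (hg : PolyTime g) : PolyTime fun a => (f a).setLabel (g a) := by unfold setLabel; fun_prop
end Rec

/-- The group in which the rows equal to `t` start. -/
def home (t : Row) : Label := (t, 0)

@[fun_prop] theorem polyTime_home {f : α → Row} (hf : PolyTime f) :
    PolyTime fun a => home (f a) := by unfold home; fun_prop

/-- The `i`-th label: the home of the `i`-th row in `names`, and new labels beyond this list. -/
def resolve (names : List Row) (i : ℕ) : Label := (names[i]?).elim ([], i + 1) home

@[fun_prop] theorem polyTime_resolve {f : α → List Row} {g : α → ℕ} (hf : PolyTime f)
    (hg : PolyTime g) : PolyTime fun a => resolve (f a) (g a) := by unfold resolve; fun_prop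

/-- The pairs of colors `a`, `b` and groups `ℓ` such that `a` is over-represented in the group `ℓ`
in comparison with `b`. -/
def imbalances (L : List (Label × Data)) : List (Label × Data × Data) :=
  L.flatMap fun p => (L.filter fun q => decide
    (L.countP (fun x => decide (x = (p.1, q.2))) * L.countP (fun x => decide (x.2 = p.2)) <
      L.countP (fun x => decide (x = p)) * L.countP (fun x => decide (x.2 = q.2)))).map
    fun q => (p.1, p.2, q.2)

@[fun_prop] theorem polyTime_imbalances {f : α → List (Label × Data)} (hf : PolyTime f) :
    PolyTime fun a => imbalances (f a) := by unfold imbalances; fun_prop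

/-- The groups and the colors of the rows. -/
def labelColors (R : List Rec) : List (Label × Data) := R.map fun x => (x.label, x.color)

@[fun_prop] theorem polyTime_labelColors {f : α → List Rec} (hf : PolyTime f) :
    PolyTime fun a => labelColors (f a) := by unfold labelColors; fun_prop

/-- Moves one row of color `a` from the group `src`, which has to be its home, to the group
`dst`. -/
def transfer (R : List Rec) (src dst : Label) (a : Data) : List Rec :=
  (R.filter fun x => decide (x.label = src) && decide (home x.row = src) &&
    decide (x.color = a)).head?.elim R
    fun y => R.map fun x => if x.idx = y.idx then x.setLabel dst else x

@[fun_prop] theorem polyTime_transfer {f : α → List Rec} {g h : α → Label} {i : α → Data}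
    (hf : PolyTime f) (hg : PolyTime g) (hh : PolyTime h) (hi : PolyTime i) :
    PolyTime fun a => transfer (f a) (g a) (h a) (i a) := by unfold transfer; fun_prop

/-- Treats the first imbalance `(ℓ, a, b)`: depending on the advice, a row of color `a` leaves the
group `ℓ`, or a row of color `b` enters it; the advice also names the other group. -/
def repairStep (names : List Row) (R : List Rec) (c : Bool × ℕ) : List Rec :=
  (imbalances (labelColors R)).head?.elim R fun v =>
    if c.1 = true then transfer R v.1 (resolve names c.2) v.2.1
    else transfer R (resolve names c.2) v.1 v.2.2

/-- The treatment of imbalances according to the advice `l`. -/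
def repair (names : List Row) (R : List Rec) (l : List (Bool × ℕ)) : List Rec :=
  l.foldl (repairStep names) R

/-- The bound for the sizes of the records during the repair. -/
def SizesLe (R : List Rec) (n s : ℕ) : Prop :=
  R.length = n ∧ ∀ x ∈ R, sz x.idx + sz x.row + sz x.color ≤ s ∧ sz x.label ≤ s

theorem SizesLe.transfer {R : List Rec} {n s : ℕ} (h : SizesLe R n s) (src : Label) {dst : Label}
    (hd : sz dst ≤ s) (a : Data) : SizesLe (transfer R src dst a) n s := by
  unfold FDMC.transfer
  cases (R.filter fun x => decide (x.label = src) && decide (home x.row = src) &&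
    decide (x.color = a)).head? with
  | none => exact h
  | some y =>
    refine ⟨by simp [h.1], fun x hx => ?_⟩
    simp only [Option.elim, List.mem_map] at hx
    obtain ⟨z, hz, rfl⟩ := hx
    split
    · exact ⟨(h.2 z hz).1, hd⟩
    · exact h.2 z hz

theorem sz_resolve_le (names : List Row) (i : ℕ) : sz (resolve names i) ≤ sz names + sz i + 5 := by
  unfold resolve
  cases h : names[i]? with
  | none => simp only [Option.elim, sz_pair, sz_nil, sz_nat]; omega
  | some t =>
    have := sz_le_of_mem (List.mem_of_getElem? h)
    simp only [Option.elim, home, sz_pair, sz_nat]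
    omega

theorem label_mem_of_mem_imbalances {L : List (Label × Data)} {v : Label × Data × Data}
    (h : v ∈ imbalances L) : ∃ p ∈ L, p.1 = v.1 := by
  simp only [imbalances, List.mem_flatMap, List.mem_map] at h
  obtain ⟨p, hp, q, -, rfl⟩ := h
  exact ⟨p, hp, rfl⟩

theorem SizesLe.repairStep {R : List Rec} {n s : ℕ} (h : SizesLe R n s) {names : List Row}
    {c : Bool × ℕ} (hc : sz names + sz c.2 + 5 ≤ s) : SizesLe (repairStep names R c) n s := by
  unfold FDMC.repairStep
  cases hv : (imbalances (labelColors R)).head? with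
  | none => exact h
  | some v =>
    simp only [Option.elim]
    split
    · exact h.transfer _ ((sz_resolve_le _ _).trans hc) _
    · obtain ⟨p, hp, hpv⟩ := label_mem_of_mem_imbalances (List.mem_of_head? hv)
      simp only [labelColors, List.mem_map] at hp
      obtain ⟨x, hx, rfl⟩ := hp
      exact h.transfer _ (hpv ▸ (h.2 x hx).2) _

theorem sz_rec (x : Rec) : sz x = sz x.idx + sz x.row + sz x.color + sz x.label + 3 := by
  show sz (x.1, x.2.1, x.2.2.1, x.2.2.2) = _
  simp only [sz_pair, Rec.idx, Rec.row, Rec.color, Rec.label]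
  omega

@[fun_prop] theorem polyTime_repair {f : α → List Row} {g : α → List Rec} {h : α → List (Bool × ℕ)}
    (hf : PolyTime f) (hg : PolyTime g) (hh : PolyTime h) :
    PolyTime fun a => repair (f a) (g a) (h a) := by
  unfold repair
  have hstep : PolyTime fun p : α × List Rec × (Bool × ℕ) => repairStep (f p.1) p.2.1 p.2.2 := by
    unfold repairStep; fun_prop
  set s : α → ℕ := fun a => sz (f a) + sz (g a) + sz (h a) + 5 with hs
  have hsb : PolyBdd sz s := ((PolyBdd.size_of hf).add (.size_of hg)).add (.size_of hh) |>.add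
      (.const 5)
  refine PolyTime.foldl hh hg hstep ⟨fun a => sz (g a) * (2 * s a + 3 + 1) + 1,
    ((PolyBdd.size_of hg).mul (((PolyBdd.const 2).mul hsb).add (.const 3) |>.add (.const 1))).add
        (.const 1),
    fun a l hl => ?_⟩
  have key : ∀ (l : List (Bool × ℕ)) R, (∀ c ∈ l, c ∈ h a) → SizesLe R (g a).length (s a) →
      SizesLe (l.foldl (repairStep (f a)) R) (g a).length (s a) := by
    intro l
    induction l with
    | nil => exact fun R _ h => h
    | cons c l ih =>
      intro R hl hR
      refine ih _ (fun d hd => hl d (List.mem_cons_of_mem _ hd)) (hR.repairStep ?_)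
      have h1 := sz_le_of_mem (hl c List.mem_cons_self)
      have h2 : sz c = sz c.1 + sz c.2 + 1 := sz_pair c.1 c.2
      simp only [hs]
      omega
  obtain ⟨h1, h2⟩ := key l (g a) (fun c hc => hl.subset hc) ⟨rfl, fun x hx => by
    have h1 := sz_le_of_mem hx
    have h2 := sz_rec x
    simp only [hs]
    omega⟩
  refine (sz_list_le (s := 2 * s a + 3) fun x hx => ?_).trans ?_
  · have := h2 x hx
    rw [sz_rec]
    omega
  · rw [h1]
    exact Nat.add_le_add_right (Nat.mul_le_mul_right _ (length_lt_sz _).le) _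

/-- The number of positions in which two rows differ. -/
def rowDist (x y : Row) : ℕ := (x.zip y).countP fun p => decide (¬ p.1 = p.2)

@[fun_prop] theorem polyTime_rowDist {f g : α → Row} (hf : PolyTime f) (hg : PolyTime g) :
    PolyTime fun a => rowDist (f a) (g a) := by unfold rowDist; fun_prop

/-- The distinct elements of a list of rows. -/
def distinct (l : List Row) : List Row := l.foldl (fun s y => if y ∈ s then s else y :: s) []

@[fun_prop] theorem polyTime_distinct {f : α → List Row} (hf : PolyTime f) :
    PolyTime fun a => distinct (f a) :=
  PolyTime.foldl_of_le (c := fun p => sz p) hf (.const _) (by fun_prop) .self fun a s x => by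
    split
    · omega
    · rw [sz_cons, sz_pair]; omega

/-- The number of rows equal to `t`, if they are precisely the members of the home group of `t`,
and `0` otherwise. -/
def weight (R : List Rec) (t : Row) : ℕ :=
  if (R.all fun x => decide (decide (x.label = home t) = decide (x.row = t))) = true then
    R.countP fun x => decide (x.row = t) else 0

/-- The distance from `t` to the nearest element of `Y`, or `0` if there is none. -/
def minDist (t : Row) (Y : List Row) : ℕ := (Y.argmin (rowDist t)).elim 0 (rowDist t)

/-- A lower bound for the cost of not using the center `t`, if the centers are taken from `X`. -/
def closeCost (R : List Rec) (X : List Row) (t : Row) : ℕ :=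
  weight R t * minDist t (X.filter fun c => decide (¬ c = t))

@[fun_prop] theorem polyTime_closeCost {f : α → List Rec} {g : α → List Row} {h : α → Row}
    (hf : PolyTime f) (hg : PolyTime g) (hh : PolyTime h) :
    PolyTime fun a => closeCost (f a) (g a) (h a) := by
  unfold closeCost weight minDist; fun_prop

/-- The state consists of the undecided centers and the ones that will be used. As long as there
are more than `r` of them, the undecided center that is cheapest to close is closed or
declared to be used, as the advice says. -/
def closeStep (R : List Rec) (r : ℕ) (s : List Row × List Row) (b : Bool) : List Row × List Row :=
  if s.1.length + s.2.length ≤ r then s else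
    (s.1.argmin (closeCost R (s.1 ++ s.2))).elim s fun t =>
      (s.1.filter fun c => decide (¬ c = t), if b = true then s.2 else t :: s.2)

/-- The selection of at most `r` of the centers `X` according to the advice `l`. -/
def closeCenters (R : List Rec) (r : ℕ) (X : List Row) (l : List Bool) : List Row × List Row :=
  l.foldl (closeStep R r) (X, [])

theorem sz_filter_ne_add_le {t : Row} {l : List Row} (h : t ∈ l) :
    sz (l.filter fun c => decide (¬ c = t)) + sz t + 1 ≤ sz l := by
  induction l with
  | nil => simp at h
  | cons u l ih =>
    by_cases hu : u = t
    · subst hu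
      rw [List.filter_cons_of_neg (by simp), sz_cons]
      have := sz_sublist (List.filter_sublist (p := fun c => decide (¬ c = u)) (l := l))
      omega
    · rw [List.filter_cons_of_pos (by simpa using hu), sz_cons, sz_cons]
      have := ih ((List.mem_cons.1 h).resolve_left fun h => hu h.symm)
      omega

theorem sz_closeStep_le (R : List Rec) (r : ℕ) (s : List Row × List Row) (b : Bool) :
    sz (closeStep R r s b) ≤ sz s := by
  unfold closeStep
  split
  · exact le_rfl
  · cases h : s.1.argmin (closeCost R (s.1 ++ s.2)) with
    | none => exact le_rfl
    | some t =>
      have h1 := sz_filter_ne_add_le (List.argmin_mem h)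
      have h2 : sz s = sz s.1 + sz s.2 + 1 := sz_pair s.1 s.2
      simp only [Option.elim]
      rw [sz_pair]
      split
      · omega
      · rw [sz_cons]
        omega

@[fun_prop] theorem polyTime_closeCenters {f : α → List Rec} {g : α → ℕ} {h : α → List Row}
    {i : α → List Bool} (hf : PolyTime f) (hg : PolyTime g) (hh : PolyTime h) (hi : PolyTime i) :
    PolyTime fun a => closeCenters (f a) (g a) (h a) (i a) :=
  PolyTime.foldl_of_le (c := fun _ => 0) hi (by fun_prop) (by unfold closeStep; fun_prop) (.const 0)
    fun a s x => sz_closeStep_le _ _ _ _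

/-- The cost of moving all rows of the group `ℓ` to the center `c`. -/
def groupCost (R : List Rec) (ℓ : Label) (c : Row) : ℕ :=
  ((R.filter fun x => decide (x.label = ℓ)).map fun x => rowDist x.row c).sum

/-- Every group moves as a whole to the center in `X` that is cheapest for it. -/
def assign (R : List Rec) (X : List Row) : List Row :=
  R.map fun x => (X.argmin (groupCost R x.label)).getD x.row

@[fun_prop] theorem polyTime_assign {f : α → List Rec} {g : α → List Row} (hf : PolyTime f)
    (hg : PolyTime g) : PolyTime fun a => assign (f a) (g a) := by
  unfold assign groupCost; fun_prop

/-- The factor `min (c̃ + 1) 4`, for the fairlet size `c̃`. -/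
def costFactor (C : List Data) : ℕ :=
  if (C.all fun a => decide (C.countP (fun b => decide (b = a)) = C.length)) = true then 2
  else if (C.all fun a => decide (2 * C.countP (fun b => decide (b = a)) = C.length)) = true then 3
  else 4

@[fun_prop] theorem polyTime_costFactor {f : α → List Data} (hf : PolyTime f) :
    PolyTime fun a => costFactor (f a) := by unfold costFactor; fun_prop

/-- The final test of a candidate `A` for the matrix with rows `M`, colors `C`, cost parameter
`k` and bound `r` for the number of distinct rows. -/
def accept (M : List Row) (C : List Data) (k r : ℕ) (A : List Row) : Bool :=
  decide (A.length = M.length) && A.all (fun x => decide (x ∈ M)) &&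
    (imbalances ((A.map home).zip C)).isEmpty && decide ((distinct A).length ≤ r) &&
    decide (((A.zip M).map fun p => rowDist p.1 p.2).sum ≤ costFactor C * k)

@[fun_prop] theorem polyTime_accept {f : α → List Row} {g : α → List Data} {h i : α → ℕ}
    {j : α → List Row} (hf : PolyTime f) (hg : PolyTime g) (hh : PolyTime h) (hi : PolyTime i)
    (hj : PolyTime j) : PolyTime fun a => accept (f a) (g a) (h a) (i a) (j a) := by
  unfold accept; fun_prop

/-! ### Decoding of numbers and advice -/

/-- One step in the evaluation of a binary number, most significant digit first. -/
def doubleAdd (n : ℕ) (b : Data) : ℕ := n + n + if b = .nil then 0 else 1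

@[fun_prop] theorem polyTime_doubleAdd {f : α → ℕ} {g : α → Data} (hf : PolyTime f)
    (hg : PolyTime g) : PolyTime fun a => doubleAdd (f a) (g a) := by unfold doubleAdd; fun_prop

/-- The minimum of `m` and the number with the given binary digits. -/
def cappedValue (m : ℕ) (l : List Data) : ℕ :=
  l.reverse.foldl (fun n b => if m ≤ doubleAdd n b then m else doubleAdd n b) 0

@[fun_prop] theorem polyTime_cappedValue {f : α → ℕ} {g : α → List Data} (hf : PolyTime f)
    (hg : PolyTime g) : PolyTime fun a => cappedValue (f a) (g a) := by
  refine PolyTime.foldl hg.reverse (.const 0) (by fun_prop) ⟨fun a => sz (f a), .size_of hf,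
    fun a l _ => ?_⟩
  rw [sz_nat, show (fun a => sz (f a)) a = _ from sz_nat (f a)]
  suffices h : l.foldl (fun n b => if f a ≤ doubleAdd n b then f a else doubleAdd n b) 0 ≤
      f a by omega
  induction l using List.reverseRecOn with
  | nil => simp
  | append_singleton l b _ =>
    rw [List.foldl_append, List.foldl_cons, List.foldl_nil]
    split <;> omega

end FDMC

/-- The list of which a tree is the representation. -/
def Data.toList : Data → List Data
  | nil => []
  | node a b => a :: b.toList

theorem Data.toList_ofList (l : List Data) : (Data.ofList l).toList = l := by
  induction l with
  | nil => rfl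
  | cons a l ih => simp [Data.ofList, Data.toList, ih]

theorem Data.ofList_toList (x : Data) : Data.ofList x.toList = x := by
  induction x with
  | nil => rfl
  | node a b _ ih => simp [toList, ofList, ih]

namespace FDMC
variable {α : Type} [Enc α]

@[fun_prop] theorem polyTime_toList {f : α → Data} (hf : PolyTime f) :
    PolyTime fun a => (f a).toList := by
  have : PolyTime Data.toList := .of_enc_eq fun x => by
    show Data.ofList (x.toList.map id) = x
    rw [List.map_id, Data.ofList_toList]
  exact this.comp hf

@[fun_prop] theorem polyTime_dataHd {f : α → Data} (hf : PolyTime f) :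
    PolyTime fun a => (f a).hd := by
  have (x : Data) : x.hd = x.toList.head?.getD .nil := by cases x <;> rfl
  simp only [this]
  fun_prop

@[fun_prop] theorem polyTime_dataTl {f : α → Data} (hf : PolyTime f) :
    PolyTime fun a => (f a).tl := by
  have : PolyTime Data.tl := .of_prog .tl 1 (fun a => ⟨1, le_rfl, .tl _⟩) fun a => by
    cases a <;> simp only [Data.tl, sz, enc, id, Data.size] <;> omega
  exact this.comp hf

/-- The advice for the repair, which is coded in the left component of an advice tree. -/
def moveAdvice (x : Data) : List (Bool × ℕ) :=
  x.hd.toList.map fun y => (decide (¬ y.hd = .nil), y.tl.toList.length)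

/-- The advice for the selection of centers, which is coded in the right component of an advice
tree. -/
def closeAdvice (x : Data) : List Bool := x.tl.toList.map fun y => decide (¬ y = .nil)

/-- The rows with their indices and colors, each in its home group. -/
def initialRecords (M : List Row) (C : List Data) : List Rec :=
  ((M.zip C).zipIdx).map fun p => (p.2, p.1.1, p.1.2, home p.1.1)

/-- The rows whose home group is not fair at the start. -/
def unfairRows (R : List Rec) : List Row :=
  distinct ((imbalances (labelColors R)).map fun v => v.1.1)

/-- The records after the repair with the advice `x`. -/
def repaired (M : List Row) (C : List Data) (x : Data) : List Rec :=
  repair (unfairRows (initialRecords M C)) (initialRecords M C) (moveAdvice x)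

/-- The centers selected among the rows of `M` with the advice `x`. -/
def centers (M : List Row) (r : ℕ) (R : List Rec) (x : Data) : List Row × List Row :=
  closeCenters R r (distinct M) (closeAdvice x)

/-- The candidate that results from the advice `x`. -/
def candidate (M : List Row) (C : List Data) (r : ℕ) (x : Data) : List Row :=
  let R := repaired M C x
  let s := centers M r R x
  assign R (s.1 ++ s.2)

@[fun_prop] theorem polyTime_candidate {f : α → List Row} {g : α → List Data} {h : α → ℕ}
    {i : α → Data} (hf : PolyTime f) (hg : PolyTime g) (hh : PolyTime h) (hi : PolyTime i) :
    PolyTime fun a => candidate (f a) (g a) (h a) (i a) := by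
  unfold candidate centers repaired unfairRows initialRecords moveAdvice closeAdvice; fun_prop

/-- The instances, in the representation that is given to a program. -/
abbrev Input := List Row × List Data × List Data × List Data × Unit

/-- The first acceptable candidate. -/
def firstAccepted (M : List Row) (C : List Data) (k r : ℕ) (advice : List Data) :
    Option (List Row) :=
  ((advice.map (candidate M C r)).filter (accept M C k r)).head?

/-- The part of the algorithm that follows the computation of the list of all advice trees, from
the input, the parameter in unary, and this list. -/
def search (p : Input × ℕ × List Data) : Option (List Row) :=
  firstAccepted p.1.1 p.1.2.1 p.2.1 (cappedValue p.1.1.length p.1.2.2.2.1) p.2.2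

theorem polyTime_search : PolyTime search := by
  unfold search firstAccepted; fun_prop

end FDMC

namespace FDMC

/-! ### The list of all advice trees -/

/-- The number with the given binary digits, least significant digit first. -/
def binaryValue (l : List Data) : ℕ := l.reverse.foldl doubleAdd 0

/-- All trees of height at most `h`. -/
def treesUpTo : ℕ → List Data
  | 0 => [.nil]
  | h + 1 => .nil :: (treesUpTo h).flatMap fun a => (treesUpTo h).map fun b => .node a b

/-- A bound for the size of `treesUpTo h`. -/
def treesBound : ℕ → ℕ
  | 0 => 3
  | h + 1 => (treesBound h * treesBound h + 1) * (2 * treesBound h + 2) + 1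

theorem sz_treesUpTo_le (h : ℕ) : sz (treesUpTo h) ≤ treesBound h := by
  induction h with
  | zero => simp [treesUpTo, treesBound, sz, enc, Data.ofList, Data.size]
  | succ h ih =>
    have hlen := (length_lt_sz (treesUpTo h)).le.trans ih
    refine (sz_list_le (s := 2 * treesBound h + 1) fun x hx => ?_).trans
      (Nat.add_le_add_right (Nat.mul_le_mul_right _ ?_) _)
    · simp only [treesUpTo, List.mem_cons, List.mem_flatMap, List.mem_map] at hx
      rcases hx with rfl | ⟨a, ha, b, hb, rfl⟩
      · simp [sz, enc, Data.size]
      · have h1 := (sz_le_of_mem ha).trans ih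
        have h2 := (sz_le_of_mem hb).trans ih
        simp only [sz, enc, id, Data.size] at *
        omega
    · simp only [treesUpTo, List.length_cons, List.length_flatMap, List.length_map, List.map_const',
        List.sum_replicate, smul_eq_mul]
      exact Nat.add_le_add_right (Nat.mul_le_mul hlen hlen) _

theorem treesBound_le_succ (h : ℕ) : treesBound h ≤ treesBound (h + 1) := by
  rw [treesBound]; nlinarith [Nat.zero_le (treesBound h * treesBound h * (2 * treesBound h + 2))]

theorem treesBound_mono : Monotone treesBound := monotone_nat_of_le_succ treesBound_le_succ

theorem computable_treesBound : Computable treesBound := by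
  have : Primrec fun h : ℕ => h.rec (motive := fun _ => ℕ) 3
      fun _ s => (s * s + 1) * (2 * s + 2) + 1 := by
    refine Primrec.nat_rec₁ 3 ?_
    have hs : Primrec fun p : ℕ × ℕ => p.2 := Primrec.snd
    exact Primrec.nat_add.comp (Primrec.nat_mul.comp
      (Primrec.nat_add.comp (Primrec.nat_mul.comp hs hs) (Primrec.const 1))
      (Primrec.nat_add.comp (Primrec.nat_mul.comp (Primrec.const 2) hs) (Primrec.const 2)))
      (Primrec.const 1)
  refine this.to_comp.of_eq fun h => ?_
  induction h with
  | zero => rfl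
  | succ h ih => simp only [treesBound, ← ih]

/-- The height of a tree. -/
def height : Data → ℕ
  | .nil => 0
  | .node a b => max (height a) (height b) + 1

theorem mem_treesUpTo {x : Data} {h : ℕ} (hx : height x ≤ h) : x ∈ treesUpTo h := by
  induction h generalizing x with
  | zero =>
    cases x with
    | nil => simp [treesUpTo]
    | node a b => simp [height] at hx
  | succ h ih =>
    cases x with
    | nil => simp [treesUpTo]
    | node a b =>
      simp only [height] at hx
      simp only [treesUpTo, List.mem_cons, List.mem_flatMap, List.mem_map]
      exact .inr ⟨a, ih (by omega), b, ih (by omega), rfl⟩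

theorem height_ofList_le {l : List Data} {h : ℕ} (hl : ∀ x ∈ l, height x ≤ h) :
    height (Data.ofList l) ≤ l.length + h := by
  induction l with
  | nil => simp [Data.ofList, height]
  | cons a l ih =>
    have h1 := ih fun x hx => hl x (List.mem_cons_of_mem _ hx)
    have h2 := hl a List.mem_cons_self
    simp only [Data.ofList, height, List.length_cons]
    omega

/-- The height of the advice trees that are tried for the parameter `k`. -/
def adviceHeight (k : ℕ) : ℕ := 20 * k + 20

/-- A bound for the size of all data that depend on the parameter only. -/
def parameterBound (k : ℕ) : ℕ := treesBound (adviceHeight k) + 2 * k + 1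

theorem computable_parameterBound : Computable parameterBound := by
  have hk : Primrec fun k : ℕ => k := Primrec.id
  have h1 : Computable fun k => treesBound (adviceHeight k) :=
    computable_treesBound.comp (Primrec.nat_add.comp
      (Primrec.nat_mul.comp (Primrec.const 20) hk) (Primrec.const 20)).to_comp
  have h2 : Computable fun k : ℕ => 2 * k + 1 :=
    (Primrec.nat_add.comp (Primrec.nat_mul.comp (Primrec.const 2) hk) (Primrec.const 1)).to_comp
  exact (Primrec.nat_add.to_comp.comp h1 h2).of_eq fun k => by
    simp only [parameterBound]; ring

/-- The size of an instance plus the part that depends on the parameter only. -/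
def inputWeight (p : Input) : ℕ := sz p + parameterBound (binaryValue p.2.2.1)

theorem polyBdd_inputWeight_sz : PolyBdd inputWeight sz :=
  PolyBdd.self.mono fun p => by unfold inputWeight; omega

theorem polyBdd_inputWeight_bound :
    PolyBdd inputWeight fun p => parameterBound (binaryValue p.2.2.1) :=
  PolyBdd.self.mono fun p => by unfold inputWeight; omega

theorem _root_.PolyTime.inWeight {f : Input → β} [Enc β] (hf : PolyTime f) :
    PolyTimeIn inputWeight f := by
  have hid : PolyTimeIn inputWeight fun p : Input => p :=
    ⟨.id, .intro (.const 1) polyBdd_inputWeight_sz (fun a => ⟨1, le_rfl, .id _⟩) fun a => le_rfl⟩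
  exact PolyTimeIn.comp hf hid

theorem le_foldl_doubleAdd (n : ℕ) (l : List Data) : n ≤ l.foldl doubleAdd n := by
  induction l generalizing n with
  | nil => exact le_rfl
  | cons b l ih => exact le_trans (by unfold doubleAdd; omega) (ih (doubleAdd n b))

theorem polyTimeIn_binaryValue : PolyTimeIn inputWeight fun p => binaryValue p.2.2.1 := by
  refine PolyTimeIn.foldl polyBdd_inputWeight_sz (PolyTime.inWeight (by fun_prop))
    (PolyTime.inWeight (.const 0)) (by fun_prop) ⟨_, polyBdd_inputWeight_bound, ?_⟩
  rintro p l ⟨l', hl⟩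
  have h1 : l.foldl doubleAdd 0 ≤ binaryValue p.2.2.1 := by
    rw [binaryValue, ← hl, List.foldl_append]
    exact le_foldl_doubleAdd _ _
  rw [sz_nat]
  unfold parameterBound
  omega

@[fun_prop] theorem polyTime_node {α : Type} [Enc α] {f g : α → Data} (hf : PolyTime f)
    (hg : PolyTime g) :
    PolyTime fun a => Data.node (f a) (g a) := by
  have : PolyTime fun p : Data × Data => Data.node p.1 p.2 := .of_enc_eq fun _ => rfl
  exact this.comp (hf.pair hg)

theorem foldl_units_eq_treesUpTo (h : ℕ) : (List.replicate h ()).foldl (fun s _ =>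
    Data.nil :: s.flatMap fun a => s.map fun b => .node a b) [.nil] = treesUpTo h := by
  induction h with
  | zero => rfl
  | succ h ih => rw [List.replicate_succ', List.foldl_append, ih]; rfl

theorem polyTimeIn_treesUpTo :
    PolyTimeIn inputWeight fun p => treesUpTo (adviceHeight (binaryValue p.2.2.1)) := by
  simp only [← foldl_units_eq_treesUpTo]
  refine PolyTimeIn.foldl polyBdd_inputWeight_sz ?_ (PolyTime.inWeight (.const _)) (by fun_prop)
    ⟨_, polyBdd_inputWeight_bound, ?_⟩
  · refine PolyTimeIn.comp (g := fun k => List.replicate (adviceHeight k) ()) ?_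
      polyTimeIn_binaryValue
    unfold adviceHeight
    fun_prop
  · intro p l hl
    obtain ⟨h, rfl⟩ : ∃ h, l = List.replicate h () := ⟨l.length, by
      rw [List.eq_replicate_iff]; exact ⟨rfl, fun _ _ => rfl⟩⟩
    rw [foldl_units_eq_treesUpTo]
    have h1 := hl.length_le
    simp only [List.length_replicate] at h1
    have h2 := (sz_treesUpTo_le h).trans (treesBound_mono h1)
    unfold parameterBound
    omega

/-- The algorithm. -/
def solve (p : Input) : Option (List Row) :=
  search (p, binaryValue p.2.2.1, treesUpTo (adviceHeight (binaryValue p.2.2.1)))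

theorem exists_prog_solve : ∃ (p : Prog) (f : ℕ → ℕ) (d : ℕ), Computable f ∧
    ∀ x : Input, ∃ t ≤ f (binaryValue x.2.2.1) * sz x ^ d, p.Runs (enc x) (enc (solve x)) t := by
  have h : PolyTimeIn inputWeight solve := PolyTimeIn.comp (g := search) polyTime_search
    ((PolyTime.inWeight .id).pair (polyTimeIn_binaryValue.pair polyTimeIn_treesUpTo))
  obtain ⟨p, d, hp⟩ := h
  refine ⟨p, fun k => (parameterBound k + 3) ^ d, d, ?_, fun x => ?_⟩
  · have h1 : Primrec fun n : ℕ => (n + 3) ^ d := by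
      have h2 : Primrec fun n : ℕ => n + 3 :=
        Primrec.nat_add.comp Primrec.id (Primrec.const 3)
      clear hp
      induction d with
      | zero => simpa using Primrec.const 1
      | succ d ih => simpa only [pow_succ] using Primrec.nat_mul.comp ih h2
    exact h1.to_comp.comp computable_parameterBound
  · obtain ⟨t, ht, hr⟩ := (hp x).1
    refine ⟨t, ht.trans ?_, hr⟩
    rw [← mul_pow]
    refine Nat.pow_le_pow_left ?_ _
    have := sz_pos x
    unfold inputWeight
    nlinarith

/-! ### The representation of instances -/

variable {m n : ℕ}

/-- The representation of a row. -/
def encRow (v : Fin n → ℕ) : Row := List.ofFn fun j => Data.ofNat (v j)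

theorem ofBool_injective : Function.Injective Data.ofBool := enc_injective (α := Bool)

theorem ofNat_injective : Function.Injective Data.ofNat := by
  intro a b h
  have h1 := List.map_injective_iff.2 ofBool_injective (Data.ofList_injective h)
  have h2 (a : ℕ) : a.bits.foldr (fun b n => Nat.bit b n) 0 = a := by
    induction a using Nat.binaryRec' with
    | zero => simp
    | bit b n h ih => rw [Nat.bits_append_bit n b h]; simp [ih]
  rw [← h2 a, ← h2 b, h1]

theorem encRow_injective : Function.Injective (encRow (n := n)) := fun v w h => by
  have := List.ofFn_injective h
  funext j
  exact ofNat_injective (congrFun this j)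

/-- The list of the rows of a matrix. -/
def encRows (A : Matrix (Fin m) (Fin n) ℕ) : List Row := List.ofFn fun i => encRow (A i)

theorem enc_encRows (A : Matrix (Fin m) (Fin n) ℕ) : enc (encRows A) = Data.ofMatrix A := by
  show Data.ofList ((encRows A).map fun r => Data.ofList (r.map id)) = _
  simp only [encRows, Data.ofMatrix, List.map_ofFn, encRow]
  congr 2
  funext i
  simp only [Function.comp, List.map_id]

theorem binaryValue_digits (k : ℕ) : binaryValue (k.bits.map Data.ofBool) = k := by
  unfold binaryValue
  rw [List.foldl_reverse]
  induction k using Nat.binaryRec' with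
  | zero => simp
  | bit b n h ih =>
    rw [Nat.bits_append_bit n b h, List.map_cons, List.foldr_cons, ih, doubleAdd, Nat.bit_val]
    cases b <;> simp [Data.ofBool] <;> omega

theorem cappedValue_digits (c k : ℕ) : cappedValue c (k.bits.map Data.ofBool) = min c k := by
  unfold cappedValue
  rw [List.foldl_reverse]
  induction k using Nat.binaryRec' with
  | zero => simp
  | bit b n h ih =>
    rw [Nat.bits_append_bit n b h, List.map_cons, List.foldr_cons, ih, doubleAdd, Nat.bit_val]
    cases b <;> simp [Data.ofBool] <;> split <;> omega

/-- The colors of the rows, as they are given to a program. -/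
def Instance.colors (I : Instance) : List Data := List.ofFn fun i => Data.ofNat (I.γ i)

/-- The input for the instance `I`. -/
def Instance.input (I : Instance) : Input :=
  (encRows I.M, I.colors, I.k.bits.map Data.ofBool, I.r.bits.map Data.ofBool, ())

theorem enc_input (I : Instance) : enc I.input = I.encode := by
  simp only [Instance.input, enc_pair, enc_encRows, Instance.encode, Data.ofList]
  congr 2
  · show Data.ofList (I.colors.map id) = _
    rw [List.map_id]; rfl
  · show Data.node (Data.ofList (List.map id _)) (Data.node (Data.ofList (List.map id _)) _) = _
    rw [List.map_id, List.map_id]; rfl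

end FDMC

namespace FDMC

/-! ### Fair partitions -/

section Fair
variable {ρ ι ι' κ κ' : Type*} [Fintype ρ] [DecidableEq ι] [DecidableEq ι'] [DecidableEq κ]
    [DecidableEq κ']

/-- The partition of the rows `ρ` into the fibers of `Λ` is fair with respect to the colors `γ`. -/
def FairPartition (γ : ρ → κ) (Λ : ρ → ι) : Prop :=
  ∀ ℓ a, (Finset.univ.filter fun i => Λ i = ℓ ∧ γ i = a).card * Fintype.card ρ =
    (Finset.univ.filter fun i => γ i = a).card * (Finset.univ.filter fun i => Λ i = ℓ).card

theorem FairPartition.comp {γ : ρ → κ} {Λ : ρ → ι} (h : FairPartition γ Λ) (f : ι → ι') :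
    FairPartition γ fun i => f (Λ i) := by
  intro ℓ' a
  have h1 (s : Finset ρ) : (s.filter fun i => f (Λ i) = ℓ').card =
      ∑ ℓ ∈ (Finset.univ.image Λ).filter fun ℓ => f ℓ = ℓ', (s.filter fun i => Λ i = ℓ).card := by
    rw [Finset.card_eq_sum_card_fiberwise (f := Λ)
      (t := (Finset.univ.image Λ).filter fun ℓ => f ℓ = ℓ') (by
        intro i hi
        simp only [Finset.coe_filter, Set.mem_ofPred_eq, Finset.mem_image, Finset.mem_univ,
          true_and] at hi ⊢
        exact ⟨⟨i, rfl⟩, hi.2⟩)]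
    refine Finset.sum_congr rfl fun ℓ hℓ => ?_
    rw [Finset.filter_filter]
    congr 1
    ext i
    simp only [Finset.mem_filter] at hℓ ⊢
    constructor
    · rintro ⟨h1, h2, h3⟩; exact ⟨h1, h3⟩
    · rintro ⟨h1, rfl⟩; exact ⟨h1, hℓ.2, rfl⟩
  have h2 := h1 Finset.univ
  have h3 := h1 (Finset.univ.filter fun i => γ i = a)
  rw [Finset.filter_filter] at h3
  simp only [and_comm (a := f (Λ _) = ℓ')]
  rw [h2, h3, Finset.sum_mul, Finset.mul_sum]
  refine Finset.sum_congr rfl fun ℓ _ => ?_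
  rw [Finset.filter_filter, ← h ℓ a]
  simp only [and_comm]

theorem FairPartition.of_comp_injective {γ : ρ → κ} {Λ : ρ → ι} {f : ι → ι'} (hf : f.Injective)
    {g : κ → κ'} (hg : g.Injective)
    (h : FairPartition (fun i => g (γ i)) fun i => f (Λ i)) : FairPartition γ Λ := by
  intro ℓ a
  simpa only [hf.eq_iff, hg.eq_iff] using h (f ℓ) (g a)

theorem FairPartition.comp_color {γ : ρ → κ} {Λ : ρ → ι} (h : FairPartition γ Λ)
    {g : κ → κ'} (hg : g.Injective) : FairPartition (fun i => g (γ i)) Λ := by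
  intro ℓ a
  by_cases ha : ∃ b, g b = a
  · obtain ⟨b, rfl⟩ := ha
    simpa only [hg.eq_iff] using h ℓ b
  · have : ∀ i, g (γ i) ≠ a := fun i h => ha ⟨_, h⟩
    simp [this]

/-- A group is fair if and only if no color is over-represented in comparison with another one. -/
theorem forall_card_mul_card_eq_iff {γ : ρ → κ} {Λ : ρ → ι} {ℓ : ι} :
    (∀ a, (Finset.univ.filter fun i => Λ i = ℓ ∧ γ i = a).card * Fintype.card ρ =
      (Finset.univ.filter fun i => γ i = a).card * (Finset.univ.filter fun i => Λ i = ℓ).card) ↔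
    ∀ i j, Λ i = ℓ → (Finset.univ.filter fun x => Λ x = ℓ ∧ γ x = γ i).card *
      (Finset.univ.filter fun x => γ x = γ j).card ≤
    (Finset.univ.filter fun x => Λ x = ℓ ∧ γ x = γ j).card *
      (Finset.univ.filter fun x => γ x = γ i).card := by
  constructor
  · intro h i j _
    have h1 := h (γ i)
    have h2 := h (γ j)
    have h3 : 0 < Fintype.card ρ := Fintype.card_pos_iff.2 ⟨i⟩
    refine Nat.le_of_mul_le_mul_right ?_ h3
    generalize (Finset.univ.filter fun x => γ x = γ i).card = s at *
    generalize (Finset.univ.filter fun x => γ x = γ j).card = t at *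
    exact le_of_eq (by linear_combination t * h1 + s * h2.symm)
  · intro h a
    set N : κ → ℕ := fun b => (Finset.univ.filter fun x => Λ x = ℓ ∧ γ x = b).card with hN
    set T : κ → ℕ := fun b => (Finset.univ.filter fun x => γ x = b).card with hT
    -- cross-multiplied comparison for arbitrary colors
    have key (i j : ρ) : N (γ i) * T (γ j) ≤ N (γ j) * T (γ i) := by
      by_cases hi : N (γ i) = 0
      · simp [hi]
      · obtain ⟨x, hx⟩ := Finset.card_pos.1 (Nat.pos_of_ne_zero hi)
        simp only [Finset.mem_filter, Finset.mem_univ, true_and] at hx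
        have := h x j hx.1
        rw [hx.2] at this
        exact this
    by_cases ha : ∃ i, γ i = a
    · obtain ⟨i, rfl⟩ := ha
      have h1 : Fintype.card ρ = ∑ b ∈ Finset.univ.image γ, T b :=
        Finset.card_eq_sum_card_fiberwise (s := Finset.univ) fun x _ =>
          Finset.mem_coe.2 (Finset.mem_image_of_mem _ (Finset.mem_univ x))
      have h2 : (Finset.univ.filter fun x => Λ x = ℓ).card = ∑ b ∈ Finset.univ.image γ, N b := by
        rw [Finset.card_eq_sum_card_fiberwise (f := γ) (t := Finset.univ.image γ) fun x _ =>
          Finset.mem_coe.2 (Finset.mem_image_of_mem _ (Finset.mem_univ x))]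
        simp only [hN, Finset.filter_filter]
      show N (γ i) * _ = T (γ i) * _
      rw [h1, h2, Finset.mul_sum, Finset.mul_sum]
      refine Finset.sum_congr rfl fun b hb => ?_
      obtain ⟨j, -, rfl⟩ := Finset.mem_image.1 hb
      rw [mul_comm (T _)]
      exact le_antisymm (key i j) (key j i)
    · have : ∀ i, γ i ≠ a := fun i h => ha ⟨i, h⟩
      simp [this]

theorem fairPartition_iff {γ : ρ → κ} {Λ : ρ → ι} : FairPartition γ Λ ↔ ∀ i j,
    (Finset.univ.filter fun x => Λ x = Λ i ∧ γ x = γ i).card *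
      (Finset.univ.filter fun x => γ x = γ j).card ≤
    (Finset.univ.filter fun x => Λ x = Λ i ∧ γ x = γ j).card *
      (Finset.univ.filter fun x => γ x = γ i).card := by
  simp only [FairPartition, forall_card_mul_card_eq_iff]
  exact ⟨fun h i j => h _ i j rfl, fun h ℓ i j hi => hi ▸ h i j⟩

end Fair

theorem countP_ofFn {α : Type*} {m : ℕ} (f : Fin m → α) (p : α → Bool) :
    (List.ofFn f).countP p = (Finset.univ.filter fun i => p (f i) = true).card := by
  rw [List.ofFn_eq_map, List.countP_map, Finset.card_def, Finset.filter_val, Fin.univ_def,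
    ← Multiset.countP_eq_card_filter, Multiset.coe_countP]
  congr 1
  funext x
  simp

variable {m n : ℕ}

theorem imbalances_ofFn_eq_nil_iff (Λ : Fin m → Label) (γ : Fin m → Data) :
    imbalances (List.ofFn fun i => (Λ i, γ i)) = [] ↔ FairPartition γ Λ := by
  rw [fairPartition_iff, imbalances]
  simp only [countP_ofFn, List.flatMap_eq_nil_iff, List.map_eq_nil_iff, List.filter_eq_nil_iff,
    List.forall_mem_ofFn_iff, decide_eq_true_eq, Prod.mk.injEq, not_lt]

theorem mem_imbalances_ofFn {Λ : Fin m → Label} {γ : Fin m → Data} {v : Label × Data × Data}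
    (h : v ∈ imbalances (List.ofFn fun i => (Λ i, γ i))) :
    (Finset.univ.filter fun x => Λ x = v.1 ∧ γ x = v.2.2).card *
      (Finset.univ.filter fun x => γ x = v.2.1).card <
    (Finset.univ.filter fun x => Λ x = v.1 ∧ γ x = v.2.1).card *
      (Finset.univ.filter fun x => γ x = v.2.2).card := by
  simp only [imbalances, List.mem_flatMap, List.mem_map, List.mem_filter, countP_ofFn,
    decide_eq_true_eq] at h
  obtain ⟨p, -, q, ⟨-, h⟩, rfl⟩ := h
  obtain ⟨p1, p2⟩ := p
  simpa only [Prod.mk.injEq] using h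

theorem exists_mem_imbalances_ofFn_iff {Λ : Fin m → Label} {γ : Fin m → Data} {ℓ : Label} :
    (∃ v ∈ imbalances (List.ofFn fun i => (Λ i, γ i)), v.1 = ℓ) ↔
      ¬ ∀ a, (Finset.univ.filter fun i => Λ i = ℓ ∧ γ i = a).card * Fintype.card (Fin m) =
        (Finset.univ.filter fun i => γ i = a).card *
            (Finset.univ.filter fun i => Λ i = ℓ).card := by
  rw [forall_card_mul_card_eq_iff]
  simp only [imbalances, List.mem_flatMap, List.mem_map, List.mem_filter, countP_ofFn,
    decide_eq_true_eq, List.mem_ofFn', Set.mem_range]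
  push Not
  constructor
  · rintro ⟨v, ⟨p, ⟨i, rfl⟩, q, ⟨⟨j, rfl⟩, h⟩, rfl⟩, rfl⟩
    refine ⟨i, j, rfl, ?_⟩
    simpa only [Prod.mk.injEq] using h
  · rintro ⟨i, j, rfl, h⟩
    refine ⟨_, ⟨_, ⟨i, rfl⟩, _, ⟨⟨j, rfl⟩, ?_⟩, rfl⟩, rfl⟩
    simpa only [Prod.mk.injEq] using h

theorem zip_ofFn {α β : Type*} (f : Fin m → α) (g : Fin m → β) :
    (List.ofFn f).zip (List.ofFn g) = List.ofFn fun i => (f i, g i) := by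
  apply List.ext_getElem <;> simp

theorem fairMatrix_iff {c : ℕ} {γ : Fin m → Fin c} {A : Matrix (Fin m) (Fin n) ℕ} :
    FairMatrix γ A ↔ FairPartition γ A.row := by
  have key (v : Fin n → ℕ) (a : Fin c) (hm : 0 < m) :
      (((cluster A v).filter fun i => γ i = a).card : ℚ) =
          (colorCount γ a : ℚ) / m * (cluster A v).card ↔
      (Finset.univ.filter fun i => A.row i = v ∧ γ i = a).card * Fintype.card (Fin m) =
        (Finset.univ.filter fun i => γ i = a).card *
          (Finset.univ.filter fun i => A.row i = v).card := by
    have hm' : (m : ℚ) ≠ 0 := by positivity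
    rw [div_mul_eq_mul_div, eq_div_iff hm', cluster, Finset.filter_filter, Fintype.card_fin]
    unfold colorCount
    norm_cast
  constructor
  · intro h v a
    by_cases hv : ∃ i, A.row i = v
    · obtain ⟨i, rfl⟩ := hv
      exact (key _ _ (Fin.pos i)).1 (h i a)
    · have : ∀ i, A.row i ≠ v := fun i h => hv ⟨i, h⟩
      simp [this]
  · intro h i a
    exact (key _ _ (Fin.pos i)).2 (h (A.row i) a)

/-! ### Properties of the list operations -/

theorem mem_distinct {l : List Row} {x : Row} : x ∈ distinct l ↔ x ∈ l := by
  induction l using List.reverseRecOn with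
  | nil => simp [distinct]
  | append_singleton l y ih =>
    have : distinct (l ++ [y]) = if y ∈ distinct l then distinct l else y :: distinct l := by
      rw [distinct, List.foldl_append]; rfl
    rw [this]
    split
    · next h =>
      replace h : y ∈ distinct l := h
      simp only [ih, List.mem_append, List.mem_singleton, iff_self_or]
      rintro rfl
      exact ih.1 h
    · simp [ih, or_comm]

theorem nodup_distinct (l : List Row) : (distinct l).Nodup := by
  induction l using List.reverseRecOn with
  | nil => simp [distinct]
  | append_singleton l y ih =>
    have : distinct (l ++ [y]) = if y ∈ distinct l then distinct l else y :: distinct l := by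
      rw [distinct, List.foldl_append]; rfl
    rw [this]
    split
    · exact ih
    · next h => exact List.nodup_cons.2 ⟨h, ih⟩

theorem length_distinct (l : List Row) : (distinct l).length = l.toFinset.card := by
  rw [← List.toFinset_card_of_nodup (nodup_distinct l)]
  congr 1
  ext x
  simp [mem_distinct]

theorem toFinset_encRows (A : Matrix (Fin m) (Fin n) ℕ) :
    (encRows A).toFinset = (Finset.univ.image A.row).image encRow := by
  rw [Finset.image_image]
  ext x
  simp only [encRows, List.mem_toFinset, List.mem_ofFn', Set.mem_range, Finset.mem_image,
    Finset.mem_univ, true_and, Function.comp, Matrix.row]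

theorem length_distinct_encRows (A : Matrix (Fin m) (Fin n) ℕ) :
    (distinct (encRows A)).length = distinctRows A := by
  rw [length_distinct, toFinset_encRows, Finset.card_image_of_injective _ encRow_injective]
  rfl

theorem rowDist_encRow (v w : Fin n → ℕ) : rowDist (encRow v) (encRow w) = hammingDist v w := by
  unfold rowDist encRow
  rw [zip_ofFn, countP_ofFn, hammingDist]
  simp only [decide_eq_true_eq, ofNat_injective.eq_iff, ne_eq]

theorem editCost_eq_sum (A B : Matrix (Fin m) (Fin n) ℕ) :
    editCost A B = ∑ i, hammingDist (A i) (B i) := by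
  unfold editCost hammingDist
  rw [Finset.card_filter, Fintype.sum_prod_type]
  simp only [Finset.card_filter]

/-! ### The factor in the cost bound -/

section Factor
variable {c : ℕ} (γ : Fin m → Fin c)

theorem card_eq_sum_colorCount : m = ∑ a, colorCount γ a := by
  have := Finset.card_eq_sum_card_fiberwise (f := γ) (s := Finset.univ) (t := Finset.univ)
    fun x _ => Finset.mem_coe.2 (Finset.mem_univ _)
  rwa [Finset.card_univ, Fintype.card_fin] at this

theorem gcd_dvd_card : Finset.univ.gcd (colorCount γ) ∣ m := by
  conv_rhs => rw [card_eq_sum_colorCount γ]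
  exact Finset.dvd_sum fun a _ => Finset.gcd_dvd (Finset.mem_univ a)

theorem fairletSize_mul_gcd : fairletSize γ * Finset.univ.gcd (colorCount γ) = m :=
  Nat.div_mul_cancel (gcd_dvd_card γ)

theorem colorCount_pos (i : Fin m) : 0 < colorCount γ (γ i) :=
  Finset.card_pos.2 ⟨i, by simp⟩

theorem gcd_pos (hm : 0 < m) : 0 < Finset.univ.gcd (colorCount γ) :=
  Nat.pos_of_dvd_of_pos (gcd_dvd_card γ) hm

theorem fairletSize_pos (hm : 0 < m) : 0 < fairletSize γ :=
  Nat.pos_of_ne_zero fun h => by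
    have := fairletSize_mul_gcd γ
    rw [h, zero_mul] at this
    omega

/-- If every color that occurs has `m / s` rows, the fairlet size is at most `s`. -/
theorem fairletSize_le_of_forall (hm : 0 < m) {s : ℕ} (hs : 0 < s)
    (h : ∀ i, s * colorCount γ (γ i) = m) : fairletSize γ ≤ s := by
  have h1 : m ∣ Finset.univ.gcd fun a => s * colorCount γ a := by
    refine Finset.dvd_gcd fun a _ => ?_
    by_cases ha : ∃ i, γ i = a
    · obtain ⟨i, rfl⟩ := ha
      rw [h i]
    · have : colorCount γ a = 0 := Finset.card_eq_zero.2 (Finset.filter_eq_empty_iff.2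
        fun i _ hi => ha ⟨i, hi⟩)
      simp [this]
  rw [Finset.gcd_mul_left] at h1
  simp only [normalize_eq] at h1
  have h2 := Nat.le_of_dvd (Nat.mul_pos hs (gcd_pos γ hm)) h1
  refine Nat.le_of_mul_le_mul_right ?_ (gcd_pos γ hm)
  rwa [fairletSize_mul_gcd]

theorem costFactor_ofFn : costFactor (List.ofFn fun i => Data.ofNat (γ i)) =
    if ∀ i, 1 * colorCount γ (γ i) = m then 2 else if ∀ i, 2 * colorCount γ (γ i) = m then 3
    else 4 := by
  have h (i : Fin m) : (Finset.univ.filter fun j => decide (Data.ofNat (γ j) = Data.ofNat (γ i)) =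
      true).card =
      colorCount γ (γ i) := by
    simp only [decide_eq_true_eq, ofNat_injective.eq_iff, Fin.val_inj]
    rfl
  unfold costFactor
  simp only [List.all_eq_true, List.forall_mem_ofFn_iff, decide_eq_true_eq, countP_ofFn,
    List.length_ofFn, one_mul] at h ⊢
  simp only [h]

theorem costFactor_le (hm : 0 < m) : (costFactor (List.ofFn fun i => Data.ofNat (γ i)) : ℚ) ≤
    5 - 3 / (fairletSize γ : ℚ) := by
  have hpos := fairletSize_pos γ hm
  have hdvd (i : Fin m) : Finset.univ.gcd (colorCount γ) ∣ colorCount γ (γ i) :=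
    Finset.gcd_dvd (Finset.mem_univ _)
  have hle (i : Fin m) : colorCount γ (γ i) ≤ m := (Finset.card_le_univ _).trans (by simp)
  have hmul := fairletSize_mul_gcd γ
  have bound (s t : ℚ) (hs : 0 < s) (h : s ≤ fairletSize γ) (ht : t ≤ 5 - 3 / s) :
      t ≤ 5 - 3 / (fairletSize γ : ℚ) := by
    refine ht.trans (sub_le_sub_left ?_ _)
    exact div_le_div_of_nonneg_left (by norm_num) hs h
  have h1 : (∀ i, 1 * colorCount γ (γ i) = m) ∨ 2 ≤ fairletSize γ := by
    by_contra! h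
    obtain ⟨⟨i, hi⟩, h⟩ := h
    obtain ⟨q, hq⟩ := hdvd i
    have h2 := hle i
    have h3 := colorCount_pos γ i
    have h4 : fairletSize γ = 1 := by omega
    rw [h4, one_mul] at hmul
    rw [hmul] at hq
    have h5 : q = 1 := by
      rcases q with _ | _ | q
      · omega
      · rfl
      · rw [hq] at h2; nlinarith
    rw [h5] at hq
    omega
  rw [costFactor_ofFn]
  split_ifs with ha hb
  · exact bound 1 _ (by norm_num) (by exact_mod_cast hpos) (by norm_num)
  · exact bound 2 _ (by norm_num) (by exact_mod_cast h1.resolve_left ha) (by norm_num)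
  · refine bound 3 _ (by norm_num) ?_ (by norm_num)
    have h2 := h1.resolve_left ha
    suffices h : fairletSize γ ≠ 2 by exact_mod_cast (by omega : 3 ≤ fairletSize γ)
    intro h3
    rw [h3] at hmul
    push Not at ha hb
    obtain ⟨i, hi⟩ := ha
    obtain ⟨j, hj⟩ := hb
    have hone (i : Fin m) : colorCount γ (γ i) = Finset.univ.gcd (colorCount γ) ∨
        colorCount γ (γ i) = m := by
      obtain ⟨q, hq⟩ := hdvd i
      have h2 := hle i
      have h3 := colorCount_pos γ i
      rcases q with _ | _ | _ | q
      · omega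
      · left; omega
      · right; omega
      · rw [hq] at h2; nlinarith
    rcases hone j with h | h
    · omega
    · -- a color with all rows is the only color
      have : γ i = γ j := by
        have : (Finset.univ.filter fun x => γ x = γ j) = Finset.univ :=
          Finset.eq_univ_of_card _ (by rw [Fintype.card_fin]; exact h)
        have hmem := Finset.mem_univ i
        rw [← this] at hmem
        exact (Finset.mem_filter.1 hmem).2
      rw [this] at hi
      omega

theorem le_costFactor (hm : 0 < m) : (4 - 2 / (fairletSize γ : ℚ)) ≤
    costFactor (List.ofFn fun i => Data.ofNat (γ i)) := by
  have hpos : (0 : ℚ) < fairletSize γ := by exact_mod_cast fairletSize_pos γ hm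
  rw [costFactor_ofFn]
  have bound (s : ℕ) (hs : 0 < s) (h : ∀ i, s * colorCount γ (γ i) = m) :
      (4 - 2 / (fairletSize γ : ℚ)) ≤ 4 - 2 / s := by
    refine sub_le_sub_left (div_le_div_of_nonneg_left (by norm_num) hpos ?_) _
    exact_mod_cast fairletSize_le_of_forall γ hm hs h
  split_ifs with ha hb
  · refine (bound 1 (by norm_num) ha).trans (by norm_num)
  · refine (bound 2 (by norm_num) hb).trans (by norm_num)
  · have : 0 ≤ 2 / (fairletSize γ : ℚ) := by positivity
    push_cast
    linarith

end Factor

/-! ### Accepted candidates are correct answers -/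

theorem accept_encRows_iff (I : Instance) (A : Matrix (Fin I.m) (Fin I.n) ℕ) (r : ℕ) :
    accept (encRows I.M) I.colors I.k r (encRows A) = true ↔
      (∀ i, ∃ j, A i = I.M j) ∧ FairMatrix I.γ A ∧ distinctRows A ≤ r ∧
      editCost I.M A ≤ costFactor I.colors * I.k := by
  have h1 : (imbalances (((encRows A).map home).zip I.colors)).isEmpty = true ↔
      FairMatrix I.γ A := by
    rw [List.isEmpty_iff, encRows, Instance.colors, List.map_ofFn, zip_ofFn,
      imbalances_ofFn_eq_nil_iff, fairMatrix_iff]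
    have hinj : Function.Injective fun v : Fin I.n → ℕ => home (encRow v) := fun v w h =>
      encRow_injective (Prod.ext_iff.1 h).1
    have hinj' : Function.Injective fun a : Fin I.c => Data.ofNat a := fun a b h =>
      Fin.val_injective (ofNat_injective h)
    exact ⟨fun h => h.of_comp_injective (f := fun v : Fin I.n → ℕ => home (encRow v)) hinj hinj',
      fun h => (h.comp_color hinj').comp fun v : Fin I.n → ℕ => home (encRow v)⟩
  have h2 : (((encRows A).zip (encRows I.M)).map fun p => rowDist p.1 p.2).sum =
      editCost I.M A := by
    rw [encRows, encRows, zip_ofFn, List.map_ofFn, List.sum_ofFn, editCost_eq_sum]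
    refine Finset.sum_congr rfl fun i _ => ?_
    simp only [Function.comp, rowDist_encRow, hammingDist_comm]
  have h3 : (∀ x ∈ encRows A, x ∈ encRows I.M) ↔ ∀ i, ∃ j, A i = I.M j := by
    simp only [encRows]
    rw [List.forall_mem_ofFn_iff]
    simp only [List.mem_ofFn', Set.mem_range, encRow_injective.eq_iff, eq_comm]
  unfold accept
  simp only [Bool.and_eq_true, decide_eq_true_eq, h1, h2, length_distinct_encRows,
    List.all_eq_true, h3]
  simp [encRows, and_assoc]

theorem exists_matrix_of_accept {I : Instance} {r : ℕ} {l : List Row}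
    (h : accept (encRows I.M) I.colors I.k r l = true) :
    ∃ A : Matrix (Fin I.m) (Fin I.n) ℕ, l = encRows A := by
  simp only [accept, Bool.and_eq_true, decide_eq_true_eq, List.all_eq_true] at h
  obtain ⟨⟨⟨⟨h1, h2⟩, -⟩, -⟩, -⟩ := h
  have h1 : l.length = I.m := by simpa [encRows] using h1
  have h3 (i : Fin I.m) : ∃ j, l[i] = encRow (I.M j) := by
    have := h2 l[i] (List.getElem_mem _)
    simp only [encRows, List.mem_ofFn', Set.mem_range] at this
    obtain ⟨j, hj⟩ := this
    exact ⟨j, hj.symm⟩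
  choose g hg using h3
  refine ⟨fun i => I.M (g i), List.ext_getElem (by simp [encRows, h1]) fun i hi _ => ?_⟩
  simpa [encRows] using hg ⟨i, h1 ▸ hi⟩

theorem correctAnswer_of_accept {I : Instance} {r : ℕ} (hr : r ≤ I.r)
    {A : Matrix (Fin I.m) (Fin I.n) ℕ}
    (h : accept (encRows I.M) I.colors I.k r (encRows A) = true) :
    I.CorrectAnswer (5 - 3 / (fairletSize I.γ : ℚ)) (some A) := by
  rw [accept_encRows_iff] at h
  obtain ⟨h1, h2, h3, h4⟩ := h
  refine ⟨h2, h3.trans hr, ?_, fun i j => ?_⟩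
  · refine le_trans (b := ((costFactor I.colors * I.k : ℕ) : ℚ)) (by exact_mod_cast h4) ?_
    rw [Nat.cast_mul]
    exact mul_le_mul_of_nonneg_right (costFactor_le I.γ I.m_pos) (Nat.cast_nonneg _)
  · obtain ⟨i', hi'⟩ := h1 i
    exact ⟨i', j, by rw [hi']⟩

end FDMC

namespace FDMC

/-! ### Blocks and matchings -/

section Blocks
variable {ρ ι κ : Type} [Fintype ρ] [DecidableEq ι] [DecidableEq κ]

theorem FairPartition.of_ne {γ : ρ → κ} {Λ : ρ → ι} (ℓ₀ : ι) (h : ∀ ℓ ≠ ℓ₀, ∀ a,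
    (Finset.univ.filter fun i => Λ i = ℓ ∧ γ i = a).card * Fintype.card ρ =
    (Finset.univ.filter fun i => γ i = a).card * (Finset.univ.filter fun i => Λ i = ℓ).card) :
    FairPartition γ Λ := by
  intro ℓ a
  by_cases hℓ : ℓ = ℓ₀
  · subst hℓ
    have h1 : Fintype.card ρ = ∑ ℓ' ∈ insert ℓ (Finset.univ.image Λ),
        (Finset.univ.filter fun i => Λ i = ℓ').card :=
      Finset.card_eq_sum_card_fiberwise (s := Finset.univ) fun x _ => by simp
    have h2 : (Finset.univ.filter fun i => γ i = a).card = ∑ ℓ' ∈ insert ℓ (Finset.univ.image Λ),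
        (Finset.univ.filter fun i => Λ i = ℓ' ∧ γ i = a).card := by
      rw [Finset.card_eq_sum_card_fiberwise (f := Λ) (t := insert ℓ (Finset.univ.image Λ))
        fun x _ => by simp]
      simp only [Finset.filter_filter, and_comm]
    rw [← Finset.add_sum_erase _ _ (Finset.mem_insert_self _ _)] at h1 h2
    have h3 : (∑ ℓ' ∈ (insert ℓ (Finset.univ.image Λ)).erase ℓ,
          (Finset.univ.filter fun i => Λ i = ℓ' ∧ γ i = a).card) * Fintype.card ρ =
        (Finset.univ.filter fun i => γ i = a).card *
          ∑ ℓ' ∈ (insert ℓ (Finset.univ.image Λ)).erase ℓ,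
            (Finset.univ.filter fun i => Λ i = ℓ').card := by
      rw [Finset.sum_mul, Finset.mul_sum]
      exact Finset.sum_congr rfl fun ℓ' hℓ' => h ℓ' (Finset.ne_of_mem_erase hℓ') a
    set s := ∑ ℓ' ∈ (insert ℓ (Finset.univ.image Λ)).erase ℓ,
          (Finset.univ.filter fun i => Λ i = ℓ' ∧ γ i = a).card
    set t := ∑ ℓ' ∈ (insert ℓ (Finset.univ.image Λ)).erase ℓ,
            (Finset.univ.filter fun i => Λ i = ℓ').card
    generalize Fintype.card ρ = m at *
    generalize (Finset.univ.filter fun i => γ i = a).card = u at *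
    generalize (Finset.univ.filter fun i => Λ i = ℓ ∧ γ i = a).card = v at *
    generalize (Finset.univ.filter fun i => Λ i = ℓ).card = w at *
    zify at h1 h2 h3 ⊢
    linear_combination (u : ℤ) * h1 - (m : ℤ) * h2 - h3
  · exact h ℓ hℓ a

theorem exists_equal_parts {ρ : Type} [DecidableEq ρ] (φ p : ℕ) (S : Finset ρ)
    (hS : S.card = p * φ) :
    ∃ f : ρ → ℕ, (∀ i ∈ S, f i < p) ∧ ∀ q < p, (S.filter fun i => f i = q).card = φ := by
  induction p generalizing S with
  | zero =>
    refine ⟨fun _ => 0, fun i hi => ?_, fun q hq => absurd hq (by omega)⟩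
    rw [zero_mul, Finset.card_eq_zero] at hS
    simp [hS] at hi
  | succ p ih =>
    rw [Nat.succ_mul] at hS
    obtain ⟨U, hU, hUc⟩ := Finset.exists_subset_card_eq (s := S) (n := φ) (by omega)
    obtain ⟨f, hf, hf'⟩ := ih (S \ U) (by rw [Finset.card_sdiff_of_subset hU]; omega)
    refine ⟨fun i => if i ∈ U then p else f i, fun i hi => ?_, fun q hq => ?_⟩
    · dsimp only
      split
      · omega
      · next h => exact (hf i (Finset.mem_sdiff.2 ⟨hi, h⟩)).trans (by omega)
    · by_cases hqp : q = p
      · subst hqp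
        rw [← hUc]
        congr 1
        ext i
        simp only [Finset.mem_filter]
        constructor
        · rintro ⟨h1, h2⟩
          by_contra h
          rw [if_neg h] at h2
          have := hf i (Finset.mem_sdiff.2 ⟨h1, h⟩)
          omega
        · exact fun h => ⟨hU h, if_pos h⟩
      · rw [← hf' q (by omega)]
        congr 1
        ext i
        simp only [Finset.mem_filter, Finset.mem_sdiff]
        constructor
        · rintro ⟨h1, h2⟩
          by_cases h : i ∈ U
          · rw [if_pos h] at h2; omega
          · rw [if_neg h] at h2; exact ⟨⟨h1, h⟩, h2⟩
        · rintro ⟨⟨h1, h⟩, h2⟩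
          exact ⟨h1, by rw [if_neg h]; exact h2⟩

/-- A partition whose parts have color counts that are multiples of `φ` is refined by a partition
into blocks with color counts `φ`. -/
theorem exists_blocks [DecidableEq ρ] {γ : ρ → κ} {Λ : ρ → ι} {φ : κ → ℕ} {N : ℕ}
    (hγ : ∀ a, (Finset.univ.filter fun i => γ i = a).card = N * φ a) (hφ : ∃ a, 0 < φ a)
    (hΛ : ∀ ℓ, ∃ p, ∀ a, (Finset.univ.filter fun i => Λ i = ℓ ∧ γ i = a).card = p * φ a) :
    ∃ g : ρ → Fin N, (∀ G a, (Finset.univ.filter fun i => g i = G ∧ γ i = a).card = φ a) ∧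
      ∀ i j, g i = g j → Λ i = Λ j := by
  choose p hp using hΛ
  choose f hf hf' using fun ℓ a => exists_equal_parts (φ a) (p ℓ) _ (hp ℓ a)
  simp only [Finset.mem_filter, Finset.mem_univ, true_and, Finset.filter_filter] at hf hf'
  set g₀ : ρ → ι × ℕ := fun i => (Λ i, f (Λ i) (γ i) i) with hg₀
  set B : Finset (ι × ℕ) := (Finset.univ.image Λ).biUnion fun ℓ =>
    (Finset.range (p ℓ)).image fun q => (ℓ, q) with hB
  have hmem (x : ι × ℕ) : x ∈ B ↔ (∃ i, Λ i = x.1) ∧ x.2 < p x.1 := by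
    obtain ⟨ℓ, q⟩ := x
    simp only [hB, Finset.mem_biUnion, Finset.mem_image, Finset.mem_univ, true_and,
      Finset.mem_range, Prod.mk.injEq]
    constructor
    · rintro ⟨ℓ', hi, q', hq, rfl, rfl⟩; exact ⟨hi, hq⟩
    · rintro ⟨hi, hq⟩; exact ⟨ℓ, hi, q, hq, rfl, rfl⟩
  have hg₀B (i : ρ) : g₀ i ∈ B := (hmem _).2 ⟨⟨i, rfl⟩, hf _ _ i ⟨rfl, rfl⟩⟩
  have hcount (x : ι × ℕ) (hx : x ∈ B) (a : κ) :
      (Finset.univ.filter fun i => g₀ i = x ∧ γ i = a).card = φ a := by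
    rw [← hf' x.1 a x.2 ((hmem x).1 hx).2]
    congr 1
    ext i
    simp only [hg₀, Finset.mem_filter, Finset.mem_univ, true_and, Prod.ext_iff]
    constructor
    · rintro ⟨⟨h1, h2⟩, h3⟩; exact ⟨⟨h1, h3⟩, by rw [← h2, h1, h3]⟩
    · rintro ⟨⟨h1, h3⟩, h2⟩; exact ⟨⟨h1, by rw [← h2, h1, h3]⟩, h3⟩
  have hcard : B.card = N := by
    obtain ⟨a, ha⟩ := hφ
    have h1 := hγ a
    rw [Finset.card_eq_sum_card_fiberwise (f := g₀) (t := B) fun x _ => Finset.mem_coe.2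
        (hg₀B x)] at h1
    simp only [Finset.filter_filter, and_comm (a := γ _ = a)] at h1
    rw [Finset.sum_congr rfl fun x hx => hcount x hx a, Finset.sum_const, smul_eq_mul] at h1
    exact Nat.eq_of_mul_eq_mul_right ha h1
  let e : B ≃ Fin N := B.equivFinOfCardEq hcard
  refine ⟨fun i => e ⟨g₀ i, hg₀B i⟩, fun G a => ?_, fun i j h => ?_⟩
  · rw [← hcount (e.symm G).1 (e.symm G).2 a]
    congr 1
    ext i
    simp only [Finset.mem_filter, Finset.mem_univ, true_and, ← Equiv.eq_symm_apply, Subtype.ext_iff]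
  · have := Subtype.ext_iff.1 (e.injective h)
    exact (Prod.ext_iff.1 this).1

/-- Two partitions into `N` blocks of `c` rows can be matched such that the rows that are in
different blocks under the matching have at most the average weight, by Birkhoff's theorem. -/
theorem exists_matching {N c : ℕ} (hc : 0 < c) (g h : ρ → Fin N)
    (hg : ∀ G, (Finset.univ.filter fun i => g i = G).card = c)
    (hh : ∀ F, (Finset.univ.filter fun i => h i = F).card = c) (D : Fin N → Fin N → ℕ) :
    ∃ σ : Equiv.Perm (Fin N), c * ∑ i with h i ≠ σ (g i), D (g i) (σ (g i)) ≤
      (c - 1) * ∑ i, D (g i) (h i) := by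
  have hc' : (c : ℚ) ≠ 0 := by positivity
  set ν : Fin N → Fin N → ℕ := fun G F =>
      (Finset.univ.filter fun i => g i = G ∧ h i = F).card with hν
  have hνG (G : Fin N) : ∑ F, ν G F = c := by
    rw [← hg G, Finset.card_eq_sum_card_fiberwise (f := h) (t := Finset.univ) fun x _ => by simp]
    simp only [hν, Finset.filter_filter]
  have hνF (F : Fin N) : ∑ G, ν G F = c := by
    rw [← hh F, Finset.card_eq_sum_card_fiberwise (f := g) (t := Finset.univ) fun x _ => by simp]
    simp only [hν, Finset.filter_filter, and_comm]
  have hX : (Matrix.of fun G F => (ν G F : ℚ) / c) ∈ doublyStochastic ℚ (Fin N) := by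
    rw [mem_doublyStochastic_iff_sum]
    refine ⟨fun G F => by simp only [Matrix.of_apply]; positivity, fun G => ?_, fun F => ?_⟩
    · simp only [Matrix.of_apply]
      rw [← Finset.sum_div, ← Nat.cast_sum, hνG, div_self hc']
    · simp only [Matrix.of_apply]
      rw [← Finset.sum_div, ← Nat.cast_sum, hνF, div_self hc']
  obtain ⟨w, hw, hw1, hwX⟩ := exists_eq_sum_perm_of_mem_doublyStochastic hX
  have hentry (G F : Fin N) : (ν G F : ℚ) / c = ∑ σ : Equiv.Perm (Fin N), w σ * if σ G =
      F then 1 else 0 := by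
    have := congrFun (congrFun hwX G) F
    rw [Matrix.sum_apply] at this
    simp only [Matrix.smul_apply, smul_eq_mul, Equiv.Perm.permMatrix, PEquiv.toMatrix_apply,
      Equiv.toPEquiv_apply, Option.mem_def, Option.some_inj, Matrix.of_apply] at this
    rw [← this]
  -- the weight of the rows that change their block
  set cost : Equiv.Perm (Fin N) → ℚ := fun σ => ∑ G, D G (σ G) * ((c : ℚ) - ν G (σ G)) with hcost
  have hsum : ∑ σ, w σ * cost σ = ∑ G, ∑ F, (ν G F : ℚ) / c * (D G F * ((c : ℚ) - ν G F)) := by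
    simp only [hentry, Finset.sum_mul, hcost, Finset.mul_sum]
    rw [Finset.sum_comm]
    refine Finset.sum_congr rfl fun G _ => ?_
    rw [Finset.sum_comm]
    refine Finset.sum_congr rfl fun σ _ => ?_
    rw [Finset.sum_eq_single (σ G)]
    · simp
    · intro F _ hF
      simp [hF.symm]
    · simp
  have hle : ∑ G, ∑ F, (ν G F : ℚ) / c * (D G F * ((c : ℚ) - ν G F)) ≤
      ((c : ℚ) - 1) / c * ∑ G, ∑ F, (ν G F : ℚ) * D G F := by
    rw [Finset.mul_sum]
    refine Finset.sum_le_sum fun G _ => ?_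
    rw [Finset.mul_sum]
    refine Finset.sum_le_sum fun F _ => ?_
    have h1 : (ν G F : ℚ) ≤ ν G F * ν G F := by exact_mod_cast Nat.le_mul_self _
    have h2 : (0 : ℚ) ≤ D G F / c := by positivity
    calc (ν G F : ℚ) / c * (D G F * ((c : ℚ) - ν G F))
        = (D G F / c : ℚ) * (c * ν G F - ν G F * ν G F) := by ring
      _ ≤ (D G F / c : ℚ) * (c * ν G F - ν G F) := mul_le_mul_of_nonneg_left (by linarith) h2
      _ = _ := by ring
  have hrows : ∑ G, ∑ F, (ν G F : ℚ) * D G F = ∑ i, (D (g i) (h i) : ℚ) := by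
    have h1 (G F : Fin N) : (ν G F : ℚ) * D G F =
        ∑ i, if G = g i ∧ F = h i then (D G F : ℚ) else 0 := by
      rw [← Finset.sum_filter, Finset.sum_const, nsmul_eq_mul]
      simp only [hν, eq_comm]
    simp only [h1]
    rw [Finset.sum_congr rfl fun G _ => Finset.sum_comm, Finset.sum_comm]
    refine Finset.sum_congr rfl fun i _ => ?_
    simp only [ite_and]
    simp
  have hcostrows (σ : Equiv.Perm (Fin N)) :
      cost σ = ∑ i with h i ≠ σ (g i), (D (g i) (σ (g i)) : ℚ) := by
    rw [← Finset.sum_fiberwise _ g]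
    refine Finset.sum_congr rfl fun G _ => ?_
    rw [Finset.filter_filter, Finset.sum_congr rfl fun i hi => by
      rw [(Finset.mem_filter.1 hi).2.2], Finset.sum_const, nsmul_eq_mul, mul_comm]
    congr 1
    rw [sub_eq_iff_eq_add, ← hg G]
    norm_cast
    rw [← Finset.card_filter_add_card_filter_not (fun i => h i ≠ σ G), Finset.filter_filter,
      Finset.filter_filter]
    simp only [hν, ne_eq, not_not]
    congr 2
    ext i
    simp only [Finset.mem_filter, Finset.mem_univ, true_and]
    constructor
    · rintro ⟨rfl, h2⟩; exact ⟨h2, rfl⟩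
    · rintro ⟨h2, rfl⟩; exact ⟨rfl, h2⟩
  obtain ⟨σ, hσ⟩ : ∃ σ, cost σ ≤ ∑ σ, w σ * cost σ := by
    by_contra! hcon
    have h1 : ∑ σ, w σ * (∑ σ, w σ * cost σ) < ∑ σ, w σ * cost σ := by
      obtain ⟨σ, -, hσ⟩ := Finset.exists_ne_zero_of_sum_ne_zero (hw1.trans_ne one_ne_zero)
      exact Finset.sum_lt_sum (fun σ _ => mul_le_mul_of_nonneg_left (hcon σ).le (hw σ))
        ⟨σ, Finset.mem_univ _, mul_lt_mul_of_pos_left (hcon σ) (lt_of_le_of_ne (hw σ) hσ.symm)⟩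
    rw [← Finset.sum_mul, hw1, one_mul] at h1
    exact lt_irrefl _ h1
  refine ⟨σ, ?_⟩
  have h1 := (hσ.trans hsum.le).trans hle
  rw [hrows, hcostrows, div_mul_eq_mul_div, le_div_iff₀ (by positivity)] at h1
  have h2 : ((c - 1 : ℕ) : ℚ) = c - 1 := by rw [Nat.cast_sub hc, Nat.cast_one]
  rw [← h2] at h1
  rw [mul_comm]
  exact_mod_cast h1

end Blocks

/-! ### Moving fair clusters as a whole -/

section Exchange
variable {ρ κ : Type} [Fintype ρ] [DecidableEq ρ] [DecidableEq κ] {n N : ℕ}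

theorem card_filter_comp_swap (γ : ρ → κ) (b : ρ → Fin N) {w x : ρ} (hwx : γ w = γ x)
    (F : Fin N) (a : κ) :
    (Finset.univ.filter fun i => b (Equiv.swap w x i) = F ∧ γ i = a).card =
      (Finset.univ.filter fun i => b i = F ∧ γ i = a).card := by
  have hγ (i : ρ) : γ (Equiv.swap w x i) = γ i := by
    by_cases h1 : i = w
    · rw [h1, Equiv.swap_apply_left, hwx]
    · by_cases h2 : i = x
      · rw [h2, Equiv.swap_apply_right, hwx]
      · rw [Equiv.swap_apply_of_ne_of_ne h1 h2]
  rw [← Finset.card_map (Equiv.swap w x).toEmbedding]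
  congr 1
  ext i
  simp only [Finset.mem_map_equiv, Finset.mem_filter, Finset.mem_univ, true_and, Equiv.symm_swap,
    Equiv.swap_apply_self, hγ]

/-- The rows with property `P` are brought to their targets `τ`, one after the other, by exchanging
the blocks of two rows of the same color. If the row `w` takes the place of the row `x`, the latter
can travel to the old place of `w` via the new place of `w` and `w` itself, so that the total cost
grows by at most twice the distance between `w` and its target. -/
theorem exists_exchange (γ : ρ → κ) (M : ρ → Fin n → ℕ) (cen : Fin N → Fin n → ℕ) (P : ρ → Prop)
    [DecidablePred P] (τ b : ρ → Fin N)
    (h : ∀ F a, (Finset.univ.filter fun i => (P i ∧ τ i = F) ∧ γ i = a).card ≤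
      (Finset.univ.filter fun i => b i = F ∧ γ i = a).card) :
    ∃ b' : ρ → Fin N, (∀ F a, (Finset.univ.filter fun i => b' i = F ∧ γ i = a).card =
      (Finset.univ.filter fun i => b i = F ∧ γ i = a).card) ∧ (∀ i, P i → b' i = τ i) ∧
      ∑ i, hammingDist (M i) (cen (b' i)) ≤ ∑ i, hammingDist (M i) (cen (b i)) +
        2 * ∑ i with P i ∧ b i ≠ τ i, hammingDist (M i) (cen (τ i)) := by
  induction hk : (Finset.univ.filter fun i => P i ∧ b i ≠ τ i).card using Nat.strong_induction_on
    generalizing b with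
  | _ k ih =>
    by_cases hbad : ∃ w, P w ∧ b w ≠ τ w
    · obtain ⟨w, hw, hwτ⟩ := hbad
      obtain ⟨x, hxb, hxγ, hx⟩ : ∃ x, b x = τ w ∧ γ x = γ w ∧ ¬ (P x ∧ τ x = τ w) := by
        by_contra! hcon
        have h1 := h (τ w) (γ w)
        have h2 : (Finset.univ.filter fun i => b i = τ w ∧ γ i = γ w) ⊂
            Finset.univ.filter fun i => (P i ∧ τ i = τ w) ∧ γ i = γ w := by
          refine Finset.ssubset_iff_subset_ne.2 ⟨fun i hi => ?_, fun heq => ?_⟩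
          · simp only [Finset.mem_filter, Finset.mem_univ, true_and] at hi ⊢
            exact ⟨hcon i hi.1 hi.2, hi.2⟩
          · have : w ∈ Finset.univ.filter fun i => (P i ∧ τ i = τ w) ∧ γ i = γ w := by simp [hw]
            rw [← heq] at this
            simp only [Finset.mem_filter, Finset.mem_univ, true_and] at this
            exact hwτ this.1
        exact absurd (Finset.card_lt_card h2) (by omega)
      have hwx : w ≠ x := fun h => hwτ (h ▸ hxb)
      set b₁ : ρ → Fin N := fun i => b (Equiv.swap w x i) with hb₁
      have hb₁w : b₁ w = τ w := by simp [hb₁, hxb]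
      have hb₁x : b₁ x = b w := by simp [hb₁]
      have hb₁o (i : ρ) (h1 : i ≠ w) (h2 : i ≠ x) : b₁ i = b i := by
        simp [hb₁, Equiv.swap_apply_of_ne_of_ne h1 h2]
      have hcount (F : Fin N) (a : κ) := card_filter_comp_swap γ b hxγ.symm F a
      have hsub : (Finset.univ.filter fun i => P i ∧ b₁ i ≠ τ i) ⊆
          (Finset.univ.filter fun i => P i ∧ b i ≠ τ i).erase w := by
        intro i hi
        simp only [Finset.mem_filter, Finset.mem_univ, true_and, Finset.mem_erase] at hi ⊢
        have h1 : i ≠ w := by rintro rfl; exact hi.2 hb₁w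
        refine ⟨h1, hi.1, ?_⟩
        by_cases h2 : i = x
        · rw [h2, hxb]
          exact fun h => hx ⟨h2 ▸ hi.1, h.symm⟩
        · rw [← hb₁o i h1 h2]; exact hi.2
      have hmem : w ∈ Finset.univ.filter fun i => P i ∧ b i ≠ τ i := by simp [hw, hwτ]
      have hlt : (Finset.univ.filter fun i => P i ∧ b₁ i ≠ τ i).card < k := by
        rw [← hk]
        exact (Finset.card_le_card hsub).trans_lt (Finset.card_erase_lt_of_mem hmem)
      obtain ⟨b', h1, h2, h3⟩ := ih _ hlt b₁ (fun F a => (h F a).trans (hcount F a).ge) rfl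
      refine ⟨b', fun F a => (h1 F a).trans (hcount F a), h2, h3.trans ?_⟩
      have h4 : ∑ i with P i ∧ b₁ i ≠ τ i, hammingDist (M i) (cen (τ i)) +
          hammingDist (M w) (cen (τ w)) ≤ ∑ i with P i ∧ b i ≠ τ i,
              hammingDist (M i) (cen (τ i)) := by
        rw [← Finset.sum_erase_add _ _ hmem]
        exact Nat.add_le_add_right (Finset.sum_le_sum_of_subset hsub) _
      have split (c : ρ → Fin N) : ∑ i, hammingDist (M i) (cen (c i)) =
          ∑ i ∈ Finset.univ \ {w, x}, hammingDist (M i) (cen (c i)) +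
            (hammingDist (M w) (cen (c w)) + hammingDist (M x) (cen (c x))) := by
        rw [← Finset.sum_pair (f := fun i => hammingDist (M i) (cen (c i))) hwx,
          Finset.sum_sdiff (Finset.subset_univ _)]
      have h5 : ∑ i ∈ Finset.univ \ {w, x}, hammingDist (M i) (cen (b₁ i)) =
          ∑ i ∈ Finset.univ \ {w, x}, hammingDist (M i) (cen (b i)) := by
        refine Finset.sum_congr rfl fun i hi => ?_
        simp only [Finset.mem_sdiff, Finset.mem_insert, Finset.mem_singleton, not_or] at hi
        rw [hb₁o i hi.2.1 hi.2.2]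
      rw [split b₁, split b, h5, hb₁w, hb₁x, hxb]
      have h6 := hammingDist_triangle (M x) (cen (τ w)) (cen (b w))
      have h7 := hammingDist_triangle (cen (τ w)) (M w) (cen (b w))
      rw [hammingDist_comm (cen (τ w)) (M w)] at h7
      omega
    · push Not at hbad
      exact ⟨b, fun _ _ => rfl, hbad, Nat.le_add_right _ _⟩

end Exchange

section Goal
variable {m n c : ℕ}

/-- The number of rows of a color in a fairlet. -/
def fairletCount (γ : Fin m → Fin c) (a : Fin c) : ℕ :=
  colorCount γ a / Finset.univ.gcd (colorCount γ)

theorem gcd_mul_fairletCount (γ : Fin m → Fin c) (a : Fin c) :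
    Finset.univ.gcd (colorCount γ) * fairletCount γ a = colorCount γ a :=
  Nat.mul_div_cancel' (Finset.gcd_dvd (Finset.mem_univ a))

theorem sum_fairletCount (γ : Fin m → Fin c) (hm : 0 < m) :
    ∑ a, fairletCount γ a = fairletSize γ := by
  refine Nat.eq_of_mul_eq_mul_left (gcd_pos γ hm) ?_
  rw [Finset.mul_sum]
  simp only [gcd_mul_fairletCount]
  rw [← card_eq_sum_colorCount, mul_comm, fairletSize_mul_gcd]

theorem exists_fairletCount_pos (γ : Fin m → Fin c) (hm : 0 < m) : ∃ a, 0 < fairletCount γ a := by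
  by_contra! h
  have h1 := sum_fairletCount γ hm
  have h2 := fairletSize_pos γ hm
  rw [Finset.sum_eq_zero fun a _ => by have := h a; omega] at h1
  omega

variable {ι : Type} [DecidableEq ι]

theorem card_eq_sum_card_color (γ : Fin m → Fin c) (S : Finset (Fin m)) :
    S.card = ∑ a, (S.filter fun i => γ i = a).card :=
  Finset.card_eq_sum_card_fiberwise fun _ _ => Finset.mem_coe.2 (Finset.mem_univ _)

/-- The parts of a fair partition consist of entire fairlets, since the numbers of rows of the
colors in a fairlet have no common divisor. -/
theorem FairPartition.exists_mul {γ : Fin m → Fin c} (hm : 0 < m) {Λ : Fin m → ι}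
    (h : FairPartition γ Λ) (ℓ : ι) :
    ∃ p, ∀ a, (Finset.univ.filter fun i => Λ i = ℓ ∧ γ i = a).card = p * fairletCount γ a := by
  set S := (Finset.univ.filter fun i => Λ i = ℓ).card
  have hg := gcd_pos γ hm
  have hc := fairletSize_pos γ hm
  have h1 (a : Fin c) : (Finset.univ.filter fun i => Λ i = ℓ ∧ γ i = a).card * fairletSize γ =
      fairletCount γ a * S := by
    refine Nat.eq_of_mul_eq_mul_right hg ?_
    rw [mul_assoc, fairletSize_mul_gcd, mul_right_comm, mul_comm (fairletCount γ a),
      gcd_mul_fairletCount]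
    have := h ℓ a
    rwa [Fintype.card_fin] at this
  have h2 : fairletSize γ ∣ S := by
    have h3 : fairletSize γ ∣ Finset.univ.gcd fun a => fairletCount γ a * S :=
      Finset.dvd_gcd fun a _ => ⟨_, by rw [← h1 a, mul_comm]⟩
    obtain ⟨a, ha⟩ := exists_fairletCount_pos γ hm
    have h4 : Finset.univ.gcd (fairletCount γ) = 1 := by
      refine Finset.gcd_div_eq_one (s := Finset.univ) (f := colorCount γ) (i := a)
          (Finset.mem_univ _) ?_
      rw [← gcd_mul_fairletCount]
      positivity
    rw [Finset.gcd_mul_right, h4] at h3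
    simpa using h3
  obtain ⟨p, hp⟩ := h2
  refine ⟨p, fun a => Nat.eq_of_mul_eq_mul_right hc ?_⟩
  rw [h1, hp]
  ring

theorem FairPartition.of_exists_mul {γ : Fin m → Fin c} (hm : 0 < m) {Λ : Fin m → ι}
    (h : ∀ ℓ, ∃ p, ∀ a, (Finset.univ.filter fun i => Λ i = ℓ ∧ γ i = a).card =
        p * fairletCount γ a) :
    FairPartition γ Λ := by
  intro ℓ a
  obtain ⟨p, hp⟩ := h ℓ
  have h1 : (Finset.univ.filter fun i => Λ i = ℓ).card = p * fairletSize γ := by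
    rw [card_eq_sum_card_color γ]
    simp only [Finset.filter_filter, hp]
    rw [← Finset.mul_sum, sum_fairletCount γ hm]
  have h2 : (Finset.univ.filter fun i => γ i = a).card = colorCount γ a := rfl
  rw [hp, h1, h2, Fintype.card_fin, ← gcd_mul_fairletCount]
  linear_combination (p * fairletCount γ a) * (fairletSize_mul_gcd γ).symm

/-- The cluster of the row `i` of `M` is fair. -/
def InFairCluster (γ : Fin m → Fin c) (M : Fin m → Fin n → ℕ) (i : Fin m) : Prop :=
  ∀ a, (Finset.univ.filter fun j => M j = M i ∧ γ j = a).card * Fintype.card (Fin m) =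
    (Finset.univ.filter fun j => γ j = a).card * (Finset.univ.filter fun j => M j = M i).card

theorem InFairCluster.congr {γ : Fin m → Fin c} {M : Fin m → Fin n → ℕ} {i j : Fin m}
    (h : M i = M j) : InFairCluster γ M i ↔ InFairCluster γ M j := by
  unfold InFairCluster; rw [h]

open Classical in
/-- The fair clusters together with the set of all other rows form a fair partition. More
generally, the other rows may be partitioned arbitrarily into fair parts. -/
theorem fairPartition_sum {γ : Fin m → Fin c} {M : Fin m → Fin n → ℕ} {κ : Fin m → ι}
    (h : FairPartition γ fun i => (decide (InFairCluster γ M i), κ i)) :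
    FairPartition γ fun i =>
      (if InFairCluster γ M i then Sum.inl (M i) else Sum.inr (κ i) : (Fin n → ℕ) ⊕ ι) := by
  rintro (v | x) a
  · by_cases hv : ∃ i, InFairCluster γ M i ∧ M i = v
    · obtain ⟨i, hi, rfl⟩ := hv
      have h1 (j : Fin m) : (if InFairCluster γ M j then Sum.inl (M j) else Sum.inr (κ j) :
          (Fin n → ℕ) ⊕ ι) = Sum.inl (M i) ↔ M j = M i := by
        split
        · simp
        · next h =>
          simp only [reduceCtorEq, false_iff]
          exact fun hj => h ((InFairCluster.congr hj).2 hi)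
      simp only [h1]
      exact hi a
    · have h1 (j : Fin m) : (if InFairCluster γ M j then Sum.inl (M j) else Sum.inr (κ j) :
          (Fin n → ℕ) ⊕ ι) ≠ Sum.inl v := by
        split
        · next h => exact fun hj => hv ⟨j, h, Sum.inl_injective hj⟩
        · simp
      simp [h1]
  · have h1 (j : Fin m) : (if InFairCluster γ M j then Sum.inl (M j) else Sum.inr (κ j) :
          (Fin n → ℕ) ⊕ ι) = Sum.inr x ↔ (decide (InFairCluster γ M j), κ j) = (false, x) := by
      split
      · next h => simp [h]
      · next h => simp [h]
    simp only [h1]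
    exact h (false, x) a

open Classical in
theorem fairPartition_fairClusters (γ : Fin m → Fin c) (M : Fin m → Fin n → ℕ) :
    FairPartition γ fun i => if InFairCluster γ M i then some (M i) else none := by
  refine .of_ne none fun ℓ hℓ a => ?_
  obtain ⟨v, rfl⟩ := Option.ne_none_iff_exists'.1 hℓ
  by_cases hv : ∃ i, InFairCluster γ M i ∧ M i = v
  · obtain ⟨i, hi, rfl⟩ := hv
    have h1 (j : Fin m) : (if InFairCluster γ M j then some (M j) else none) = some (M i) ↔
        M j = M i := by
      split
      · simp
      · next h =>
        simp only [reduceCtorEq, false_iff]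
        exact fun hj => h ((InFairCluster.congr hj).2 hi)
    simp only [h1]
    exact hi a
  · have h1 (j : Fin m) : (if InFairCluster γ M j then some (M j) else none) ≠ some v := by
      split
      · next h => exact fun hj => hv ⟨j, h, Option.some_injective _ hj⟩
      · simp
    simp [h1]

open Classical in
/-- The structured approximate solutions: for every fair matrix `A` there is an assignment `κ` of
the rows of `M` to rows of `M`, with at most as many values as `A` has distinct rows, such that
the rows outside of the fair clusters are partitioned into fair sets, and with cost at most
`4 - 2 / c̃` times the cost of `A`. (The fair clusters may be split by `κ`; since all of them are
fair, each of them can be moved as a whole to the nearest value of `κ`.) -/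
theorem exists_structured_assignment {γ : Fin m → Fin c} (hm : 0 < m) (M A : Fin m → Fin n → ℕ)
    (hA : FairPartition γ A) : ∃ κ : Fin m → Fin n → ℕ, (∀ i, ∃ j, κ i = M j) ∧
      (Finset.univ.image κ).card ≤ (Finset.univ.image A).card ∧
      FairPartition γ (fun i => (if InFairCluster γ M i then Sum.inl (M i) else Sum.inr (κ i) :
        (Fin n → ℕ) ⊕ (Fin n → ℕ))) ∧
      ((∑ i, hammingDist (M i) (κ i) : ℕ) : ℚ) ≤
        (4 - 2 / (fairletSize γ : ℚ)) * (∑ i, hammingDist (M i) (A i) : ℕ) := by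
  set P : Fin m → Prop := InFairCluster γ M with hP
  set N := Finset.univ.gcd (colorCount γ) with hN
  have hcp := fairletSize_pos γ hm
  have hφ := exists_fairletCount_pos γ hm
  have hγ (a : Fin c) : (Finset.univ.filter fun i => γ i = a).card = N * fairletCount γ a :=
    (gcd_mul_fairletCount γ a).symm
  obtain ⟨g, hg, hgM⟩ := exists_blocks hγ hφ ((fairPartition_fairClusters γ M).exists_mul hm)
  obtain ⟨b, hb, hbA⟩ := exists_blocks hγ hφ (hA.exists_mul hm)
  have hsize {h : Fin m → Fin N} (hh : ∀ G a, (Finset.univ.filter fun i => h i = G ∧ γ i = a).card =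
      fairletCount γ a) (G : Fin N) : (Finset.univ.filter fun i => h i = G).card =
          fairletSize γ := by
    rw [card_eq_sum_card_color γ, ← sum_fairletCount γ hm]
    simp only [Finset.filter_filter, hh]
  -- representatives of the blocks
  have hrep {h : Fin m → Fin N} (hh : ∀ G a, (Finset.univ.filter fun i => h i = G ∧ γ i = a).card =
      fairletCount γ a) (G : Fin N) : ∃ i, h i = G := by
    have := hsize hh G
    obtain ⟨i, hi⟩ := Finset.card_pos.1 (this ▸ hcp)
    exact ⟨i, (Finset.mem_filter.1 hi).2⟩
  choose rg hrg using hrep hg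
  choose rb hrb using hrep hb
  set cen : Fin N → Fin n → ℕ := fun F => A (rb F) with hcen
  have hcenA (i : Fin m) : cen (b i) = A i := hbA _ _ (hrb (b i))
  have hrgM (i : Fin m) : (P (rg (g i)) ↔ P i) ∧ (P i → M (rg (g i)) = M i) := by
    have h1 := hgM _ _ (hrg (g i))
    simp only [← hP] at h1
    by_cases h2 : P (rg (g i)) <;> by_cases h3 : P i <;> simp [h2, h3] at h1 ⊢
    exact h1
  set D : Fin N → Fin N → ℕ := fun G F =>
    if P (rg G) then hammingDist (M (rg G)) (cen F) else 0 with hD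
  have hDi (i : Fin m) (F : Fin N) : D (g i) F = if P i then hammingDist (M i) (cen F) else 0 := by
    simp only [hD, (hrgM i).1]
    split
    · next h => rw [(hrgM i).2 h]
    · rfl
  obtain ⟨σ, hσ⟩ := exists_matching hcp g b (hsize hg) (hsize hb) D
  have hinj (i : Fin m) (F : Fin N) : σ (g i) = F ↔ g i = σ.symm F := by
    rw [Equiv.eq_symm_apply]
  have hcountP (F : Fin N) (a : Fin c) :
      (Finset.univ.filter fun i => (P i ∧ σ (g i) = F) ∧ γ i = a).card =
        if P (rg (σ.symm F)) then fairletCount γ a else 0 := by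
    split
    · next h =>
      rw [← hg (σ.symm F) a]
      congr 1
      ext i
      simp only [Finset.mem_filter, Finset.mem_univ, true_and, hinj]
      constructor
      · rintro ⟨⟨-, h1⟩, h2⟩; exact ⟨h1, h2⟩
      · rintro ⟨h1, h2⟩
        rw [← h1] at h
        exact ⟨⟨(hrgM i).1.1 h, h1⟩, h2⟩
    · next h =>
      rw [Finset.card_eq_zero, Finset.filter_eq_empty_iff]
      rintro i - ⟨⟨h1, h2⟩, -⟩
      rw [hinj] at h2
      rw [← h2] at h
      exact h ((hrgM i).1.2 h1)
  obtain ⟨b', hb', hbP, hcost⟩ := exists_exchange γ M cen P (fun i => σ (g i)) b fun F a => by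
    rw [hcountP, hb]
    split <;> omega
  simp only [hb] at hb'
  -- every row of `A` is replaced by the nearest row of `M`
  have hu : ∀ v : Fin n → ℕ, ∃ j : Fin m, ∀ i, hammingDist v (M j) ≤ hammingDist v (M i) := by
    intro v
    obtain ⟨j, -, hj⟩ := Finset.exists_min_image Finset.univ (fun i => hammingDist v (M i))
      ⟨⟨0, hm⟩, Finset.mem_univ _⟩
    exact ⟨j, fun i => hj i (Finset.mem_univ i)⟩
  choose u hu using hu
  refine ⟨fun i => M (u (cen (b' i))), fun i => ⟨_, rfl⟩, ?_, ?_, ?_⟩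
  · have h1 : Finset.univ.image (fun i => M (u (cen (b' i)))) ⊆
        (Finset.univ.image A).image fun v => M (u v) := by
      intro x hx
      obtain ⟨i, -, rfl⟩ := Finset.mem_image.1 hx
      exact Finset.mem_image_of_mem _ (Finset.mem_image_of_mem _ (Finset.mem_univ _))
    exact (Finset.card_le_card h1).trans Finset.card_image_le
  · have h1 : FairPartition γ fun i => (decide (P i), b' i) := by
      refine .of_exists_mul hm ?_
      rintro ⟨p, F⟩
      have h2 (a : Fin c) : (Finset.univ.filter fun i => (decide (P i), b' i) = (true, F) ∧
          γ i = a).card =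
          if P (rg (σ.symm F)) then fairletCount γ a else 0 := by
        rw [← hcountP]
        congr 1
        ext i
        simp only [Finset.mem_filter, Finset.mem_univ, true_and, Prod.mk.injEq, decide_eq_true_eq]
        constructor
        · rintro ⟨⟨h1, h2⟩, h3⟩; exact ⟨⟨h1, by rw [← hbP i h1, h2]⟩, h3⟩
        · rintro ⟨⟨h1, h2⟩, h3⟩; exact ⟨⟨h1, by rw [hbP i h1, h2]⟩, h3⟩
      have h3 (a : Fin c) : (Finset.univ.filter fun i => (decide (P i), b' i) = (true, F) ∧
          γ i = a).card +
          (Finset.univ.filter fun i => (decide (P i), b' i) = (false, F) ∧ γ i = a).card =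
          fairletCount γ a := by
        rw [← hb' F a, ← Finset.card_filter_add_card_filter_not
          (s := Finset.univ.filter fun i => b' i = F ∧ γ i = a) (fun i => P i),
              Finset.filter_filter,
          Finset.filter_filter]
        refine congrArg₂ (fun x y : ℕ => x + y) ?_ ?_ <;>
            (congr 1; ext i; simp [and_comm, and_left_comm])
      cases p with
      | true =>
        by_cases h : P (rg (σ.symm F))
        · exact ⟨1, fun a => by rw [h2, if_pos h, one_mul]⟩
        · exact ⟨0, fun a => by rw [h2, if_neg h, zero_mul]⟩
      | false =>
        by_cases h : P (rg (σ.symm F))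
        · refine ⟨0, fun a => ?_⟩
          have := h3 a
          rw [h2, if_pos h] at this
          omega
        · refine ⟨1, fun a => ?_⟩
          have := h3 a
          rw [h2, if_neg h] at this
          omega
    exact fairPartition_sum (h1.comp fun x => (x.1, M (u (cen x.2))))
  · have h1 : ∑ i, hammingDist (M i) (M (u (cen (b' i)))) ≤
        ∑ i, hammingDist (M i) (cen (b' i)) + ∑ i,
            hammingDist (cen (b' i)) (M (u (cen (b' i)))) := by
      rw [← Finset.sum_add_distrib]
      exact Finset.sum_le_sum fun i _ => hammingDist_triangle _ _ _
    have h2 : ∑ i, hammingDist (cen (b' i)) (M (u (cen (b' i)))) ≤ ∑ i,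
        hammingDist (M i) (A i) := by
      have h3 (h : Fin m → Fin N) (hh : ∀ G a,
          (Finset.univ.filter fun i => h i = G ∧ γ i = a).card =
          fairletCount γ a) : ∑ i, hammingDist (cen (h i)) (M (u (cen (h i)))) =
          ∑ F, fairletSize γ * hammingDist (cen F) (M (u (cen F))) := by
        rw [← Finset.sum_fiberwise _ h]
        refine Finset.sum_congr rfl fun F _ => ?_
        rw [Finset.sum_congr rfl fun i hi => by rw [(Finset.mem_filter.1 hi).2], Finset.sum_const,
          smul_eq_mul, hsize hh]
      rw [h3 b' hb', ← h3 b hb]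
      refine Finset.sum_le_sum fun i _ => ?_
      rw [hammingDist_comm (M i), ← hcenA i]
      exact hu _ i
    have h3 : ∑ i with P i ∧ b i ≠ σ (g i), hammingDist (M i) (cen (σ (g i))) =
        ∑ i with b i ≠ σ (g i), D (g i) (σ (g i)) := by
      simp only [hDi]
      rw [← Finset.sum_filter, Finset.filter_filter]
      simp only [and_comm]
    have h4 : ∑ i, D (g i) (b i) ≤ ∑ i, hammingDist (M i) (A i) := by
      refine Finset.sum_le_sum fun i _ => ?_
      rw [hDi, hcenA]
      split
      · exact le_rfl
      · exact Nat.zero_le _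
    simp only [hcenA] at hcost
    rw [h3] at hcost
    set S := ∑ i with b i ≠ σ (g i), D (g i) (σ (g i))
    set O := ∑ i, hammingDist (M i) (A i)
    have h5 : fairletSize γ * S ≤ (fairletSize γ - 1) * O := hσ.trans (Nat.mul_le_mul_left _ h4)
    have h6 : ((fairletSize γ : ℚ)) * S ≤ ((fairletSize γ : ℚ) - 1) * O := by
      rw [← Nat.cast_one, ← Nat.cast_sub hcp]
      exact_mod_cast h5
    have h7 : ∑ i, hammingDist (M i) (M (u (cen (b' i)))) ≤ 2 * O + 2 * S := by omega
    have h8 : (0 : ℚ) < fairletSize γ := by exact_mod_cast hcp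
    calc ((∑ i, hammingDist (M i) (M (u (cen (b' i)))) : ℕ) : ℚ) ≤ ((2 * O + 2 * S : ℕ) : ℚ) := by
          exact_mod_cast h7
      _ = 2 * O + 2 * S := by push_cast; ring
      _ ≤ 2 * O + 2 * (((fairletSize γ : ℚ) - 1) * O / fairletSize γ) := by
          gcongr
          rw [le_div_iff₀ h8, mul_comm]
          exact h6
      _ = _ := by field_simp; ring

end Goal

/-! ### Advice that repairs the unfair groups -/

section Repair
variable {m : ℕ}

/-- The list of records for rows `τ`, colors `γ` and groups `Λ`. -/
def records (τ : Fin m → Row) (γ : Fin m → Data) (Λ : Fin m → Label) : List Rec :=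
  List.ofFn fun i => ((i : ℕ), τ i, γ i, Λ i)

theorem labelColors_records (τ : Fin m → Row) (γ : Fin m → Data) (Λ : Fin m → Label) :
    labelColors (records τ γ Λ) = List.ofFn fun i => (Λ i, γ i) := by
  simp only [labelColors, records, List.map_ofFn]
  rfl

theorem exists_transfer_eq {τ : Fin m → Row} {γ : Fin m → Data} {Λ : Fin m → Label}
    {src dst : Label} {a : Data} {i₁ : Fin m} (h₁ : Λ i₁ = src) (h₂ : home (τ i₁) = src)
    (h₃ : γ i₁ = a) : ∃ i₀, Λ i₀ = src ∧ home (τ i₀) = src ∧ γ i₀ = a ∧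
      transfer (records τ γ Λ) src dst a = records τ γ (Function.update Λ i₀ dst) := by
  unfold transfer
  set l := (records τ γ Λ).filter fun x => decide (x.label = src) && decide (home x.row = src) &&
    decide (x.color = a) with hl
  have hmem (x : Rec) : x ∈ l ↔ ∃ i : Fin m, ((i : ℕ), τ i, γ i, Λ i) = x ∧ Λ i = src ∧
      home (τ i) = src ∧
      γ i = a := by
    simp only [hl, List.mem_filter, records, List.mem_ofFn', Set.mem_range, Bool.and_eq_true,
      decide_eq_true_eq, and_assoc]
    constructor
    · rintro ⟨⟨i, rfl⟩, h⟩; exact ⟨i, rfl, h⟩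
    · rintro ⟨i, rfl, h⟩; exact ⟨⟨i, rfl⟩, h⟩
  cases hx : l.head? with
  | none =>
    rw [List.head?_eq_none_iff] at hx
    have := (hmem ((i₁ : ℕ), τ i₁, γ i₁, Λ i₁)).2 ⟨i₁, rfl, h₁, h₂, h₃⟩
    simp [hx] at this
  | some x =>
    obtain ⟨i₀, rfl, h4, h5, h6⟩ := (hmem x).1 (List.mem_of_head? hx)
    refine ⟨i₀, h4, h5, h6, ?_⟩
    simp only [Option.elim, records, List.map_ofFn]
    congr 1
    funext i
    simp only [Function.comp, Rec.idx, Rec.setLabel, Fin.val_inj]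
    by_cases h : i = i₀
    · subst h; simp
    · simp [h]

theorem FairPartition.comp_perm {ρ ι κ : Type*} [Fintype ρ] [DecidableEq ι] [DecidableEq κ]
    {γ : ρ → κ} {Λ : ρ → ι} (h : FairPartition γ Λ) (π : Equiv.Perm ρ) (hπ : ∀ i, γ (π i) = γ i) :
    FairPartition γ fun i => Λ (π i) := by
  intro ℓ a
  have h1 : (Finset.univ.filter fun i => Λ (π i) = ℓ ∧ γ i = a).card =
      (Finset.univ.filter fun i => Λ i = ℓ ∧ γ i = a).card := by
    rw [← Finset.card_map π.toEmbedding]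
    congr 1
    ext i
    have := hπ (π.symm i)
    rw [Equiv.apply_symm_apply] at this
    simp [Finset.mem_map_equiv, this]
  have h2 : (Finset.univ.filter fun i => Λ (π i) = ℓ).card =
      (Finset.univ.filter fun i => Λ i = ℓ).card := by
    rw [← Finset.card_map π.toEmbedding]
    congr 1
    ext i
    simp [Finset.mem_map_equiv]
  rw [h1, h2]
  exact h ℓ a

theorem home_injective : Function.Injective home := fun _ _ h => (Prod.ext_iff.1 h).1

/-- Suitable advice leads to a fair partition that agrees with the goal `β` up to permutations of
identical rows, except for rows that are still at home. An imbalance of colors `a`, `b` in a group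
`ℓ` means that, in comparison with `β`, there are too many rows of color `a` or too few rows of
color `b` in `ℓ`; so there is a row that has to leave or to enter this group. -/
theorem exists_repair (names : List Row) (τ : Fin m → Row) (γ : Fin m → Data) (H : ℕ)
    (Λ β : Fin m → Label) (hβ : FairPartition γ β) (hΛ : ∀ i, Λ i = home (τ i) ∨ Λ i = β i)
    (hres : ∀ i, β i ≠ home (τ i) →
      (∃ j ≤ H, resolve names j = β i) ∧ ∃ j ≤ H, resolve names j = home (τ i)) :
    ∃ l : List (Bool × ℕ), l.length ≤ (Finset.univ.filter fun i => Λ i ≠ β i).card ∧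
      (∀ c ∈ l, c.2 ≤ H) ∧ ∃ (Λ' : Fin m → Label) (π : Equiv.Perm (Fin m)), FairPartition γ Λ' ∧
        repair names (records τ γ Λ) l = records τ γ Λ' ∧ (∀ i, τ (π i) = τ i ∧ γ (π i) = γ i) ∧
        ∀ i, Λ' i = home (τ i) ∨ Λ' i = β (π i) := by
  induction hk : (Finset.univ.filter fun i => Λ i ≠ β i).card using Nat.strong_induction_on
    generalizing Λ β with
  | _ k ih =>
  by_cases hfair : FairPartition γ Λ
  · exact ⟨[], by simp, by simp, Λ, 1, hfair, rfl, fun i => ⟨rfl, rfl⟩, hΛ⟩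
  · rw [← imbalances_ofFn_eq_nil_iff, ← labelColors_records τ] at hfair
    obtain ⟨v, V, hv⟩ := List.exists_cons_of_ne_nil hfair
    have himb := mem_imbalances_ofFn (Λ := Λ) (γ := γ) (v := v) (by
      rw [← labelColors_records τ, hv]; exact List.mem_cons_self)
    obtain ⟨ℓ, a, b⟩ := v
    dsimp only at himb
    -- a row that has to move, and the advice that moves it
    obtain ⟨i₁, src, dst, col, c, hc, h1, h2, h3, h4, h5, hstep⟩ : ∃ (i₁ : Fin m) (src dst : Label)
        (col : Data) (c : Bool × ℕ), c.2 ≤ H ∧ Λ i₁ = src ∧ home (τ i₁) = src ∧ γ i₁ = col ∧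
        β i₁ = dst ∧ src ≠ dst ∧ repairStep names (records τ γ Λ) c =
          transfer (records τ γ Λ) src dst col := by
      have hstep (c : Bool × ℕ) : repairStep names (records τ γ Λ) c =
          if c.1 = true then transfer (records τ γ Λ) ℓ (resolve names c.2) a
          else transfer (records τ γ Λ) (resolve names c.2) ℓ b := by
        unfold repairStep
        rw [hv]
        rfl
      by_cases ha : ∃ i, (Λ i = ℓ ∧ γ i = a) ∧ β i ≠ ℓ
      · obtain ⟨i, ⟨hi, hia⟩, hiβ⟩ := ha
        have hhome : Λ i = home (τ i) := (hΛ i).resolve_right fun h => hiβ (h ▸ hi)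
        have hne : β i ≠ home (τ i) := by rw [← hhome, hi]; exact hiβ
        obtain ⟨⟨j, hj, hjβ⟩, -⟩ := hres i hne
        exact ⟨i, ℓ, β i, a, (true, j), hj, hi, hhome ▸ hi, hia, rfl, hiβ.symm, by
          rw [hstep, if_pos rfl, hjβ]⟩
      · by_cases hb : ∃ i, (β i = ℓ ∧ γ i = b) ∧ Λ i ≠ ℓ
        · obtain ⟨i, ⟨hi, hib⟩, hiΛ⟩ := hb
          have hhome : Λ i = home (τ i) := (hΛ i).resolve_right fun h => hiΛ (h ▸ hi)
          have hne : β i ≠ home (τ i) := by rw [← hhome, hi]; exact hiΛ.symm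
          obtain ⟨-, j, hj, hjh⟩ := hres i hne
          exact ⟨i, home (τ i), ℓ, b, (false, j), hj, hhome, rfl, hib, hi, hhome ▸ hiΛ, by
            rw [hstep, if_neg (by simp), hjh]⟩
        · push Not at ha hb
          exfalso
          have h1 : (Finset.univ.filter fun x => Λ x = ℓ ∧ γ x = a).card ≤
              (Finset.univ.filter fun x => β x = ℓ ∧ γ x = a).card :=
            Finset.card_le_card fun i hi => by
              simp only [Finset.mem_filter, Finset.mem_univ, true_and] at hi ⊢
              exact ⟨ha i hi, hi.2⟩
          have h2 : (Finset.univ.filter fun x => β x = ℓ ∧ γ x = b).card ≤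
              (Finset.univ.filter fun x => Λ x = ℓ ∧ γ x = b).card :=
            Finset.card_le_card fun i hi => by
              simp only [Finset.mem_filter, Finset.mem_univ, true_and] at hi ⊢
              exact ⟨hb i hi, hi.2⟩
          have h3 := hβ ℓ a
          have h4 := hβ ℓ b
          have hm : 0 < Fintype.card (Fin m) := by
            refine Nat.pos_of_ne_zero fun h0 => ?_
            rw [Fintype.card_eq_zero_iff] at h0
            simp at himb
          generalize (Finset.univ.filter fun x => Λ x = ℓ ∧ γ x = a).card = xa at *
          generalize (Finset.univ.filter fun x => Λ x = ℓ ∧ γ x = b).card = xb at *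
          generalize (Finset.univ.filter fun x => β x = ℓ ∧ γ x = a).card = ya at *
          generalize (Finset.univ.filter fun x => β x = ℓ ∧ γ x = b).card = yb at *
          generalize (Finset.univ.filter fun x => γ x = a).card = ta at *
          generalize (Finset.univ.filter fun x => γ x = b).card = tb at *
          have h5 : ya * tb = yb * ta := by
            refine Nat.eq_of_mul_eq_mul_right hm ?_
            linear_combination tb * h3 + ta * h4.symm
          have h6 : xa * tb ≤ xb * ta := (Nat.mul_le_mul_right _ h1).trans
            (h5.le.trans (Nat.mul_le_mul_right _ h2))
          omega
    obtain ⟨i₀, g1, g2, g3, htr⟩ := exists_transfer_eq (dst := dst) h1 h2 h3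
    have hτ : τ i₀ = τ i₁ := home_injective (g2.trans h2.symm)
    have hγ : γ i₀ = γ i₁ := g3.trans h3.symm
    set s := Equiv.swap i₀ i₁ with hs
    have hinv {X : Type} (f : Fin m → X) (hf : f i₀ = f i₁) (i : Fin m) : f (s i) = f i := by
      by_cases e1 : i = i₀
      · rw [e1, hs, Equiv.swap_apply_left, hf]
      · by_cases e2 : i = i₁
        · rw [e2, hs, Equiv.swap_apply_right, hf]
        · rw [hs, Equiv.swap_apply_of_ne_of_ne e1 e2]
    set Λ₁ := Function.update Λ i₀ dst with hΛ₁
    have hΛ₁0 : Λ₁ i₀ = dst := Function.update_self _ _ _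
    have hΛ₁o (i : Fin m) (hi : i ≠ i₀) : Λ₁ i = Λ i := Function.update_of_ne hi _ _
    have hs0 : s i₀ = i₁ := Equiv.swap_apply_left _ _
    have hs1 : s i₁ = i₀ := Equiv.swap_apply_right _ _
    have hso (i : Fin m) (e1 : i ≠ i₀) (e2 : i ≠ i₁) : s i = i := Equiv.swap_apply_of_ne_of_ne e1 e2
    have hlt : (Finset.univ.filter fun i => Λ₁ i ≠ β (s i)).card < k := by
      rw [← hk]
      refine Finset.card_lt_card (Finset.ssubset_iff_of_subset (fun i hi => ?_) |>.2 ?_)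
      · simp only [Finset.mem_filter, Finset.mem_univ, true_and] at hi ⊢
        by_cases e1 : i = i₀
        · rw [e1, hΛ₁0, hs0, h4] at hi; exact absurd rfl hi
        · by_cases e2 : i = i₁
          · rw [e2, h1, h4]; exact h5
          · rwa [hΛ₁o i e1, hso i e1 e2] at hi
      · by_cases e : β i₀ = src
        · refine ⟨i₁, by simp [h1, h4, h5], ?_⟩
          simp only [Finset.mem_filter, Finset.mem_univ, true_and, not_not]
          have e1 : i₁ ≠ i₀ := by rintro rfl; exact h5 (e.symm.trans h4)
          rw [hΛ₁o _ e1, hs1, e, h1]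
        · refine ⟨i₀, by simp [g1, Ne.symm e], ?_⟩
          simp [hΛ₁0, hs0, h4]
    obtain ⟨l, hl, hlH, Λ', π, hf, hrep, hπ, hΛ'⟩ := ih _ hlt Λ₁ (fun i => β (s i))
      (hβ.comp_perm s (hinv γ hγ)) (fun i => by
        by_cases e1 : i = i₀
        · right; rw [e1, hΛ₁0, hs0, h4]
        · rw [hΛ₁o i e1]
          by_cases e2 : i = i₁
          · left; rw [e2, h1, h2]
          · rw [hso i e1 e2]; exact hΛ i)
      (fun i hi => by
        have := hres (s i)
        rw [hinv τ hτ] at this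
        exact this hi) rfl
    refine ⟨c :: l, ?_, ?_, Λ', π.trans s, hf, ?_, fun i => ?_, hΛ'⟩
    · rw [List.length_cons]; omega
    · intro d hd
      rcases List.mem_cons.1 hd with rfl | hd
      · exact hc
      · exact hlH d hd
    · rw [repair, List.foldl_cons, hstep, htr]
      exact hrep
    · rw [Equiv.trans_apply, hinv τ hτ, hinv γ hγ]
      exact hπ i

end Repair

/-! ### Advice that selects the centers -/

section Close
variable {m : ℕ} {τ : Fin m → Row} {γ : Fin m → Data} {Λ : Fin m → Label}

theorem rowDist_self (t : Row) : rowDist t t = 0 := by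
  simp only [rowDist, List.countP_eq_zero, decide_eq_true_eq, not_not]
  intro p hp
  induction t with
  | nil => simp at hp
  | cons a t ih =>
    rw [List.zip_cons_cons, List.mem_cons] at hp
    rcases hp with rfl | hp
    · rfl
    · exact ih hp

/-- The home group of `t` consists precisely of the rows equal to `t`. -/
def Pure (τ : Fin m → Row) (Λ : Fin m → Label) (t : Row) : Prop := ∀ i, Λ i = home t ↔ τ i = t

open Classical in
theorem weight_records (t : Row) : weight (records τ γ Λ) t =
    if Pure τ Λ t then (Finset.univ.filter fun i => τ i = t).card else 0 := by
  unfold weight records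
  rw [countP_ofFn]
  refine if_congr ?_ (congrArg Finset.card (Finset.filter_congr fun i _ => decide_eq_true_iff)) rfl
  simp only [List.all_eq_true, List.forall_mem_ofFn_iff, decide_eq_true_iff, decide_eq_decide]
  rfl

theorem minDist_le {t y : Row} {Y : List Row} (hy : y ∈ Y) : minDist t Y ≤ rowDist t y := by
  unfold minDist
  cases h : Y.argmin (rowDist t) with
  | none => rw [List.argmin_eq_none] at h; simp [h] at hy
  | some z => exact List.le_of_mem_argmin hy h

theorem exists_minDist_eq {t : Row} {Y : List Row} (hY : Y ≠ []) :
    ∃ y ∈ Y, minDist t Y = rowDist t y := by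
  unfold minDist
  cases h : Y.argmin (rowDist t) with
  | none => exact absurd (List.argmin_eq_none.1 h) hY
  | some z => exact ⟨z, List.argmin_mem h, rfl⟩

open Classical in
/-- The centers that are used by the assignment `s` of centers to groups for other rows than the
equal ones. -/
noncomputable def usedCenters (τ : Fin m → Row) (Λ : Fin m → Label) (s : Label → Row) :
    Finset Row :=
  (Finset.univ.filter fun i => ¬ (Pure τ Λ (s (Λ i)) ∧ Λ i = home (s (Λ i)))).image fun i => s (Λ i)

open Classical in
/-- Suitable advice leads to a set of at most `r` centers that is as good as the set `C`. If the
undecided center `t` that is cheapest to close belongs to `C`, but is not used for other rows, then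
it can be closed in place of some `v` outside of `C`: the rows equal to `t` move to their
nearest center, and the rows equal to `v`, whose cost was at least as high, stay where they are.
Every step decreases `2 * (number of centers - r) + (number of undecided used centers)`. -/
theorem exists_closeCenters {r : ℕ} (B : ℕ) (Q S : List Row) (C : Finset Row)
    (s : Label → Row) (hnd : (Q ++ S).Nodup) (hS : ∀ x ∈ S, x ∈ C) (hC : ∀ x ∈ C, x ∈ Q ++ S)
    (hcard : C.card ≤ r) (hs : ∀ i, s (Λ i) ∈ C) (hB : ∑ i, rowDist (τ i) (s (Λ i)) ≤ B) :
    ∃ l : List Bool, l.length ≤ 2 * (Q.length + S.length - r) +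
        (usedCenters τ Λ s \ S.toFinset).card ∧
      (l.foldl (closeStep (records τ γ Λ) r) (Q, S)).1.length +
        (l.foldl (closeStep (records τ γ Λ) r) (Q, S)).2.length ≤ r ∧
      ∃ s' : Label → Row, (∀ i, s' (Λ i) ∈ (l.foldl (closeStep (records τ γ Λ) r) (Q, S)).1 ++
        (l.foldl (closeStep (records τ γ Λ) r) (Q, S)).2) ∧
        ∑ i, rowDist (τ i) (s' (Λ i)) ≤ B := by
  induction hk : 2 * (Q.length + S.length - r) + (usedCenters τ Λ s \ S.toFinset).card
    using Nat.strong_induction_on generalizing Q S C s with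
  | _ k ih =>
  by_cases hle : Q.length + S.length ≤ r
  · exact ⟨[], by simp, hle, s, fun i => hC _ (hs i), hB⟩
  obtain ⟨hQnd, hSnd, hdisj⟩ := List.nodup_append.1 hnd
  set R := records τ γ Λ with hR
  set X := Q ++ S with hX
  have hXlen : X.length = Q.length + S.length := List.length_append
  obtain ⟨t, ht⟩ : ∃ t, Q.argmin (closeCost R X) = some t := by
    refine Option.ne_none_iff_exists'.1 fun h => ?_
    rw [List.argmin_eq_none] at h
    subst h
    have : S.length ≤ C.card := by
      rw [← List.toFinset_card_of_nodup hSnd]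
      exact Finset.card_le_card fun x hx => hS x (List.mem_toFinset.1 hx)
    simp at hle
    omega
  have htQ : t ∈ Q := List.argmin_mem ht
  have htS : t ∉ S := fun h => hdisj t htQ t h rfl
  set Q' := Q.filter fun c => decide (¬ c = t) with hQ'
  have hstep (b : Bool) : closeStep R r (Q, S) b = (Q', if b = true then S else t :: S) := by
    unfold closeStep
    rw [if_neg hle]
    simp only
    rw [ht]
    rfl
  have hQ'len : Q'.length + 1 = Q.length := by
    have h1 := List.length_eq_countP_add_countP (fun c => decide (¬ c = t)) (l := Q)
    have h2 : List.countP (fun c => decide ¬ (decide (¬ c = t)) = true) Q = 1 := by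
      have := List.count_eq_one_of_mem hQnd htQ
      rw [List.count] at this
      rw [← this]
      congr 1
      funext c
      by_cases hc : c = t <;> simp [hc]
    rw [hQ', ← List.countP_eq_length_filter]
    omega
  have hmemQ' (x : Row) : x ∈ Q' ↔ x ∈ Q ∧ x ≠ t := by simp [hQ']
  have hnd' : (Q' ++ S).Nodup := List.nodup_append.2
    ⟨hQnd.filter _, hSnd, fun x hx y hy => hdisj x ((hmemQ' x).1 hx).1 y hy⟩
  have hmemX' {x : Row} (hx : x ∈ X) (hxt : x ≠ t) : x ∈ Q' ++ S := by
    rcases List.mem_append.1 hx with h | h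
    · exact List.mem_append_left _ ((hmemQ' x).2 ⟨h, hxt⟩)
    · exact List.mem_append_right _ h
  -- one step that closes `t`, followed by the steps given by induction
  have close (C' : Finset Row) (s' : Label → Row) (hS' : ∀ x ∈ S, x ∈ C')
      (hC' : ∀ x ∈ C', x ∈ Q' ++ S) (hcard' : C'.card ≤ r) (hs' : ∀ i, s' (Λ i) ∈ C')
      (hB' : ∑ i, rowDist (τ i) (s' (Λ i)) ≤ B)
      (hused : (usedCenters τ Λ s' \ S.toFinset).card ≤ (usedCenters τ Λ s \ S.toFinset).card + 1) :
      ∃ l : List Bool, l.length ≤ k ∧ (l.foldl (closeStep R r) (Q, S)).1.length +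
        (l.foldl (closeStep R r) (Q, S)).2.length ≤ r ∧
      ∃ s' : Label → Row, (∀ i, s' (Λ i) ∈ (l.foldl (closeStep R r) (Q, S)).1 ++
        (l.foldl (closeStep R r) (Q, S)).2) ∧ ∑ i, rowDist (τ i) (s' (Λ i)) ≤ B := by
    obtain ⟨l, hl, h⟩ := ih _ (by omega) Q' S C' s' hnd' hS' hC' hcard' hs' hB' rfl
    refine ⟨true :: l, by rw [List.length_cons]; omega, ?_⟩
    rw [List.foldl_cons, hstep, if_pos rfl]
    exact h
  by_cases htC : t ∈ C
  swap
  · exact close C s hS (fun x hx => hmemX' (hC x hx) fun h => htC (h ▸ hx)) hcard hs hB (by omega)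
  by_cases htu : t ∈ usedCenters τ Λ s
  · have h1 : usedCenters τ Λ s \ (t :: S).toFinset = (usedCenters τ Λ s \ S.toFinset).erase t := by
      ext x
      simp only [List.toFinset_cons, Finset.mem_sdiff, Finset.mem_insert, not_or, Finset.mem_erase]
      tauto
    have h2 : t ∈ usedCenters τ Λ s \ S.toFinset := by
      rw [Finset.mem_sdiff, List.mem_toFinset]; exact ⟨htu, htS⟩
    have h3 := Finset.card_erase_add_one h2
    rw [← h1] at h3
    obtain ⟨l, hl, h⟩ := ih (2 * (Q'.length + (t :: S).length - r) +
        (usedCenters τ Λ s \ (t :: S).toFinset).card) (by rw [List.length_cons]; omega)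
      Q' (t :: S) C s
      (List.nodup_append.2 ⟨hQnd.filter _, List.nodup_cons.2 ⟨htS, hSnd⟩, fun x hx y hy => by
        rcases List.mem_cons.1 hy with rfl | hy
        · exact ((hmemQ' x).1 hx).2
        · exact hdisj x ((hmemQ' x).1 hx).1 y hy⟩)
      (fun x hx => by
        rcases List.mem_cons.1 hx with rfl | hx
        · exact htC
        · exact hS x hx)
      (fun x hx => by
        by_cases hxt : x = t
        · exact List.mem_append_right _ (hxt ▸ List.mem_cons_self)
        · rcases List.mem_append.1 (hmemX' (hC x hx) hxt) with h | h
          · exact List.mem_append_left _ h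
          · exact List.mem_append_right _ (List.mem_cons_of_mem _ h)) hcard hs hB rfl
    rw [List.length_cons] at hl
    refine ⟨false :: l, by rw [List.length_cons]; omega, ?_⟩
    rw [List.foldl_cons, hstep, if_neg (by simp)]
    exact h
  -- the center `t` is exchanged for `v`
  have hown (i : Fin m) (hi : s (Λ i) = t) : Pure τ Λ t ∧ Λ i = home t := by
    by_contra hcon
    refine htu (Finset.mem_image.2 ⟨i, Finset.mem_filter.2 ⟨Finset.mem_univ _, ?_⟩, hi⟩)
    rw [hi]
    exact hcon
  have hout : ∃ v ∈ X, v ∉ C := by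
    by_contra! hcon
    have : X.length ≤ C.card := by
      rw [← List.toFinset_card_of_nodup hnd]
      exact Finset.card_le_card fun x hx => hcon x (List.mem_toFinset.1 hx)
    omega
  have hfilter {x : Row} : x ∈ X.filter (fun c => decide (¬ c = t)) ↔ x ∈ X ∧ x ≠ t := by simp
  obtain ⟨s₀, hs₀, hs₀d⟩ := exists_minDist_eq (t := t) (Y := X.filter fun c => decide (¬ c = t)) (by
    obtain ⟨v, hv, hvC⟩ := hout
    exact List.ne_nil_of_mem (hfilter.2 ⟨hv, fun h => hvC (h ▸ htC)⟩))
  rw [hfilter] at hs₀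
  obtain ⟨v, hvX, hvC, hv₀⟩ : ∃ v ∈ X, v ∉ C ∧ (s₀ ∈ C ∨ s₀ = v) := by
    by_cases h : s₀ ∈ C
    · obtain ⟨v, hv, hvC⟩ := hout
      exact ⟨v, hv, hvC, .inl h⟩
    · exact ⟨s₀, hs₀.1, h, .inr rfl⟩
  have hvQ : v ∈ Q := (List.mem_append.1 hvX).resolve_right fun h => hvC (hS v h)
  have hvt : v ≠ t := fun h => hvC (h ▸ htC)
  have hcost : closeCost R X t ≤ closeCost R X v := List.le_of_mem_argmin hvQ ht
  set s₁ : Label → Row := fun ℓ => if Pure τ Λ t ∧ ℓ = home t then s₀ else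
    if Pure τ Λ v ∧ ℓ = home v then v else s ℓ with hs₁
  have hs₁C (i : Fin m) : s₁ (Λ i) ∈ insert v (C.erase t) := by
    simp only [hs₁]
    split_ifs with h1 h2
    · rcases hv₀ with h | h
      · exact Finset.mem_insert_of_mem (Finset.mem_erase.2 ⟨hs₀.2, h⟩)
      · exact h ▸ Finset.mem_insert_self _ _
    · exact Finset.mem_insert_self _ _
    · exact Finset.mem_insert_of_mem (Finset.mem_erase.2 ⟨fun h => h1 (hown i h), hs i⟩)
  refine close (insert v (C.erase t)) s₁ ?_ ?_ ?_ hs₁C ?_ ?_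
  · intro x hx
    exact Finset.mem_insert_of_mem (Finset.mem_erase.2 ⟨fun h => htS (h ▸ hx), hS x hx⟩)
  · intro x hx
    rcases Finset.mem_insert.1 hx with rfl | hx
    · exact hmemX' hvX hvt
    · exact hmemX' (hC x (Finset.mem_of_mem_erase hx)) (Finset.ne_of_mem_erase hx)
  · have := Finset.card_insert_le v (C.erase t)
    have := Finset.card_erase_add_one htC
    omega
  · have hpoint (i : Fin m) : rowDist (τ i) (s₁ (Λ i)) +
        (if Pure τ Λ v ∧ τ i = v then minDist v (X.filter fun c => decide (¬ c = v)) else 0) ≤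
        rowDist (τ i) (s (Λ i)) +
        (if Pure τ Λ t ∧ τ i = t then minDist t (X.filter fun c => decide (¬ c = t)) else 0) := by
      simp only [hs₁]
      by_cases h1 : Pure τ Λ t ∧ Λ i = home t
      · have hτ : τ i = t := (h1.1 i).1 h1.2
        rw [if_pos h1, hτ, if_neg (fun h => hvt h.2.symm), if_pos ⟨h1.1, rfl⟩, hs₀d]
        omega
      · rw [if_neg h1]
        by_cases h2 : Pure τ Λ v ∧ Λ i = home v
        · have hτ : τ i = v := (h2.1 i).1 h2.2
          rw [if_pos h2, hτ, if_pos ⟨h2.1, rfl⟩, rowDist_self, zero_add]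
          refine le_add_right (minDist_le ?_)
          simp only [List.mem_filter, decide_eq_true_eq]
          exact ⟨hC _ (hs i), fun h => hvC (h ▸ hs i)⟩
        · rw [if_neg h2, if_neg fun h => h2 ⟨h.1, (h.1 i).2 h.2⟩]
          omega
    have hsum (u : Row) : ∑ i, (if Pure τ Λ u ∧ τ i = u then
        minDist u (X.filter fun c => decide (¬ c = u)) else 0) = closeCost R X u := by
      rw [closeCost, hR, weight_records]
      by_cases h : Pure τ Λ u
      · simp only [h, true_and, if_true]
        rw [← Finset.sum_filter, Finset.sum_const, smul_eq_mul]
      · simp [h]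
    have h1 := Finset.sum_le_sum fun i (_ : i ∈ Finset.univ) => hpoint i
    rw [Finset.sum_add_distrib, Finset.sum_add_distrib, hsum, hsum] at h1
    omega
  · have h1 : usedCenters τ Λ s₁ ⊆ insert s₀ (usedCenters τ Λ s) := by
      intro x hx
      obtain ⟨i, hi, rfl⟩ := Finset.mem_image.1 hx
      replace hi := (Finset.mem_filter.1 hi).2
      simp only [hs₁] at hi ⊢
      split_ifs at hi ⊢ with e1 e2
      · exact Finset.mem_insert_self _ _
      · exact absurd e2 hi
      · exact Finset.mem_insert_of_mem (Finset.mem_image.2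
          ⟨i, Finset.mem_filter.2 ⟨Finset.mem_univ _, hi⟩, rfl⟩)
    calc (usedCenters τ Λ s₁ \ S.toFinset).card
        ≤ (insert s₀ (usedCenters τ Λ s \ S.toFinset)).card := by
          refine Finset.card_le_card fun x hx => ?_
          rw [Finset.mem_sdiff] at hx
          rcases Finset.mem_insert.1 (h1 hx.1) with h | h
          · exact h ▸ Finset.mem_insert_self _ _
          · exact Finset.mem_insert_of_mem (Finset.mem_sdiff.2 ⟨h, hx.2⟩)
      _ ≤ _ := Finset.card_insert_le _ _

theorem groupCost_records (ℓ : Label) (c : Row) :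
    groupCost (records τ γ Λ) ℓ c = ∑ i with Λ i = ℓ, rowDist (τ i) c := by
  have key : ∀ (l : List Rec), ((l.filter fun x => decide (x.label = ℓ)).map fun x =>
      rowDist x.row c).sum =
      (l.map fun x => if x.label = ℓ then rowDist x.row c else 0).sum := by
    intro l
    induction l with
    | nil => rfl
    | cons x l ih =>
      by_cases h : x.label = ℓ
      · rw [List.filter_cons_of_pos (by simpa using h)]; simp [h, ih]
      · rw [List.filter_cons_of_neg (by simpa using h)]; simp [h, ih]
  rw [groupCost, key, records, List.map_ofFn, List.sum_ofFn, Finset.sum_filter]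
  rfl

/-- Every group is assigned to a center that is at least as good as the one given by `s`. -/
theorem exists_assign_eq {X : List Row} {s : Label → Row} (hs : ∀ i, s (Λ i) ∈ X) :
    ∃ f : Label → Row, (∀ i, f (Λ i) ∈ X) ∧ assign (records τ γ Λ) X =
        List.ofFn (fun i => f (Λ i)) ∧
      ∑ i, rowDist (τ i) (f (Λ i)) ≤ ∑ i, rowDist (τ i) (s (Λ i)) := by
  set f : Label → Row := fun ℓ => (X.argmin (groupCost (records τ γ Λ) ℓ)).getD [] with hf
  have hX (i : Fin m) (ℓ : Label) : X.argmin (groupCost (records τ γ Λ) ℓ) = some (f ℓ) := by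
    cases h : X.argmin (groupCost (records τ γ Λ) ℓ) with
    | none =>
      rw [List.argmin_eq_none] at h
      have := hs i
      simp [h] at this
    | some x => simp [hf, h]
  refine ⟨f, fun i => List.argmin_mem (hX i _), ?_, ?_⟩
  · rw [assign]
    conv_lhs => rw [records, List.map_ofFn]
    congr 1
    funext i
    show (X.argmin (groupCost (records τ γ Λ) (Λ i))).getD (τ i) = _
    rw [hX i]
    rfl
  · rw [← Finset.sum_fiberwise_of_maps_to (t := Finset.univ.image Λ) (g := Λ) (fun i _ =>
      Finset.mem_image_of_mem _ (Finset.mem_univ i)) (fun i => rowDist (τ i) (f (Λ i))),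
      ← Finset.sum_fiberwise_of_maps_to (t := Finset.univ.image Λ) (g := Λ) (fun i _ =>
      Finset.mem_image_of_mem _ (Finset.mem_univ i)) (fun i => rowDist (τ i) (s (Λ i)))]
    refine Finset.sum_le_sum fun ℓ hℓ => ?_
    obtain ⟨j, -, rfl⟩ := Finset.mem_image.1 hℓ
    have h1 := List.le_of_mem_argmin (hs j) (hX j (Λ j))
    rw [groupCost_records, groupCost_records] at h1
    rw [Finset.sum_congr rfl fun i hi => by rw [(Finset.mem_filter.1 hi).2]]
    refine h1.trans (le_of_eq ?_)
    exact Finset.sum_congr rfl fun i hi => by rw [(Finset.mem_filter.1 hi).2]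

end Close

/-! ### Completeness of the search -/

section Advice
variable {m : ℕ} {τ : Fin m → Row} {γ : Fin m → Data} {κ : Fin m → Row} {names : List Row}

/-- The goal of the repair: a fair partition `β` of the rows into groups, and an assignment `s` of
centers to groups. Groups outside of `names` stay at home. The rows of a group in `names` go to the
group of their center `κ i`, which is its home if this home is in `names`, and a new group
otherwise. -/
theorem exists_goal [NeZero m]
    (hμ : FairPartition γ fun i => (if τ i ∈ names then Sum.inr (κ i) else Sum.inl (τ i) :
        Row ⊕ Row)) :
    ∃ (β : Fin m → Label) (s : Label → Row), FairPartition γ β ∧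
      (∀ i, β i ≠ home (τ i) → κ i ≠ τ i ∧
        (∃ j ≤ names.length + (Finset.univ.filter fun i => κ i ≠ τ i).card, resolve names j = β i) ∧
        ∃ j ≤ names.length + (Finset.univ.filter fun i => κ i ≠ τ i).card,
          resolve names j = home (τ i)) ∧
      (∀ t, s (home t) ∈ Finset.univ.image κ ∧
        ∀ i, rowDist t (s (home t)) ≤ rowDist t (κ i)) ∧
      ∀ i, (τ i ∉ names ∧ β i = home (τ i)) ∨
        (τ i ∈ names ∧ κ i ∈ names ∧ β i = home (κ i)) ∨
        (τ i ∈ names ∧ κ i ∉ names ∧ (β i).2 ≠ 0 ∧ s (β i) = κ i) := by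
  set E : Finset Row := (Finset.univ.filter fun i => κ i ≠ τ i).image κ with hE
  set L := E.toList with hL
  have hLlen : L.length ≤ (Finset.univ.filter fun i => κ i ≠ τ i).card := by
    rw [hL, Finset.length_toList]; exact Finset.card_image_le
  have hnear (t : Row) : ∃ c ∈ Finset.univ.image κ, ∀ i, rowDist t c ≤ rowDist t (κ i) := by
    obtain ⟨c, hc, h⟩ := Finset.exists_min_image (Finset.univ.image κ) (rowDist t)
      ⟨κ 0, Finset.mem_image_of_mem _ (Finset.mem_univ _)⟩
    exact ⟨c, hc, fun i => h _ (Finset.mem_image_of_mem _ (Finset.mem_univ i))⟩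
  choose near hnear hnear' using hnear
  set new : Row → Label := fun c => ([], names.length + L.idxOf c + 1) with hnew
  set f : Row ⊕ Row → Label := Sum.elim home fun c => if c ∈ names then home c else new c with hf
  set s : Label → Row := fun ℓ => match ℓ with
    | (t, 0) => near t
    | (_, j + 1) => L.getD (j - names.length) [] with hs
  have hmemL {i : Fin m} (h1 : τ i ∈ names) (h2 : κ i ∉ names) : κ i ∈ L := by
    rw [hL, Finset.mem_toList]
    exact Finset.mem_image_of_mem _ (Finset.mem_filter.2 ⟨Finset.mem_univ _, fun h => h2 (h ▸ h1)⟩)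
  have hhome {t : Row} (ht : t ∈ names) : ∃ j ≤ names.length +
      (Finset.univ.filter fun i => κ i ≠ τ i).card,
      resolve names j = home t := by
    obtain ⟨j, hj, rfl⟩ := List.getElem_of_mem ht
    exact ⟨j, by omega, by rw [resolve, List.getElem?_eq_getElem hj]; rfl⟩
  refine ⟨fun i => f (if τ i ∈ names then Sum.inr (κ i) else Sum.inl (τ i)), s, hμ.comp f,
    fun i hi => ?_, fun t => ⟨hnear t, hnear' t⟩, fun i => ?_⟩
  · dsimp only at hi ⊢
    by_cases h1 : τ i ∈ names
    swap
    · rw [if_neg h1] at hi; exact absurd rfl hi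
    simp only [if_pos h1, hf, Sum.elim_inr] at hi ⊢
    by_cases h2 : κ i ∈ names
    · rw [if_pos h2] at hi ⊢
      exact ⟨fun h => hi (by rw [h]), hhome h2, hhome h1⟩
    · rw [if_neg h2] at hi ⊢
      refine ⟨fun h => h2 (h ▸ h1), ⟨names.length + L.idxOf (κ i), ?_, ?_⟩, hhome h1⟩
      · have := List.idxOf_le_length (l := L) (a := κ i)
        omega
      · rw [resolve, List.getElem?_eq_none (by omega)]; rfl
  · dsimp only
    by_cases h1 : τ i ∈ names
    swap
    · exact .inl ⟨h1, by rw [if_neg h1]; rfl⟩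
    right
    simp only [if_pos h1, hf, Sum.elim_inr]
    by_cases h2 : κ i ∈ names
    · exact .inl ⟨h1, h2, if_pos h2⟩
    · refine .inr ⟨h1, h2, ?_, ?_⟩
      · rw [if_neg h2]; exact Nat.succ_ne_zero _
      · rw [if_neg h2]
        show L.getD (names.length + L.idxOf (κ i) - names.length) [] = κ i
        rw [Nat.add_sub_cancel_left, List.getD_eq_getElem _ _
          (List.idxOf_lt_length_iff.2 (hmemL h1 h2)), List.getElem_idxOf]

/-- For every fair way to move the unfair groups to centers `κ i`, there is advice that
leads to a fair partition and an assignment of the parts to centers of at most the same cost. -/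
theorem exists_advice [NeZero m] {Q : List Row} {k r : ℕ} (hκ : ∀ i, ∃ j, κ i = τ j)
    (hμ : FairPartition γ fun i => (if τ i ∈ names then Sum.inr (κ i) else Sum.inl (τ i) :
        Row ⊕ Row))
    (hdist : ∀ i j, rowDist (τ i) (τ j) = 0 → τ i = τ j) (hnames : names.length ≤ 2 * k)
    (hQ : Q.Nodup) (hτQ : ∀ x, x ∈ Q ↔ ∃ i, τ i = x) (hQr : Q.length ≤ r + k)
    (hr : (Finset.univ.image κ).card ≤ r) (hcost : ∑ i, rowDist (τ i) (κ i) ≤ 4 * k) :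
    ∃ (l₁ : List (Bool × ℕ)) (l₂ : List Bool), l₁.length ≤ 4 * k ∧ (∀ c ∈ l₁, c.2 ≤ 6 * k) ∧
      l₂.length ≤ 12 * k ∧ ∃ (Λ : Fin m → Label) (s : Label → Row), FairPartition γ Λ ∧
      repair names (records τ γ fun i => home (τ i)) l₁ = records τ γ Λ ∧
      (closeCenters (records τ γ Λ) r Q l₂).1.length +
        (closeCenters (records τ γ Λ) r Q l₂).2.length ≤ r ∧
      (∀ i, s (Λ i) ∈ (closeCenters (records τ γ Λ) r Q l₂).1 ++
        (closeCenters (records τ γ Λ) r Q l₂).2) ∧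
      ∑ i, rowDist (τ i) (s (Λ i)) ≤ ∑ i, rowDist (τ i) (κ i) := by
  classical
  obtain ⟨β, s, hβ, hres, hs, hcases⟩ := exists_goal hμ
  set D := Finset.univ.filter fun i => κ i ≠ τ i with hD
  have hDcard : D.card ≤ 4 * k := by
    refine le_trans ?_ hcost
    rw [Finset.card_filter]
    refine Finset.sum_le_sum fun i _ => ?_
    split_ifs with h
    · obtain ⟨j, hj⟩ := hκ i
      rw [hj] at h ⊢
      exact Nat.one_le_iff_ne_zero.2 fun h0 => h (hdist i j h0).symm
    · exact Nat.zero_le _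
  have hsC {t : Row} (ht : t ∈ Finset.univ.image κ) : s (home t) = t := by
    obtain ⟨i, -, rfl⟩ := Finset.mem_image.1 ht
    obtain ⟨h1, h2⟩ := hs (κ i)
    obtain ⟨i', -, h3⟩ := Finset.mem_image.1 h1
    have h4 := h2 i
    rw [rowDist_self] at h4
    obtain ⟨j, hj⟩ := hκ i
    obtain ⟨j', hj'⟩ := hκ i'
    rw [← h3] at h4 ⊢
    rw [hj, hj'] at h4 ⊢
    exact (hdist _ _ (Nat.le_zero.1 h4)).symm
  have hsβ (i : Fin m) : s (β i) ∈ Finset.univ.image κ ∧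
      rowDist (τ i) (s (β i)) ≤ rowDist (τ i) (κ i) := by
    rcases hcases i with ⟨-, h⟩ | ⟨-, -, h⟩ | ⟨-, -, -, h⟩
    · rw [h]; exact ⟨(hs _).1, (hs _).2 i⟩
    · rw [h, hsC (Finset.mem_image_of_mem _ (Finset.mem_univ _))]
      exact ⟨Finset.mem_image_of_mem _ (Finset.mem_univ _), le_rfl⟩
    · rw [h]
      exact ⟨Finset.mem_image_of_mem _ (Finset.mem_univ _), le_rfl⟩
  obtain ⟨l₁, hl₁, hH, Λ, π, hΛ, hrep, hπ, hΛβ⟩ := exists_repair names τ γ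
    (names.length + D.card) (fun i => home (τ i)) β hβ (fun i => .inl rfl) fun i hi => (hres i hi).2
  have hsΛ (i : Fin m) : s (Λ i) ∈ Finset.univ.image κ ∧
      rowDist (τ i) (s (Λ i)) ≤ rowDist (τ (π i)) (κ (π i)) := by
    rcases hΛβ i with h | h
    · rw [h, ← (hπ i).1]; exact ⟨(hs _).1, (hs _).2 (π i)⟩
    · rw [h, ← (hπ i).1]; exact hsβ (π i)
  have hΛfair {i : Fin m} (hi : τ i ∉ names) : Λ i = home (τ i) := by
    rcases hΛβ i with h | h
    · exact h
    · rcases hcases (π i) with ⟨-, h'⟩ | ⟨h', -⟩ | ⟨h', -⟩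
      · rw [h, h', (hπ i).1]
      · exact absurd ((hπ i).1 ▸ h') hi
      · exact absurd ((hπ i).1 ▸ h') hi
  have hpure {t : Row} (ht : t ∉ names) : Pure τ Λ t := by
    refine fun i => ⟨fun h => ?_, fun h => h ▸ hΛfair (h ▸ ht)⟩
    by_cases hi : τ i ∈ names
    · rcases hΛβ i with h' | h'
      · exact home_injective (h'.symm.trans h)
      · rcases hcases (π i) with ⟨h1, -⟩ | ⟨-, h1, h2⟩ | ⟨-, -, h1, -⟩
        · exact absurd hi ((hπ i).1 ▸ h1)
        · exact absurd (home_injective (h2.symm.trans (h'.symm.trans h)) ▸ h1) ht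
        · exact absurd (congrArg Prod.snd (h'.symm.trans h)) h1
    · exact home_injective ((hΛfair hi).symm.trans h)
  have hused : (usedCenters τ Λ s).card ≤ 2 * k + 4 * k + 4 * k := by
    have hsub : usedCenters τ Λ s ⊆ (names.toFinset.image fun t => s (home t)) ∪ D.image κ ∪
        D.image fun i => s (home (τ i)) := by
      intro x hx
      obtain ⟨i, hi, rfl⟩ := Finset.mem_image.1 hx
      replace hi := (Finset.mem_filter.1 hi).2
      simp only [Finset.mem_union, Finset.mem_image, List.mem_toFinset]
      by_cases h1 : τ i ∈ names
      · left
        rcases hΛβ i with h | h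
        · exact .inl ⟨τ i, h1, by rw [h]⟩
        · rcases hcases (π i) with ⟨h2, -⟩ | ⟨-, h2, h3⟩ | ⟨h2, h3, -, h4⟩
          · exact absurd h1 ((hπ i).1 ▸ h2)
          · exact .inl ⟨_, h2, by rw [h, h3]⟩
          · exact .inr ⟨π i, Finset.mem_filter.2 ⟨Finset.mem_univ _, fun h => h3 (h ▸ h2)⟩,
              by rw [h, h4]⟩
      · right
        refine ⟨i, Finset.mem_filter.2 ⟨Finset.mem_univ _, fun h => hi ?_⟩, by rw [hΛfair h1]⟩
        have h2 : s (Λ i) = τ i := by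
          rw [hΛfair h1]
          exact hsC (h ▸ Finset.mem_image_of_mem _ (Finset.mem_univ _))
        rw [h2]
        exact ⟨hpure h1, hΛfair h1⟩
    refine (Finset.card_le_card hsub).trans ((Finset.card_union_le _ _).trans
      (Nat.add_le_add ((Finset.card_union_le _ _).trans (Nat.add_le_add ?_ ?_)) ?_))
    · exact Finset.card_image_le.trans ((List.toFinset_card_le _).trans hnames)
    · exact Finset.card_image_le.trans hDcard
    · exact Finset.card_image_le.trans hDcard
  have hcost' : ∑ i, rowDist (τ i) (s (Λ i)) ≤ ∑ i, rowDist (τ i) (κ i) :=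
    (Finset.sum_le_sum fun i _ => (hsΛ i).2).trans
      (Equiv.sum_comp π fun i => rowDist (τ i) (κ i)).le
  obtain ⟨l₂, hl₂, hlen, s', hs', hcost''⟩ := exists_closeCenters (γ := γ) (r := r) _ Q []
    (Finset.univ.image κ) s (by rwa [List.append_nil]) (by simp) (fun x hx => by
      obtain ⟨i, -, rfl⟩ := Finset.mem_image.1 hx
      obtain ⟨j, hj⟩ := hκ i
      rw [List.append_nil, hτQ]
      exact ⟨j, hj.symm⟩) hr (fun i => (hsΛ i).1) hcost'
  refine ⟨l₁, l₂, hl₁.trans ((Finset.card_le_card fun i hi => ?_).trans hDcard),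
    fun c hc => (hH c hc).trans (by omega), ?_, Λ, s', hΛ, hrep, hlen, hs', hcost''⟩
  · simp only [Finset.mem_filter, Finset.mem_univ, true_and] at hi
    exact Finset.mem_filter.2 ⟨Finset.mem_univ _, (hres i hi.symm).1⟩
  · rw [List.toFinset_nil, Finset.sdiff_empty, List.length_nil] at hl₂
    omega

end Advice

/-- The tree for the given advice. -/
theorem exists_tree (l₁ : List (Bool × ℕ)) (l₂ : List Bool) {H N : ℕ} (hH : ∀ c ∈ l₁, c.2 ≤ H)
    (h₁ : l₁.length + (H + 2) ≤ N) (h₂ : l₂.length + 1 ≤ N) :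
    ∃ x : Data, moveAdvice x = l₁ ∧ closeAdvice x = l₂ ∧ height x ≤ N + 1 := by
  set f : Bool × ℕ → Data := fun c => .node (Data.ofBool c.1)
      (.ofList (List.replicate c.2 .nil)) with hf
  refine ⟨.node (.ofList (l₁.map f)) (.ofList (l₂.map Data.ofBool)), ?_, ?_, ?_⟩
  · simp only [moveAdvice, Data.hd, Data.toList_ofList, List.map_map]
    refine (List.map_congr_left fun c _ => ?_).trans (List.map_id _)
    obtain ⟨b, j⟩ := c
    simp only [Function.comp, hf, Data.tl, Data.toList_ofList, List.length_replicate]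
    cases b <;> simp [Data.ofBool]
  · simp only [closeAdvice, Data.tl, Data.toList_ofList, List.map_map]
    refine (List.map_congr_left fun b _ => ?_).trans (List.map_id _)
    cases b <;> simp [Data.ofBool]
  · have hbool (b : Bool) : height (Data.ofBool b) ≤ 1 := by cases b <;> simp [Data.ofBool, height]
    refine Nat.succ_le_succ (max_le (le_trans ?_ h₁) (le_trans ?_ h₂))
    · have := height_ofList_le (l := l₁.map f) (h := H + 2) fun x hx => by
        obtain ⟨c, hc, rfl⟩ := List.mem_map.1 hx
        have h3 := height_ofList_le (l := List.replicate c.2 Data.nil) (h := 0) fun x hx => by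
          rw [List.eq_of_mem_replicate hx]; rfl
        rw [List.length_replicate] at h3
        have h4 := hbool c.1
        have h5 := hH c hc
        simp only [hf, height]
        omega
      rwa [List.length_map] at this
    · have := height_ofList_le (l := l₂.map Data.ofBool) (h := 1) fun x hx => by
        obtain ⟨b, -, rfl⟩ := List.mem_map.1 hx
        exact hbool b
      rwa [List.length_map] at this

theorem initialRecords_ofFn {m : ℕ} (τ : Fin m → Row) (γ : Fin m → Data) :
    initialRecords (List.ofFn τ) (List.ofFn γ) = records τ γ fun i => home (τ i) := by
  unfold initialRecords records
  rw [zip_ofFn]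
  apply List.ext_getElem <;> simp

theorem mem_unfairRows {m n c : ℕ} {M : Fin m → Fin n → ℕ} {γ : Fin m → Fin c} {t : Row} :
    t ∈ unfairRows (records (fun i => encRow (M i)) (fun i => Data.ofNat (γ i))
      fun i => home (encRow (M i))) ↔ ∃ i, encRow (M i) = t ∧ ¬ InFairCluster γ M i := by
  rw [unfairRows, mem_distinct, labelColors_records]
  have key (i : Fin m) : (∃ v ∈ imbalances
      (List.ofFn fun i => (home (encRow (M i)), Data.ofNat (γ i))),
      v.1 = home (encRow (M i))) ↔ ¬ InFairCluster γ M i := by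
    rw [exists_mem_imbalances_ofFn_iff, not_iff_not]
    simp only [home_injective.eq_iff, encRow_injective.eq_iff]
    constructor
    · intro h a
      have := h (Data.ofNat a)
      simpa only [ofNat_injective.eq_iff, Fin.val_inj] using this
    · intro h a
      by_cases ha : ∃ b : Fin c, Data.ofNat b = a
      · obtain ⟨b, rfl⟩ := ha
        simpa only [ofNat_injective.eq_iff, Fin.val_inj] using h b
      · have : ∀ j, Data.ofNat (γ j) ≠ a := fun j h => ha ⟨_, h⟩
        simp [this]
  constructor
  · intro h
    obtain ⟨v, hv, rfl⟩ := List.mem_map.1 h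
    obtain ⟨p, hp, hpv⟩ := label_mem_of_mem_imbalances hv
    obtain ⟨i, rfl⟩ := (List.mem_ofFn' _ _).1 hp
    exact ⟨i, congrArg Prod.fst hpv, (key i).1 ⟨v, hv, hpv.symm⟩⟩
  · rintro ⟨i, rfl, hi⟩
    obtain ⟨v, hv, h⟩ := (key i).2 hi
    exact List.mem_map.2 ⟨v, hv, congrArg Prod.fst h⟩

theorem card_ne_le_sum_hammingDist {m n : ℕ} (M A : Fin m → Fin n → ℕ) :
    (Finset.univ.filter fun i => M i ≠ A i).card ≤ ∑ i, hammingDist (M i) (A i) := by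
  rw [Finset.card_filter]
  refine Finset.sum_le_sum fun i _ => ?_
  split_ifs with h
  · exact Nat.one_le_iff_ne_zero.2 (hammingDist_ne_zero.2 h)
  · exact Nat.zero_le _

/-- An unfair cluster of `M` loses or gains a row when `M` is edited to a fair matrix `A`. -/
theorem length_unfairRows_le {m n c : ℕ} {M A : Fin m → Fin n → ℕ} {γ : Fin m → Fin c}
    (hA : FairPartition γ A) :
    (unfairRows (records (fun i => encRow (M i)) (fun i => Data.ofNat (γ i))
      fun i => home (encRow (M i)))).length ≤ 2 * ∑ i, hammingDist (M i) (A i) := by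
  set D := Finset.univ.filter fun i => M i ≠ A i with hD
  rw [unfairRows, ← List.toFinset_card_of_nodup (nodup_distinct _), ← unfairRows]
  have hsub : (unfairRows (records (fun i => encRow (M i)) (fun i => Data.ofNat (γ i))
      fun i => home (encRow (M i)))).toFinset ⊆
      (D.image fun i => encRow (M i)) ∪ D.image fun i => encRow (A i) := by
    intro t ht
    rw [List.mem_toFinset, mem_unfairRows] at ht
    obtain ⟨i, rfl, hi⟩ := ht
    by_contra hcon
    simp only [Finset.mem_union, Finset.mem_image, not_or, not_exists, not_and,
      encRow_injective.eq_iff, hD, Finset.mem_filter, Finset.mem_univ, true_and] at hcon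
    have h (j : Fin m) : M j = M i ↔ A j = M i :=
      ⟨fun h => by_contra fun h' => hcon.1 j (fun e => h' (e ▸ h)) h,
        fun h => by_contra fun h' => hcon.2 j (fun e => h' (e.trans h)) h⟩
    refine hi fun a => ?_
    simp only [h]
    exact hA (M i) a
  have h1 : D.card ≤ _ := card_ne_le_sum_hammingDist M A
  refine (Finset.card_le_card hsub).trans ((Finset.card_union_le _ _).trans ?_)
  have h2 := Finset.card_image_le (s := D) (f := fun i => encRow (M i))
  have h3 := Finset.card_image_le (s := D) (f := fun i => encRow (A i))
  omega

theorem card_image_le_add_sum_hammingDist {m n : ℕ} (M A : Fin m → Fin n → ℕ) :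
    (Finset.univ.image M).card ≤ (Finset.univ.image A).card + ∑ i, hammingDist (M i) (A i) := by
  have hsub : Finset.univ.image M ⊆ Finset.univ.image A ∪
      (Finset.univ.filter fun i => M i ≠ A i).image M := by
    intro v hv
    obtain ⟨i, -, rfl⟩ := Finset.mem_image.1 hv
    by_cases h : M i = A i
    · exact Finset.mem_union_left _ (Finset.mem_image.2 ⟨i, Finset.mem_univ _, h.symm⟩)
    · exact Finset.mem_union_right _ (Finset.mem_image_of_mem _
        (Finset.mem_filter.2 ⟨Finset.mem_univ _, h⟩))
  exact (Finset.card_le_card hsub).trans ((Finset.card_union_le _ _).trans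
    (Nat.add_le_add_left (Finset.card_image_le.trans (card_ne_le_sum_hammingDist M A)) _))

theorem mem_of_mem_foldl_closeStep {R : List Rec} {r : ℕ} {x : Row} (l : List Bool)
    (s : List Row × List Row)
    (h : x ∈ (l.foldl (closeStep R r) s).1 ++ (l.foldl (closeStep R r) s).2) : x ∈ s.1 ++ s.2 := by
  induction l generalizing s with
  | nil => exact h
  | cons b l ih =>
    replace h := ih _ h
    unfold closeStep at h
    split at h
    · exact h
    · cases ht : s.1.argmin (closeCost R (s.1 ++ s.2)) with
      | none => rwa [ht] at h
      | some t =>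
        rw [ht] at h
        have hts := List.argmin_mem ht
        simp only [Option.elim, List.mem_append, List.mem_filter] at h ⊢
        rcases h with h | h
        · exact .inl h.1
        · split at h
          · exact .inr h
          · rcases List.mem_cons.1 h with rfl | h
            · exact .inl hts
            · exact .inr h

/-- If there is a solution, then some advice leads to an acceptable candidate. -/
theorem exists_accepted {I : Instance} {A : Matrix (Fin I.m) (Fin I.n) ℕ} (hA : I.IsSolution A) :
    ∃ x : Data, height x ≤ adviceHeight I.k ∧ accept (encRows I.M) I.colors I.k (min I.m I.r)
      (candidate (encRows I.M) I.colors (min I.m I.r) x) = true := by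
  classical
  obtain ⟨hfair, hk, hr⟩ := hA
  have : NeZero I.m := ⟨I.m_pos.ne'⟩
  rw [fairMatrix_iff] at hfair
  obtain ⟨κ, hκ, hκr, hκμ, hκcost⟩ := exists_structured_assignment I.m_pos I.M A hfair
  set τ : Fin I.m → Row := fun i => encRow (I.M i) with hτ
  set g : Fin I.m → Data := fun i => Data.ofNat (I.γ i) with hg
  set names := unfairRows (records τ g fun i => home (τ i)) with hnames
  have hinit : initialRecords (encRows I.M) I.colors = records τ g fun i => home (τ i) :=
    initialRecords_ofFn τ g
  have hginj : Function.Injective fun a : Fin I.c => Data.ofNat a := fun a b h =>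
    Fin.val_injective (ofNat_injective h)
  have hmem (i : Fin I.m) : τ i ∈ names ↔ ¬ InFairCluster I.γ I.M i := by
    refine (mem_unfairRows (M := I.M) (γ := I.γ)).trans ?_
    constructor
    · rintro ⟨j, hj, h⟩
      exact fun h' => h ((InFairCluster.congr (encRow_injective hj)).2 h')
    · exact fun h => ⟨i, rfl, h⟩
  have hμ : FairPartition g fun i =>
      (if τ i ∈ names then Sum.inr (encRow (κ i)) else Sum.inl (τ i) : Row ⊕ Row) := by
    convert (hκμ.comp (Sum.map encRow encRow)).comp_color hginj using 2 with i
    by_cases h : InFairCluster I.γ I.M i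
    · rw [if_pos h, if_neg fun h' => (hmem i).1 h' h]; rfl
    · rw [if_neg h, if_pos ((hmem i).2 h)]; rfl
  have hdist : ∑ i, rowDist (τ i) (encRow (κ i)) = ∑ i, hammingDist (I.M i) (κ i) :=
    Finset.sum_congr rfl fun i _ => rowDist_encRow _ _
  rw [← hdist, ← editCost_eq_sum] at hκcost
  have hkQ : (editCost I.M A : ℚ) ≤ I.k := by exact_mod_cast hk
  have hcost : ∑ i, rowDist (τ i) (encRow (κ i)) ≤ costFactor I.colors * I.k := by
    have h1 : (0 : ℚ) ≤ costFactor I.colors := Nat.cast_nonneg _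
    have h2 : ((∑ i, rowDist (τ i) (encRow (κ i)) : ℕ) : ℚ) ≤ costFactor I.colors * I.k :=
      hκcost.trans (mul_le_mul (le_costFactor I.γ I.m_pos) hkQ (Nat.cast_nonneg _) h1)
    exact_mod_cast h2
  have hfactor : costFactor I.colors ≤ 4 := by
    unfold costFactor; split_ifs <;> omega
  have himage : (Finset.univ.image fun i => encRow (κ i)).card = (Finset.univ.image κ).card := by
    rw [← Finset.card_image_of_injective _ (encRow_injective (n := I.n)), Finset.image_image]
    rfl
  obtain ⟨l₁, l₂, hl₁, hH, hl₂, Λ, s, hΛ, hrep, hlen, hs, hscost⟩ :=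
    exists_advice (τ := τ) (κ := fun i => encRow (κ i)) (names := names)
        (Q := distinct (encRows I.M))
      (k := I.k) (r := min I.m I.r) (fun i => (hκ i).imp fun j h => congrArg encRow h) hμ
      (fun i j h => congrArg encRow (hammingDist_eq_zero.1 ((rowDist_encRow _ _).symm.trans h)))
      ((length_unfairRows_le hfair).trans
          (Nat.mul_le_mul_left 2 ((editCost_eq_sum _ _).symm.trans_le hk))) (nodup_distinct _)
      (fun x => by rw [mem_distinct, encRows, List.mem_ofFn']; rfl)
      (by
        rw [length_distinct_encRows]
        have h1 : distinctRows I.M ≤ distinctRows A + ∑ i, hammingDist (I.M i) (A i) :=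
          card_image_le_add_sum_hammingDist I.M A
        have h3 := (editCost_eq_sum I.M A).symm.trans_le hk
        have h2 : distinctRows I.M ≤ I.m := Finset.card_image_le.trans_eq (Finset.card_fin _)
        omega)
      (by
        rw [himage]
        exact le_min (Finset.card_image_le.trans_eq (Finset.card_fin _)) (hκr.trans hr))
      (hcost.trans (Nat.mul_le_mul_right _ hfactor))
  obtain ⟨x, hx₁, hx₂, hx⟩ := exists_tree l₁ l₂ (N := 12 * I.k + 2) hH (by omega) (by omega)
  refine ⟨x, hx.trans (by unfold adviceHeight; omega), ?_⟩
  set X := (closeCenters (records τ g Λ) (min I.m I.r) (distinct (encRows I.M)) l₂).1 ++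
    (closeCenters (records τ g Λ) (min I.m I.r) (distinct (encRows I.M)) l₂).2 with hX
  obtain ⟨f, hfX, hassign, hfcost⟩ := exists_assign_eq (τ := τ) (γ := g) hs
  have hcand : candidate (encRows I.M) I.colors (min I.m I.r) x = List.ofFn fun i => f (Λ i) := by
    have h1 : repaired (encRows I.M) I.colors x = records τ g Λ := by
      rw [repaired, hinit, hx₁]; exact hrep
    simp only [candidate, centers, h1, hx₂]
    exact hassign
  have hXM {c : Row} (hc : c ∈ X) : ∃ j, c = encRow (I.M j) := by
    have h1 : c ∈ distinct (encRows I.M) := by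
      simpa using mem_of_mem_foldl_closeStep _ _ hc
    rw [mem_distinct, encRows, List.mem_ofFn'] at h1
    obtain ⟨j, rfl⟩ := h1
    exact ⟨j, rfl⟩
  choose j hj' using fun i => hXM (hfX i)
  obtain ⟨B, hBj⟩ : ∃ B : Matrix (Fin I.m) (Fin I.n) ℕ, ∀ i, B i = I.M (j i) :=
    ⟨fun i => I.M (j i), fun _ => rfl⟩
  have hj (i : Fin I.m) : f (Λ i) = encRow (B i) := (hj' i).trans (congrArg encRow (hBj i).symm)
  have hB : candidate (encRows I.M) I.colors (min I.m I.r) x = encRows B := by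
    rw [hcand]
    exact congrArg List.ofFn (funext hj)
  rw [hB, accept_encRows_iff]
  refine ⟨fun i => ⟨j i, hBj i⟩, ?_, ?_, ?_⟩
  · rw [fairMatrix_iff]
    have h1 := hΛ.comp f
    simp only [hj] at h1
    exact h1.of_comp_injective encRow_injective hginj
  · rw [← length_distinct_encRows, ← hB, hcand, length_distinct]
    refine (Finset.card_le_card fun y hy => ?_).trans ((List.toFinset_card_le X).trans
      (List.length_append.trans_le hlen))
    rw [List.mem_toFinset, List.mem_ofFn'] at hy
    obtain ⟨i, rfl⟩ := hy
    exact List.mem_toFinset.2 (hfX i)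
  · rw [editCost_eq_sum]
    refine le_trans (le_of_eq ?_) (hfcost.trans (hscost.trans hcost))
    refine Finset.sum_congr rfl fun i _ => ?_
    rw [hj, hτ, rowDist_encRow]

end FDMC

open FDMC in
theorem theorem4 :
    FDMC.AdmitsApproxFPT (fun I => 5 - 3 / (FDMC.fairletSize I.γ : ℚ)) := by
  obtain ⟨p, f, d, hf, hp⟩ := exists_prog_solve
  refine ⟨p, f, d, hf, fun I => ?_⟩
  obtain ⟨t, ht, hrun⟩ := hp I.input
  have hdig : binaryValue I.input.2.2.1 = I.k := binaryValue_digits I.k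
  have hsize : Enc.enc I.input = I.encode := enc_input I
  rw [hdig, show sz I.input = I.encode.size from congrArg Data.size hsize] at ht
  rw [hsize] at hrun
  have hsolve : solve I.input = firstAccepted (encRows I.M) I.colors I.k (min I.m I.r)
      (treesUpTo (adviceHeight I.k)) := by
    unfold solve search
    rw [hdig]
    simp only [Instance.input, cappedValue_digits, encRows, List.length_ofFn]
  cases h : solve I.input with
  | none =>
    rw [h] at hrun
    refine ⟨none, t, hrun, ht, ?_⟩
    rintro ⟨A, hA⟩
    obtain ⟨x, hx, hacc⟩ := exists_accepted hA
    rw [hsolve, firstAccepted, List.head?_eq_none_iff, List.filter_eq_nil_iff] at h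
    exact h _ (List.mem_map_of_mem (mem_treesUpTo hx)) hacc
  | some l =>
    rw [hsolve, firstAccepted] at h
    have hacc := (List.mem_filter.1 (List.mem_of_head? h)).2
    obtain ⟨A, rfl⟩ := exists_matrix_of_accept hacc
    rw [hsolve, firstAccepted, h, enc_some, enc_encRows] at hrun
    exact ⟨some A, t, hrun, ht, correctAnswer_of_accept (min_le_right _ _) hacc⟩
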